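/- **Setting.** For every $n\ge 1$ let $D_n=\operatorname{diag}(\lambda_n(1),\dots,\lambda_n(n))$ be a real diagonal matrix, $X_n=\frac1{\sqrt n}(x^n_{i,j})_{1\le i,j\le n}$ a Hermitian random matrix, $\varepsilon_n>0$, and $D_n^\varepsilon=D_n+\varepsilon_nX_n$. Assume: (a) the entries $x^n_{i,j}$ are independent up to the symmetry ($i\le j$) and centered, with variances $\sigma_n^2(i,j)=\mathbb E|x^n_{i,j}|^2$, and $\sup_{n,i,j}\mathbb E|x^n_{i,j}|^8<\infty$; (b) there are real functions $f,\sigma_{\mathrm d}$ on $[0,1]$ and $\sigma$ on $[0,1]^2$ such that for all $s\in(0,1]$, as $n\to\infty$, $\lambda_n(\lfloor ns\rfloor)\to f(s)$ and $\sigma_n^2(\lfloor ns\rfloor,\lfloor ns\rfloor)\to\sigma_{\mathrm d}(s)^2$, for all $s\ne t$ in $(0,1]$, $\sigma_n^2(\lfloor ns\rfloor,\lfloor nt\rfloor)\to\sigma^2(s,t)$, and $$\max\{n\varepsilon_n,1\}\ \sup_{1\le i\ne j\le n}\bigl(|\sigma_n^2(i,j)-\sigma^2(i/n,j/n)|+|\lambda_n(i)-f(i/n)|\bigr)\longrightarrow0;$$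 (f) there is a nonempty compact set $\widetilde{\mathcal S}\subset\mathbb R$ with $\max_{1\le i\le n}\operatorname{dist}(\lambda_n(i),\widetilde{\mathcal S})\to0$. Let $(Z_\phi)$ be a centered complex-valued Gaussian field indexed by the $\mathcal C^6$ functions $\phi:\mathbb R\to\mathbb C$ with $$\mathbb E[Z_\phi Z_\psi]=\int_0^1\sigma_{\mathrm d}(t)^2\phi'(f(t))\psi'(f(t))\,dt,\qquad \overline{Z_\psi}=Z_{\overline\psi}.$$ For $z\in\mathbb C\setminus\mathbb R$ put $\varphi_z(x)=\frac1{z-x}$, $Z(z)=Z_{\varphi_z}$, $$B(z)=\int_{[0,1]^2}\frac{\sigma^2(s,t)}{(z-f(s))^2(z-f(t))}\,ds\,dt,\qquad \Delta G_n(z)=\frac1n\operatorname{Tr}(z-D_n^\varepsilon)^{-1}-\frac1n\operatorname{Tr}(z-D_n)^{-1}.$$ **Proposition.** For every $z\in\mathbb C\setminus\mathbb R$, as $n\to\infty$: 1. if $\varepsilon_n\ll n^{-1}$, then $n\varepsilon_n^{-1}\Delta G_n(z)\to Z(z)$ in distribution; 2. if $\varepsilon_n\sim c/n$ with a constant $c>0$,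 then $n\varepsilon_n^{-1}\Delta G_n(z)\to cB(z)+Z(z)$ in distribution; 3. if $n^{-1}\ll\varepsilon_n\ll n^{-1/3}$ and the convergence of the profiles in (b) also has the rate $o((n\varepsilon_n)^{-1})$ in mean, that is, $$n\varepsilon_n\left(\int_{[1/n,1]^2}\bigl|\sigma_n^2(\lfloor ns\rfloor,\lfloor nt\rfloor)-\sigma^2(s,t)\bigr|\,ds\,dt+\int_{1/n}^1\bigl|\lambda_n(\lfloor ns\rfloor)-f(s)\bigr|\,ds\right)\longrightarrow0,$$ then $n\varepsilon_n^{-1}\bigl(\Delta G_n(z)-\varepsilon_n^2B(z)\bigr)\to Z(z)$ in distribution; 4. if $n^{-1}\ll\varepsilon_n\ll1$, then $\varepsilon_n^{-2}\Delta G_n(z)-B(z)\to0$ in probability. -/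

import Mathlib

open MeasureTheory ProbabilityTheory Filter Topology Asymptotics
open scoped ComplexConjugate NNReal ENNReal

noncomputable section

namespace PerturbedDiagonal

/-! ### The matrix model

Indices of `n × n` matrices run over `1, …, n`. The diagonal entries are `lam n i` and the
entries of `√n X_n` are `x n i j`, both used for `1 ≤ i, j ≤ n` only. -/

section Model

variable {Ω : ℕ → Type*} [∀ n, MeasurableSpace (Ω n)]

/-- `D_n = diag(λ_n(1), …, λ_n(n))`. -/
def diagMatrix (lam : ℕ → ℕ → ℝ) (n : ℕ) : Matrix (Finset.Icc 1 n) (Finset.Icc 1 n) ℂ :=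
  Matrix.diagonal fun i => (lam n i : ℂ)

/-- `X_n = n^{-1/2} (x^n_{i,j})`. -/
def noiseMatrix (x : (n : ℕ) → ℕ → ℕ → Ω n → ℂ) (n : ℕ) (ω : Ω n) :
    Matrix (Finset.Icc 1 n) (Finset.Icc 1 n) ℂ :=
  Matrix.of fun i j => ((1 / √(n : ℝ) : ℝ) : ℂ) * x n i j ω

/-- `D_n^ε = D_n + ε_n X_n`. -/
def perturbedMatrix (lam : ℕ → ℕ → ℝ) (x : (n : ℕ) → ℕ → ℕ → Ω n → ℂ) (ε : ℕ → ℝ)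
    (n : ℕ) (ω : Ω n) : Matrix (Finset.Icc 1 n) (Finset.Icc 1 n) ℂ :=
  diagMatrix lam n + (ε n : ℂ) • noiseMatrix x n ω

/-- The normalized resolvent trace `(1/n) Tr (z - M)⁻¹` of an `n × n` matrix. -/
def stieltjes (n : ℕ) (M : Matrix (Finset.Icc 1 n) (Finset.Icc 1 n) ℂ) (z : ℂ) : ℂ :=
  (1 / (n : ℂ)) * Matrix.trace (Matrix.scalar (Finset.Icc 1 n) z - M)⁻¹

/-- `ΔG_n(z) = (1/n) Tr (z - D_n^ε)⁻¹ - (1/n) Tr (z - D_n)⁻¹`. -/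
def deltaG (lam : ℕ → ℕ → ℝ) (x : (n : ℕ) → ℕ → ℕ → Ω n → ℂ) (ε : ℕ → ℝ) (z : ℂ)
    (n : ℕ) (ω : Ω n) : ℂ :=
  stieltjes n (perturbedMatrix lam x ε n ω) z - stieltjes n (diagMatrix lam n) z

/-- The variance `σ_n²(i,j)` of the entry `x^n_{i,j}`. -/
def entryVar (P : (n : ℕ) → Measure (Ω n)) (x : (n : ℕ) → ℕ → ℕ → Ω n → ℂ) (n i j : ℕ) : ℝ :=
  ∫ ω, ‖x n i j ω - ∫ ω', x n i j ω' ∂P n‖ ^ 2 ∂P n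

/-- The matrices `(x^n_{i,j})` are Hermitian, with centered entries which are independent up to
the symmetry and have uniformly bounded eighth moments. -/
structure IsNoise (P : (n : ℕ) → Measure (Ω n)) (x : (n : ℕ) → ℕ → ℕ → Ω n → ℂ) : Prop where
  measurable : ∀ n, ∀ i ∈ Finset.Icc 1 n, ∀ j ∈ Finset.Icc 1 n, Measurable (x n i j)
  hermitian : ∀ n, ∀ i ∈ Finset.Icc 1 n, ∀ j ∈ Finset.Icc 1 n, ∀ ω,
    x n j i ω = conj (x n i j ω)
  indep : ∀ n, iIndepFun
    (fun p : {p : ℕ × ℕ // 1 ≤ p.1 ∧ p.1 ≤ p.2 ∧ p.2 ≤ n} => x n p.1.1 p.1.2) (P n)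
  centered : ∀ n, ∀ i ∈ Finset.Icc 1 n, ∀ j ∈ Finset.Icc 1 n, ∫ ω, x n i j ω ∂P n = 0
  moment : ∃ C : ℝ≥0, ∀ n, ∀ i ∈ Finset.Icc 1 n, ∀ j ∈ Finset.Icc 1 n,
    ∫⁻ ω, ‖x n i j ω‖ₑ ^ 8 ∂P n ≤ C

/-- The rate
`η_n = max(n ε_n, 1) · sup_{1 ≤ i ≠ j ≤ n} (|σ_n²(i,j) - σ²(i/n,j/n)| + |λ_n(i) - f(i/n)|)`. -/
def profileRate (P : (n : ℕ) → Measure (Ω n)) (lam : ℕ → ℕ → ℝ)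
    (x : (n : ℕ) → ℕ → ℕ → Ω n → ℂ) (ε : ℕ → ℝ) (f : ℝ → ℝ) (σ : ℝ → ℝ → ℝ) (n : ℕ) : ℝ :=
  max (n * ε n) 1 * ⨆ p : (Finset.Icc 1 n).offDiag,
    (|entryVar P x n p.1.1 p.1.2 - σ ((p.1.1 : ℝ) / n) ((p.1.2 : ℝ) / n) ^ 2|
      + |lam n p.1.1 - f ((p.1.1 : ℝ) / n)|)

/-- Convergence of the spectrum of `D_n` and of the variances of the entries to the profiles `f`,
`σd`, `σ`. The point `0`, for which `⌊n x⌋` is never an index, is left out. -/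
structure ProfileConvergence (P : (n : ℕ) → Measure (Ω n)) (lam : ℕ → ℕ → ℝ)
    (x : (n : ℕ) → ℕ → ℕ → Ω n → ℂ) (ε : ℕ → ℝ) (f σd : ℝ → ℝ) (σ : ℝ → ℝ → ℝ) : Prop where
  spectrum : ∀ s ∈ Set.Ioc (0 : ℝ) 1,
    Tendsto (fun n : ℕ => lam n ⌊(n : ℝ) * s⌋₊) atTop (𝓝 (f s))
  diagVar : ∀ s ∈ Set.Ioc (0 : ℝ) 1,
    Tendsto (fun n : ℕ => entryVar P x n ⌊(n : ℝ) * s⌋₊ ⌊(n : ℝ) * s⌋₊) atTop (𝓝 (σd s ^ 2))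
  offDiagVar : ∀ s ∈ Set.Ioc (0 : ℝ) 1, ∀ t ∈ Set.Ioc (0 : ℝ) 1, s ≠ t →
    Tendsto (fun n : ℕ => entryVar P x n ⌊(n : ℝ) * s⌋₊ ⌊(n : ℝ) * t⌋₊) atTop (𝓝 (σ s t ^ 2))
  rate : Tendsto (profileRate P lam x ε f σ) atTop (𝓝 0)

/-- The mean distance between the step profiles `λ_n(⌊n s⌋)`, `σ_n²(⌊n s⌋,⌊n t⌋)` and their
limits `f(s)`, `σ²(s,t)`, over the `s, t ∈ [1/n, 1]`. -/
def meanProfileError (P : (n : ℕ) → Measure (Ω n)) (lam : ℕ → ℕ → ℝ)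
    (x : (n : ℕ) → ℕ → ℕ → Ω n → ℂ) (f : ℝ → ℝ) (σ : ℝ → ℝ → ℝ) (n : ℕ) : ℝ :=
  (∫ p in Set.Icc (1 / (n : ℝ)) 1 ×ˢ Set.Icc (1 / (n : ℝ)) 1,
      |entryVar P x n ⌊(n : ℝ) * p.1⌋₊ ⌊(n : ℝ) * p.2⌋₊ - σ p.1 p.2 ^ 2|)
    + ∫ s in Set.Icc (1 / (n : ℝ)) 1, |lam n ⌊(n : ℝ) * s⌋₊ - f s|

/-- There is a compact set to which the eigenvalues of `D_n` are uniformly close. -/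
def SpectrumNearCompact (lam : ℕ → ℕ → ℝ) : Prop :=
  ∃ S : Set ℝ, IsCompact S ∧ S.Nonempty ∧
    Tendsto (fun n => ⨆ i : Finset.Icc 1 n, Metric.infDist (lam n i) S) atTop (𝓝 0)

/-- Convergence to `0` in probability, the `n`-th variable living on the `n`-th space. -/
def TendstoZeroInProbability (P : (n : ℕ) → Measure (Ω n)) (Y : (n : ℕ) → Ω n → ℂ) : Prop :=
  ∀ δ : ℝ, 0 < δ → Tendsto (fun n => P n {ω | δ ≤ ‖Y n ω‖}) atTop (𝓝 0)

end Model

/-! ### The limiting objects -/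

/-- `B(z) = ∫_{[0,1]²} σ²(s,t) / ((z - f(s))² (z - f(t))) ds dt`. -/
def limitB (f : ℝ → ℝ) (σ : ℝ → ℝ → ℝ) (z : ℂ) : ℂ :=
  ∫ p in Set.Icc (0 : ℝ) 1 ×ˢ Set.Icc (0 : ℝ) 1,
    ((σ p.1 p.2 ^ 2 : ℝ) : ℂ) / ((z - (f p.1 : ℂ)) ^ 2 * (z - (f p.2 : ℂ)))

/-- The complex functions of class `C⁶` on `ℝ`. -/
abbrev C6 : Type := {φ : ℝ → ℂ // ContDiff ℝ 6 φ}

/-- The complex conjugate of a function of class `C⁶`. -/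
def C6.conjugate (φ : C6) : C6 :=
  ⟨fun t => starRingEnd ℂ (φ.1 t), Complex.conjCLE.contDiff.comp φ.2⟩

/-- `φ_z(t) = 1 / (z - t)`, for nonreal `z`. -/
def cauchyKernel (z : ℂ) (hz : z.im ≠ 0) : C6 :=
  ⟨fun t : ℝ => 1 / (z - (t : ℂ)), by
    have h : ContDiff ℝ 6 (fun t : ℝ => z - (t : ℂ)) :=
      contDiff_const.sub Complex.ofRealCLM.contDiff
    simp only [one_div]
    refine h.inv fun t ht => hz ?_
    simpa using congrArg Complex.im ht⟩

/-- `(Z_φ)` is a centered Gaussian field indexed by the `C⁶` functions such that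
`E[Z_φ Z_ψ] = ∫₀¹ σd(t)² φ'(f(t)) ψ'(f(t)) dt` and `conj Z_ψ = Z_{conj ψ}`. -/
structure IsLimitField {Ω' : Type*} [MeasurableSpace Ω'] (P' : Measure Ω') (f σd : ℝ → ℝ)
    (Z : C6 → Ω' → ℂ) : Prop where
  gaussian : IsGaussianProcess Z P'
  centered : ∀ φ, ∫ ω, Z φ ω ∂P' = 0
  covariance : ∀ φ ψ, ∫ ω, Z φ ω * Z ψ ω ∂P'
    = ∫ t in Set.Icc (0 : ℝ) 1, ((σd t ^ 2 : ℝ) : ℂ) * deriv φ.1 (f t) * deriv ψ.1 (f t)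
  conj_eq : ∀ ψ, ∀ᵐ ω ∂P', conj (Z ψ ω) = Z ψ.conjugate ω

end PerturbedDiagonal

end

/-! Write `η = ε/√n` and `g i = (z - l i)⁻¹`. Iterating the resolvent identity expands the trace of
the perturbed resolvent in powers of `η`, with three explicit orders and an exact remainder of order
four (`trace_resolvent_eq`). After multiplication by `n/ε` the difference of the normalized traces
is the sum of three pieces (`scaled_deltaG_eq`).

The first order is `n^{-1/2} ∑ g i ^ 2 * x i i`, a weighted sum of independent real variables. It
has a Gaussian limit by a Lyapunov estimate on characteristic functions
(`norm_integral_exp_sum_sub_exp_le`), and its variance is a Riemann sum converging to the variance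
of the field (`charFun_limitField`). Only the diagonal entries contribute, which is why the
covariance involves `σd` alone.

The mean of the second order is `n ε` times a Riemann sum `stepB` for `limitB`. Its distance to
`limitB` is controlled by the mean error of the profiles plus a boundary term of order `1/n`
(`norm_stepB_sub_limitB_le`).

Everything else is small in L¹, with bound a constant times `ε + ε³ n`
(`integral_norm_expansionError_le`). The fluctuations of the second order and the third order are
estimated by counting correlated pairs of terms: a product of entries has mean zero as soon as one
edge occurs in it only once (`integral_prod_eq_zero`). The remainder is handled by Frobenius norms,
so no bound on the operator norm of the noise is needed.

The regimes follow by comparing sizes. If `n ε` converges, the mean converges and the error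
vanishes. If `ε ≪ n^{-1/3}`, the error still vanishes, and the rate in mean allows `n ε B` to
replace the Riemann sum. If one only knows `n^{-1} ≪ ε ≪ 1`, dividing by `n ε` kills both the
Gaussian part and the error. -/

noncomputable section

namespace PerturbedDiagonal

/-! ### Second moments of sums with few correlated terms -/

section SecondMoment

variable {Ω α : Type*} [MeasurableSpace Ω] {P : Measure Ω}

lemma integrable_mul_conj {u v : Ω → ℂ} (hu : MemLp u 2 P) (hv : MemLp v 2 P) :
    Integrable (fun ω => u ω * conj (v ω)) P :=
  hu.integrable_mul hv.star

lemma norm_integral_mul_conj_le {u v : Ω → ℂ} (hu : MemLp u 2 P) (hv : MemLp v 2 P) {V : ℝ}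
    (huV : ∫ ω, ‖u ω‖ ^ 2 ∂P ≤ V) (hvV : ∫ ω, ‖v ω‖ ^ 2 ∂P ≤ V) :
    ‖∫ ω, u ω * conj (v ω) ∂P‖ ≤ V := by
  have hu' := hu.integrable_norm_pow (by norm_num)
  have hv' := hv.integrable_norm_pow (by norm_num)
  calc ‖∫ ω, u ω * conj (v ω) ∂P‖ ≤ ∫ ω, ‖u ω * conj (v ω)‖ ∂P := norm_integral_le_integral_norm _
    _ ≤ ∫ ω, (‖u ω‖ ^ 2 + ‖v ω‖ ^ 2) / 2 ∂P := by
        refine integral_mono (integrable_mul_conj hu hv).norm ((hu'.add hv').div_const 2) fun ω => ?_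
        simp only [norm_mul, RCLike.norm_conj]
        nlinarith [sq_nonneg (‖u ω‖ - ‖v ω‖)]
    _ ≤ V := by
        rw [integral_div, integral_add hu' hv']
        linarith

/-- Expanding the square leaves only the pairs related by `R`: each `b` has at most `N` partners and
each covariance is at most `V`. The relation `R` only has to contain the correlated pairs, so it can
be chosen to be easy to count. -/
lemma integral_norm_sum_sq_le (A : Finset α) (c : α → ℂ) (W : α → Ω → ℂ) (R : α → α → Prop)
    [DecidableRel R] {K V : ℝ} {N : ℕ} (hV : 0 ≤ V)
    (hc : ∀ a ∈ A, ‖c a‖ ≤ K) (hW : ∀ a ∈ A, MemLp (W a) 2 P)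
    (hWV : ∀ a ∈ A, ∫ ω, ‖W a ω‖ ^ 2 ∂P ≤ V)
    (hR : ∀ a ∈ A, ∀ b ∈ A, ¬ R a b → ∫ ω, W a ω * conj (W b ω) ∂P = 0)
    (hN : ∀ b ∈ A, (A.filter fun a => R a b).card ≤ N) :
    ∫ ω, ‖∑ a ∈ A, c a * W a ω‖ ^ 2 ∂P ≤ K ^ 2 * V * N * A.card := by
  have hexp : ∀ ω, (((‖∑ a ∈ A, c a * W a ω‖ ^ 2 : ℝ)) : ℂ)
      = ∑ b ∈ A, ∑ a ∈ A, c a * conj (c b) * (W a ω * conj (W b ω)) := by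
    intro ω
    rw [Complex.ofReal_pow, ← Complex.mul_conj', map_sum, Finset.sum_mul_sum, Finset.sum_comm]
    refine Finset.sum_congr rfl fun b _ => Finset.sum_congr rfl fun a _ => ?_
    rw [map_mul]; ring
  have hint : ∀ b ∈ A, ∀ a ∈ A,
      Integrable (fun ω => c a * conj (c b) * (W a ω * conj (W b ω))) P := fun b hb a ha =>
    (integrable_mul_conj (hW a ha) (hW b hb)).const_mul _
  have h1 : ((∫ ω, ‖∑ a ∈ A, c a * W a ω‖ ^ 2 ∂P : ℝ) : ℂ)
      = ∑ b ∈ A, ∑ a ∈ A, c a * conj (c b) * ∫ ω, W a ω * conj (W b ω) ∂P := by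
    rw [← integral_complex_ofReal]
    simp_rw [hexp]
    rw [integral_finsetSum _ fun b hb => integrable_finsetSum _ (hint b hb)]
    refine Finset.sum_congr rfl fun b hb => ?_
    rw [integral_finsetSum _ (hint b hb)]
    exact Finset.sum_congr rfl fun a ha => integral_const_mul _ _
  have h2 : ∫ ω, ‖∑ a ∈ A, c a * W a ω‖ ^ 2 ∂P
      = ‖∑ b ∈ A, ∑ a ∈ A, c a * conj (c b) * ∫ ω, W a ω * conj (W b ω) ∂P‖ := by
    rw [← h1, Complex.norm_real, Real.norm_of_nonneg]
    exact integral_nonneg fun ω => by positivity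
  rw [h2]
  calc _ ≤ ∑ b ∈ A, ∑ a ∈ A, (if R a b then K ^ 2 * V else 0) := by
        refine (norm_sum_le _ _).trans (Finset.sum_le_sum fun b hb => (norm_sum_le _ _).trans
          (Finset.sum_le_sum fun a ha => ?_))
        split_ifs with h
        · rw [norm_mul, norm_mul, RCLike.norm_conj, sq]
          have := norm_integral_mul_conj_le (hW a ha) (hW b hb) (hWV a ha) (hWV b hb)
          have hK := (norm_nonneg _).trans (hc a ha)
          exact mul_le_mul (mul_le_mul (hc a ha) (hc b hb) (norm_nonneg _) hK) this
            (norm_nonneg _) (mul_nonneg hK hK)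
        · rw [hR a ha b hb h]; simp
    _ ≤ ∑ b ∈ A, (N : ℝ) * (K ^ 2 * V) := by
        refine Finset.sum_le_sum fun b hb => ?_
        rw [← Finset.sum_filter, Finset.sum_const, nsmul_eq_mul]
        have := hN b hb
        gcongr
    _ = _ := by rw [Finset.sum_const, nsmul_eq_mul]; ring

/-- This is the nonnegativity of the variance of `‖u‖`. It converts second moment counts into the L¹
bounds in which errors are measured. -/
lemma integral_norm_le_sqrt [IsProbabilityMeasure P] {u : Ω → ℂ} (hu : MemLp u 2 P) {V : ℝ}
    (hV : ∫ ω, ‖u ω‖ ^ 2 ∂P ≤ V) : ∫ ω, ‖u ω‖ ∂P ≤ √V := by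
  have h2 := hu.integrable_norm_pow (p := 2) (by norm_num)
  have h1 : Integrable u P := hu.integrable (by norm_num)
  refine Real.le_sqrt_of_sq_le (le_trans ?_ hV)
  have := variance_nonneg (fun ω => ‖u ω‖) P
  rw [variance_eq_sub hu.norm] at this
  simpa using this

end SecondMoment

/-! ### A quantitative central limit theorem -/

section CLT

/-- Telescoping: the factors are exchanged one at a time, while all the others stay in the unit
disc. -/
lemma norm_prod_sub_prod_le {ι : Type*} (s : Finset ι) (a b : ι → ℂ) (ha : ∀ i ∈ s, ‖a i‖ ≤ 1)
    (hb : ∀ i ∈ s, ‖b i‖ ≤ 1) : ‖∏ i ∈ s, a i - ∏ i ∈ s, b i‖ ≤ ∑ i ∈ s, ‖a i - b i‖ := by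
  classical
  induction s using Finset.induction_on with
  | empty => simp
  | insert i s hi ih =>
    rw [Finset.prod_insert hi, Finset.prod_insert hi, Finset.sum_insert hi]
    have ih' := ih (fun j hj => ha j (Finset.mem_insert_of_mem hj))
      (fun j hj => hb j (Finset.mem_insert_of_mem hj))
    have hA : ‖∏ j ∈ s, a j‖ ≤ 1 := by
      rw [norm_prod]
      exact Finset.prod_le_one (fun _ _ => norm_nonneg _)
        fun j hj => ha j (Finset.mem_insert_of_mem hj)
    have hbi := hb i (Finset.mem_insert_self i s)
    calc _ = ‖(a i - b i) * ∏ j ∈ s, a j + b i * (∏ j ∈ s, a j - ∏ j ∈ s, b j)‖ := by ring_nf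
      _ ≤ ‖a i - b i‖ * 1 + 1 * ∑ j ∈ s, ‖a j - b j‖ := by
        refine (norm_add_le _ _).trans ?_
        rw [norm_mul, norm_mul]
        gcongr
      _ = _ := by ring

/-- Taylor's bound serves for `|y| ≤ 1`; beyond that, the triangle inequality suffices, since lower
powers of `|y|` are dominated by the cube. The constant 4 covers both cases and is not sharp. -/
lemma norm_exp_I_mul_sub_taylor_two_le (y : ℝ) :
    ‖Complex.exp (Complex.I * y) - (1 + Complex.I * y - y ^ 2 / 2)‖ ≤ 4 * |y| ^ 3 := by
  rcases le_total |y| 1 with h | h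
  · have := Complex.norm_exp_sub_sum_le_norm_mul_exp (Complex.I * y) 3
    have he : Real.exp |y| ≤ 4 :=
      (Real.exp_le_exp.2 h).trans (Real.exp_one_lt_d9.le.trans (by norm_num))
    simp only [Finset.sum_range_succ, Finset.sum_range_zero, norm_mul, Complex.norm_I,
      Complex.norm_real, Real.norm_eq_abs, one_mul, mul_pow, Complex.I_sq, Nat.factorial] at this
    calc _ ≤ |y| ^ 3 * Real.exp |y| := by
          convert this using 3
          push_cast
          ring
      _ ≤ |y| ^ 3 * 4 := by gcongr
      _ = _ := by ring
  · have h1 : ‖(1 + Complex.I * y - y ^ 2 / 2 : ℂ)‖ ≤ 1 + |y| + |y| ^ 2 / 2 := by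
      refine (norm_sub_le _ _).trans (add_le_add ((norm_add_le _ _).trans ?_) ?_)
      · simp
      · simp
    refine (norm_sub_le _ _).trans ?_
    rw [Complex.norm_exp_I_mul_ofReal]
    have h2 : |y| ≤ |y| ^ 3 := by nlinarith [mul_self_nonneg (|y| - 1), mul_le_mul h h zero_le_one (by linarith)]
    have h3 : |y| ^ 2 ≤ |y| ^ 3 := pow_le_pow_right₀ h (by norm_num)
    linarith

lemma abs_exp_neg_sub_le {u : ℝ} (hu : 0 ≤ u) : |Real.exp (-u) - (1 - u)| ≤ u ^ 2 := by
  rcases le_total u 1 with h | h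
  · have := Real.abs_exp_sub_one_sub_id_le (x := -u) (by rwa [abs_neg, abs_of_nonneg hu])
    rw [neg_sq] at this
    convert this using 2
    ring
  · rw [abs_le]
    constructor
    · nlinarith [Real.exp_pos (-u)]
    · nlinarith [Real.exp_le_one_iff.2 (neg_nonpos.2 hu)]

variable {Ω ι : Type*} [MeasurableSpace Ω] {P : Measure Ω} [IsProbabilityMeasure P]

/-- Both quantities are compared with `1 - α² v / 2`: the characteristic function through its Taylor
expansion, whose error is a third moment, and the Gaussian factor through the expansion of the
exponential. -/
lemma norm_charFun_sub_exp_le {r : Ω → ℝ} (hr : Measurable r) (α : ℝ) {v M : ℝ}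
    (h3 : Integrable (fun ω => |r ω| ^ 3) P) (h0 : ∫ ω, r ω ∂P = 0)
    (h2 : ∫ ω, r ω ^ 2 ∂P = v) (hvM : v ≤ M) (h3M : ∫ ω, |r ω| ^ 3 ∂P ≤ M) :
    ‖∫ ω, Complex.exp (Complex.I * ((α * r ω : ℝ) : ℂ)) ∂P
      - (Real.exp (-(α ^ 2 * v / 2)) : ℂ)‖ ≤ 4 * |α| ^ 3 * M + (α ^ 2 * M) ^ 2 := by
  have hL3 : MemLp r 3 P := by
    rw [← integrable_norm_rpow_iff hr.aestronglyMeasurable (by norm_num) (by norm_num)]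
    simpa using (by exact_mod_cast h3 : Integrable (fun ω => |r ω| ^ (3 : ℝ)) P)
  have i1 : Integrable r P := hL3.integrable (by norm_num)
  have i2 : Integrable (fun ω => r ω ^ 2) P :=
    (hL3.mono_exponent (by norm_num : (2 : ℝ≥0∞) ≤ 3)).integrable_sq
  have hv : 0 ≤ v := h2 ▸ integral_nonneg fun ω => sq_nonneg _
  have ie : Integrable (fun ω => Complex.exp (Complex.I * ((α * r ω : ℝ) : ℂ))) P := by
    refine Integrable.of_bound (C := 1) (by fun_prop) (ae_of_all _ fun ω => ?_)
    rw [Complex.norm_exp_I_mul_ofReal]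
  have a1 : Integrable (fun ω => 1 + Complex.I * ((α * r ω : ℝ) : ℂ)) P :=
    (integrable_const 1).add (((i1.const_mul α).ofReal).const_mul _)
  have a2' : (fun ω => ((α * r ω : ℝ) : ℂ) ^ 2 / 2)
      = fun ω => ((α ^ 2 * r ω ^ 2 / 2 : ℝ) : ℂ) := by
    ext ω; push_cast; ring
  have a2 : Integrable (fun ω => ((α * r ω : ℝ) : ℂ) ^ 2 / 2) P := by
    rw [a2']
    exact ((i2.const_mul (α ^ 2)).div_const 2).ofReal
  have it : Integrable (fun ω => (1 + Complex.I * ((α * r ω : ℝ) : ℂ)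
      - ((α * r ω : ℝ) : ℂ) ^ 2 / 2)) P := a1.sub a2
  have hval : ∫ ω, (1 + Complex.I * ((α * r ω : ℝ) : ℂ) - ((α * r ω : ℝ) : ℂ) ^ 2 / 2) ∂P
      = ((1 - α ^ 2 * v / 2 : ℝ) : ℂ) := by
    rw [integral_sub a1 a2, integral_add (integrable_const 1)
      (((i1.const_mul α).ofReal).const_mul _), a2', integral_complex_ofReal, integral_div,
      integral_const_mul, integral_const_mul, integral_complex_ofReal, integral_const_mul, h0, h2]
    simp
  calc _ ≤ ‖∫ ω, (Complex.exp (Complex.I * ((α * r ω : ℝ) : ℂ))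
          - (1 + Complex.I * ((α * r ω : ℝ) : ℂ) - ((α * r ω : ℝ) : ℂ) ^ 2 / 2)) ∂P‖
        + ‖((1 - α ^ 2 * v / 2 : ℝ) : ℂ) - (Real.exp (-(α ^ 2 * v / 2)) : ℂ)‖ := by
        rw [integral_sub ie it, hval]
        exact norm_sub_le_norm_sub_add_norm_sub _ _ _
    _ ≤ 4 * |α| ^ 3 * M + (α ^ 2 * M) ^ 2 := by
        refine add_le_add ?_ ?_
        · calc _ ≤ ∫ ω, 4 * |α| ^ 3 * |r ω| ^ 3 ∂P := by
                refine norm_integral_le_of_norm_le (h3.const_mul _) (ae_of_all _ fun ω => ?_)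
                refine (norm_exp_I_mul_sub_taylor_two_le (α * r ω)).trans_eq ?_
                rw [abs_mul]; ring
            _ ≤ _ := by rw [integral_const_mul]; gcongr
        · rw [← Complex.ofReal_sub, Complex.norm_real, Real.norm_eq_abs, abs_sub_comm]
          refine (abs_exp_neg_sub_le (by positivity)).trans ?_
          have : α ^ 2 * v / 2 ≤ α ^ 2 * M := by nlinarith [sq_nonneg α, mul_le_mul_of_nonneg_left hvM (sq_nonneg α), mul_nonneg (sq_nonneg α) hv]
          exact pow_le_pow_left₀ (by positivity) this 2

/-- A quantitative Lyapunov theorem: independence factors the characteristic function, and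
telescoping adds up the errors of the single factors. -/
lemma norm_integral_exp_sum_sub_exp_le [Fintype ι] {r : ι → Ω → ℝ} (hr : ∀ i, Measurable (r i))
    (hind : iIndepFun r P) (α v : ι → ℝ) {M : ℝ}
    (h3 : ∀ i, Integrable (fun ω => |r i ω| ^ 3) P) (h0 : ∀ i, ∫ ω, r i ω ∂P = 0)
    (h2 : ∀ i, ∫ ω, r i ω ^ 2 ∂P = v i) (hvM : ∀ i, v i ≤ M)
    (h3M : ∀ i, ∫ ω, |r i ω| ^ 3 ∂P ≤ M) :
    ‖∫ ω, Complex.exp (Complex.I * ((∑ i, α i * r i ω : ℝ) : ℂ)) ∂P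
      - (Real.exp (-(∑ i, α i ^ 2 * v i) / 2) : ℂ)‖
      ≤ ∑ i, (4 * |α i| ^ 3 * M + (α i ^ 2 * M) ^ 2) := by
  have e1 : ∫ ω, Complex.exp (Complex.I * ((∑ i, α i * r i ω : ℝ) : ℂ)) ∂P
      = ∏ i, ∫ ω, Complex.exp (Complex.I * ((α i * r i ω : ℝ) : ℂ)) ∂P := by
    rw [← hind.integral_fun_prod_comp (fun i => (hr i).aemeasurable)
      (f := fun i y => Complex.exp (Complex.I * ((α i * y : ℝ) : ℂ)))
      (fun i => by fun_prop)]
    refine integral_congr_ae (ae_of_all _ fun ω => ?_)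
    simp only
    rw [← Complex.exp_sum, Complex.ofReal_sum, Finset.mul_sum]
  have e2 : (Real.exp (-(∑ i, α i ^ 2 * v i) / 2) : ℂ)
      = ∏ i, (Real.exp (-(α i ^ 2 * v i / 2)) : ℂ) := by
    rw [← Complex.ofReal_prod, ← Real.exp_sum, Finset.sum_neg_distrib, ← Finset.sum_div, neg_div]
  rw [e1, e2]
  refine (norm_prod_sub_prod_le _ _ _ (fun i _ => ?_) (fun i _ => ?_)).trans
    (Finset.sum_le_sum fun i _ => norm_charFun_sub_exp_le (hr i) (α i) (h3 i) (h0 i) (h2 i)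
      (hvM i) (h3M i))
  · refine (norm_integral_le_of_norm_le_const (C := 1) (ae_of_all _ fun ω => ?_)).trans (by simp)
    rw [Complex.norm_exp_I_mul_ofReal]
  · rw [Complex.norm_real, Real.norm_of_nonneg (Real.exp_pos _).le, Real.exp_le_one_iff]
    have : 0 ≤ v i := h2 i ▸ integral_nonneg fun ω => sq_nonneg _
    have : 0 ≤ α i ^ 2 * v i / 2 := by positivity
    linarith

end CLT

/-! ### Hermitian arrays of independent entries -/

section NoiseArray

variable {Ω ι : Type*} [MeasurableSpace Ω] [LinearOrder ι]

/-- A Hermitian array of centered random variables, independent up to the symmetry, whose eighth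
moments are at most `C`. -/
structure IsNoiseArray (P : Measure Ω) (X : ι → ι → Ω → ℂ) (C : ℝ) : Prop where
  measurable : ∀ i j, Measurable (X i j)
  hermitian : ∀ i j ω, X j i ω = conj (X i j ω)
  indep : iIndepFun (fun p : {p : ι × ι // p.1 ≤ p.2} => X p.1.1 p.1.2) P
  centered : ∀ i j, ∫ ω, X i j ω ∂P = 0
  integrable : ∀ i j, Integrable (fun ω => ‖X i j ω‖ ^ 8) P
  moment : ∀ i j, ∫ ω, ‖X i j ω‖ ^ 8 ∂P ≤ C

/-- The σ-algebra generated by the entry at an unordered pair of indices. -/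
abbrev edgeAlgebra (X : ι → ι → Ω → ℂ) (e : Sym2 ι) : MeasurableSpace Ω :=
  MeasurableSpace.comap (X e.inf e.sup) inferInstance

namespace IsNoiseArray

variable {P : Measure Ω} {X : ι → ι → Ω → ℂ} {C : ℝ}

lemma edgeAlgebra_le (h : IsNoiseArray P X C) (e : Sym2 ι) :
    edgeAlgebra X e ≤ (inferInstance : MeasurableSpace Ω) :=
  (h.measurable _ _).comap_le

lemma iIndep_edgeAlgebra (h : IsNoiseArray P X C) : iIndep (edgeAlgebra X) P :=
  (h.indep.precomp Sym2.sortEquiv.injective).iIndep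

/-- The edge algebra is generated by the entry at the sorted pair. The entry at the reversed pair is
its conjugate and carries no further information, so the order of `i` and `j` is irrelevant. -/
lemma measurable_iSup_edgeAlgebra (h : IsNoiseArray P X C) {S : Set (Sym2 ι)} {i j : ι}
    (hij : s(i, j) ∈ S) : Measurable[⨆ e ∈ S, edgeAlgebra X e] (X i j) := by
  have h1 : Measurable[edgeAlgebra X s(i, j)] (X i j) := by
    have h2 : Measurable[edgeAlgebra X s(i, j)] (X (i ⊓ j) (i ⊔ j)) :=
      Measurable.of_comap_le le_rfl
    rcases le_total i j with hl | hl
    · rwa [inf_eq_left.2 hl, sup_eq_right.2 hl] at h2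
    · rw [inf_eq_right.2 hl, sup_eq_left.2 hl] at h2
      have h3 : X i j = fun ω => conj (X j i ω) := funext fun ω => h.hermitian j i ω
      rw [h3]
      exact RCLike.continuous_conj.measurable.comp h2
  exact h1.mono (le_iSup₂_of_le (s(i, j)) hij le_rfl) le_rfl

lemma integral_mul_of_disjoint (h : IsNoiseArray P X C) {S T : Set (Sym2 ι)}
    (hST : Disjoint S T) {u v : Ω → ℂ} (hu : Measurable[⨆ e ∈ S, edgeAlgebra X e] u)
    (hv : Measurable[⨆ e ∈ T, edgeAlgebra X e] v) :
    ∫ ω, u ω * v ω ∂P = (∫ ω, u ω ∂P) * ∫ ω, v ω ∂P := by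
  have hle : ∀ S : Set (Sym2 ι), ⨆ e ∈ S, edgeAlgebra X e ≤ (inferInstance : MeasurableSpace Ω) :=
    fun S => iSup₂_le fun e _ => h.edgeAlgebra_le e
  have hind := indep_iSup_of_disjoint h.edgeAlgebra_le h.iIndep_edgeAlgebra hST
  have hI : IndepFun u v P := by
    rw [IndepFun_iff_Indep]
    exact indep_of_indep_of_le hind hu.comap_le hv.comap_le
  exact hI.integral_fun_mul_eq_mul_integral (hu.mono (hle S) le_rfl).aestronglyMeasurable
    (hv.mono (hle T) le_rfl).aestronglyMeasurable

/-- The factor on an edge that no other factor uses is independent of the rest and centered. This is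
the vanishing criterion behind the counts for `x g x` and for the cubic statistic. -/
lemma integral_prod_eq_zero (h : IsNoiseArray P X C) {m : ℕ} (u v : Fin m → ι) (k₀ : Fin m)
    (hk : ∀ k, k ≠ k₀ → s(u k, v k) ≠ s(u k₀, v k₀)) :
    ∫ ω, ∏ k, X (u k) (v k) ω ∂P = 0 := by
  have h1 : ∀ ω, ∏ k, X (u k) (v k) ω
      = X (u k₀) (v k₀) ω * ∏ k ∈ Finset.univ.erase k₀, X (u k) (v k) ω := fun ω =>
    (Finset.mul_prod_erase _ _ (Finset.mem_univ k₀)).symm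
  simp_rw [h1]
  rw [h.integral_mul_of_disjoint (S := {s(u k₀, v k₀)}) (T := {s(u k₀, v k₀)}ᶜ)
    disjoint_compl_right (h.measurable_iSup_edgeAlgebra rfl), h.centered, zero_mul]
  refine Finset.measurable_prod _ fun k hk' => h.measurable_iSup_edgeAlgebra ?_
  exact hk k (Finset.ne_of_mem_erase hk')

/-! #### Moments -/

variable [IsProbabilityMeasure P]

lemma integrable_norm_pow (h : IsNoiseArray P X C) (i j : ι) {k : ℕ} (hk : k ≤ 8) :
    Integrable (fun ω => ‖X i j ω‖ ^ k) P ∧ ∫ ω, ‖X i j ω‖ ^ k ∂P ≤ 1 + C := by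
  have hb : ∀ ω, ‖X i j ω‖ ^ k ≤ 1 + ‖X i j ω‖ ^ 8 := fun ω => by
    rcases le_total ‖X i j ω‖ 1 with h1 | h1
    · exact (pow_le_one₀ (norm_nonneg _) h1).trans (le_add_of_nonneg_right (by positivity))
    · exact (pow_le_pow_right₀ h1 hk).trans (le_add_of_nonneg_left zero_le_one)
  have hi : Integrable (fun ω => 1 + ‖X i j ω‖ ^ 8) P := (integrable_const 1).add (h.integrable i j)
  have hk : Integrable (fun ω => ‖X i j ω‖ ^ k) P := by
    refine hi.mono' ((h.measurable i j).norm.pow_const k).aestronglyMeasurable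
      (ae_of_all _ fun ω => ?_)
    rw [Real.norm_of_nonneg (by positivity)]
    exact hb ω
  refine ⟨hk, (integral_mono hk hi hb).trans ?_⟩
  rw [integral_add (integrable_const 1) (h.integrable i j)]
  simpa using h.moment i j

lemma memLp_triple (h : IsNoiseArray P X C) (i j k l p q : ι) :
    MemLp (fun ω => X i j ω * X k l ω * X p q ω) 2 P ∧
      ∫ ω, ‖X i j ω * X k l ω * X p q ω‖ ^ 2 ∂P ≤ 1 + C := by
  have hm : Measurable (fun ω => X i j ω * X k l ω * X p q ω) :=
    ((h.measurable i j).mul (h.measurable k l)).mul (h.measurable p q)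
  have hb : ∀ ω, ‖X i j ω * X k l ω * X p q ω‖ ^ 2
      ≤ (‖X i j ω‖ ^ 6 + ‖X k l ω‖ ^ 6 + ‖X p q ω‖ ^ 6) / 3 := fun ω => by
    rw [norm_mul, norm_mul]
    generalize ha : ‖X i j ω‖ ^ 2 = a
    generalize hb : ‖X k l ω‖ ^ 2 = b
    generalize hc : ‖X p q ω‖ ^ 2 = c
    have ha0 : 0 ≤ a := ha ▸ by positivity
    have hb0 : 0 ≤ b := hb ▸ by positivity
    have hc0 : 0 ≤ c := hc ▸ by positivity
    have e : ∀ y : ℝ, y ^ 6 = (y ^ 2) ^ 3 := fun y => by ring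
    rw [e, e, e, mul_pow, mul_pow, ha, hb, hc]
    -- The hint is the factorization of `a³ + b³ + c³ - 3abc` as half of `(a + b + c)((a - b)² + (b
    -- - c)² + (c - a)²)`.
    nlinarith [mul_nonneg (add_nonneg (add_nonneg ha0 hb0) hc0)
      (add_nonneg (add_nonneg (sq_nonneg (a - b)) (sq_nonneg (b - c))) (sq_nonneg (c - a)))]
  obtain ⟨i1, l1⟩ := h.integrable_norm_pow i j (k := 6) (by norm_num)
  obtain ⟨i2, l2⟩ := h.integrable_norm_pow k l (k := 6) (by norm_num)
  obtain ⟨i3, l3⟩ := h.integrable_norm_pow p q (k := 6) (by norm_num)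
  have hi : Integrable (fun ω => (‖X i j ω‖ ^ 6 + ‖X k l ω‖ ^ 6 + ‖X p q ω‖ ^ 6) / 3) P :=
    ((i1.add i2).add i3).div_const 3
  have hI : Integrable (fun ω => ‖X i j ω * X k l ω * X p q ω‖ ^ 2) P := by
    refine hi.mono' (hm.norm.pow_const 2).aestronglyMeasurable (ae_of_all _ fun ω => ?_)
    rw [Real.norm_of_nonneg (by positivity)]
    exact hb ω
  refine ⟨(memLp_two_iff_integrable_sq_norm hm.aestronglyMeasurable).2 hI,
    (integral_mono hI hi hb).trans ?_⟩
  have e12 : Integrable (fun ω => ‖X i j ω‖ ^ 6 + ‖X k l ω‖ ^ 6) P := i1.add i2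
  rw [integral_div, integral_add e12 i3, integral_add i1 i2]
  linarith

lemma memLp_pair (h : IsNoiseArray P X C) (i j k l : ι) :
    MemLp (fun ω => X i j ω * X k l ω) 2 P ∧
      ∫ ω, ‖X i j ω * X k l ω‖ ^ 2 ∂P ≤ 1 + C := by
  have hm : Measurable (fun ω => X i j ω * X k l ω) := (h.measurable i j).mul (h.measurable k l)
  have hb : ∀ ω, ‖X i j ω * X k l ω‖ ^ 2 ≤ (‖X i j ω‖ ^ 4 + ‖X k l ω‖ ^ 4) / 2 := fun ω => by
    rw [norm_mul]
    nlinarith [sq_nonneg (‖X i j ω‖ ^ 2 - ‖X k l ω‖ ^ 2)]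
  obtain ⟨i1, l1⟩ := h.integrable_norm_pow i j (k := 4) (by norm_num)
  obtain ⟨i2, l2⟩ := h.integrable_norm_pow k l (k := 4) (by norm_num)
  have hi : Integrable (fun ω => (‖X i j ω‖ ^ 4 + ‖X k l ω‖ ^ 4) / 2) P := (i1.add i2).div_const 2
  have hI : Integrable (fun ω => ‖X i j ω * X k l ω‖ ^ 2) P := by
    refine hi.mono' (hm.norm.pow_const 2).aestronglyMeasurable (ae_of_all _ fun ω => ?_)
    rw [Real.norm_of_nonneg (by positivity)]
    exact hb ω
  refine ⟨(memLp_two_iff_integrable_sq_norm hm.aestronglyMeasurable).2 hI,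
    (integral_mono hI hi hb).trans ?_⟩
  rw [integral_div, integral_add i1 i2]
  linarith

lemma memLp_entry (h : IsNoiseArray P X C) (i j : ι) :
    MemLp (X i j) 2 P ∧ ∫ ω, ‖X i j ω‖ ^ 2 ∂P ≤ 1 + C := by
  obtain ⟨i1, l1⟩ := h.integrable_norm_pow i j (k := 2) (by norm_num)
  exact ⟨(memLp_two_iff_integrable_sq_norm (h.measurable i j).aestronglyMeasurable).2 i1, l1⟩

/-! ### Second moments of the linear, quadratic and cubic statistics -/

variable [Fintype ι]

/-- Second moment of the linear statistic of the diagonal entries. -/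
lemma integral_norm_diag_sq_le (h : IsNoiseArray P X C) (hC : 0 ≤ C) (c : ι → ℂ) {K : ℝ}
    (hc : ∀ a, ‖c a‖ ≤ K) :
    ∫ ω, ‖∑ a, c a * X a a ω‖ ^ 2 ∂P ≤ K ^ 2 * (1 + C) * Fintype.card ι := by
  have := integral_norm_sum_sq_le (P := P) Finset.univ c (fun a => X a a) (fun a b => a = b)
    (K := K) (V := 1 + C) (N := 1) (by positivity) (fun a _ => hc a)
    (fun a _ => (h.memLp_entry a a).1) (fun a _ => (h.memLp_entry a a).2)
    (fun a _ b _ hab => by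
      simp_rw [← h.hermitian b b]
      rw [h.integral_mul_of_disjoint (S := {s(a, a)}) (T := {s(b, b)}) (by simpa using hab)
        (h.measurable_iSup_edgeAlgebra rfl) (h.measurable_iSup_edgeAlgebra rfl), h.centered,
        zero_mul])
    (fun b _ => by simp [Finset.filter_eq'])
  simpa using this

/-- The fluctuation of the product of an entry with its transpose. -/
def fluctuation (P : Measure Ω) (X : ι → ι → Ω → ℂ) (p : ι × ι) (ω : Ω) : ℂ :=
  X p.1 p.2 ω * X p.2 p.1 ω - ∫ ω', X p.1 p.2 ω' * X p.2 p.1 ω' ∂P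

omit [Fintype ι] in
lemma memLp_fluctuation (h : IsNoiseArray P X C) (p : ι × ι) : MemLp (fluctuation P X p) 2 P :=
  (h.memLp_pair p.1 p.2 p.2 p.1).1.sub (memLp_const _)

omit [Fintype ι] in
lemma integral_fluctuation (h : IsNoiseArray P X C) (p : ι × ι) :
    ∫ ω, fluctuation P X p ω ∂P = 0 := by
  simp only [fluctuation]
  rw [integral_sub ((h.memLp_pair p.1 p.2 p.2 p.1).1.integrable (by norm_num)) (integrable_const _)]
  simp

omit [Fintype ι] in
-- The bound `‖u - v‖² ≤ 2‖u‖² + 2‖v‖²` is applied to the product `u` and its mean `v`; each part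
-- contributes at most `2 (1 + C)`.
lemma integral_norm_fluctuation_sq_le (h : IsNoiseArray P X C) (hC : 0 ≤ C) (p : ι × ι) :
    ∫ ω, ‖fluctuation P X p ω‖ ^ 2 ∂P ≤ 4 * (1 + C) := by
  obtain ⟨hL, hV⟩ := h.memLp_pair p.1 p.2 p.2 p.1
  have i1 := hL.integrable_norm_pow (p := 2) (by norm_num)
  have hE : ‖∫ ω', X p.1 p.2 ω' * X p.2 p.1 ω' ∂P‖ ^ 2 ≤ 1 + C := by
    have := (norm_integral_le_integral_norm _).trans (integral_norm_le_sqrt hL hV)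
    calc _ ≤ √(1 + C) ^ 2 := pow_le_pow_left₀ (norm_nonneg _) this 2
      _ = _ := Real.sq_sqrt (by positivity)
  calc _ ≤ ∫ ω, (2 * ‖X p.1 p.2 ω * X p.2 p.1 ω‖ ^ 2 + 2 * (1 + C)) ∂P := by
        refine integral_mono ((h.memLp_fluctuation p).integrable_norm_pow (by norm_num))
          ((i1.const_mul 2).add (integrable_const _)) fun ω => ?_
        simp only [fluctuation]
        generalize X p.1 p.2 ω * X p.2 p.1 ω = u
        generalize ∫ ω', X p.1 p.2 ω' * X p.2 p.1 ω' ∂P = v at hE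
        nlinarith [pow_le_pow_left₀ (norm_nonneg _) (norm_sub_le u v) 2, sq_nonneg (‖u‖ - ‖v‖)]
    _ ≤ _ := by
        rw [integral_add (i1.const_mul 2) (integrable_const _), integral_const_mul]
        simp only [integral_const, probReal_univ, smul_eq_mul, one_mul]
        linarith

omit [Fintype ι] [IsProbabilityMeasure P] in
lemma measurable_fluctuation (h : IsNoiseArray P X C) (p : ι × ι) :
    Measurable[⨆ e ∈ ({s(p.1, p.2)} : Set (Sym2 ι)), edgeAlgebra X e] (fluctuation P X p) := by
  have h1 := h.measurable_iSup_edgeAlgebra (Set.mem_singleton s(p.1, p.2))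
  have h2 := h.measurable_iSup_edgeAlgebra
    (S := {s(p.1, p.2)}) (i := p.2) (j := p.1) (by rw [Sym2.eq_swap]; rfl)
  exact (h1.mul h2).sub_const _

omit [Fintype ι] in
-- Each fluctuation is a function of a single edge, so two of them on different edges are
-- independent, and they are centered.
lemma integral_fluctuation_mul_conj (h : IsNoiseArray P X C) {p q : ι × ι}
    (hpq : s(p.1, p.2) ≠ s(q.1, q.2)) :
    ∫ ω, fluctuation P X p ω * conj (fluctuation P X q ω) ∂P = 0 := by
  have hq : Measurable[⨆ e ∈ ({s(q.1, q.2)} : Set (Sym2 ι)), edgeAlgebra X e]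
      (fun ω => conj (fluctuation P X q ω)) :=
    RCLike.continuous_conj.measurable.comp (h.measurable_fluctuation q)
  rw [h.integral_mul_of_disjoint (Set.disjoint_singleton.2 hpq) (h.measurable_fluctuation p) hq,
    h.integral_fluctuation, zero_mul]

lemma card_filter_edge_le (q : ι × ι) :
    ((Finset.univ : Finset (ι × ι)).filter fun p => s(p.1, p.2) = s(q.1, q.2)).card ≤ 2 := by
  refine (Finset.card_le_card (t := {q, q.swap}) fun p hp => ?_).trans Finset.card_le_two
  simp only [Finset.mem_filter, Finset.mem_univ, true_and, Sym2.eq_iff] at hp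
  simp only [Finset.mem_insert, Finset.mem_singleton, Prod.ext_iff, Prod.fst_swap, Prod.snd_swap]
  exact hp

/-- Second moment of the fluctuations of the quadratic statistic. -/
lemma integral_norm_quadratic_sub_sq_le (h : IsNoiseArray P X C) (hC : 0 ≤ C) (c : ι × ι → ℂ)
    {K : ℝ} (hc : ∀ p, ‖c p‖ ≤ K) :
    ∫ ω, ‖∑ p : ι × ι, c p * fluctuation P X p ω‖ ^ 2 ∂P
      ≤ 8 * K ^ 2 * (1 + C) * (Fintype.card ι) ^ 2 := by
  have := integral_norm_sum_sq_le (P := P) Finset.univ c (fluctuation P X)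
    (fun p q => s(p.1, p.2) = s(q.1, q.2))
    (K := K) (V := 4 * (1 + C)) (N := 2) (by positivity) (fun p _ => hc p)
    (fun p _ => h.memLp_fluctuation p) (fun p _ => h.integral_norm_fluctuation_sq_le hC p)
    (fun p _ q _ hpq => h.integral_fluctuation_mul_conj hpq)
    (fun q _ => card_filter_edge_le q)
  refine this.trans_eq ?_
  rw [Finset.card_univ, Fintype.card_prod]
  push_cast
  ring

/-- Second moment of an entry of `x g x`, with `g` diagonal. -/
lemma integral_norm_sandwich_sq_le (h : IsNoiseArray P X C) (hC : 0 ≤ C) (g : ι → ℂ)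
    {K : ℝ} (hg : ∀ i, ‖g i‖ ≤ K) (i j : ι) :
    ∫ ω, ‖∑ k, g k * (X i k ω * X k j ω)‖ ^ 2 ∂P
      ≤ K ^ 2 * (1 + C) * (if i = j then (Fintype.card ι : ℝ) else 1) * Fintype.card ι := by
  have := integral_norm_sum_sq_le (P := P) Finset.univ g (fun k ω => X i k ω * X k j ω)
    -- Off the diagonal a term is correlated only with itself. On the diagonal the terms are `‖X i
    -- k‖²` and need not be centered, so all pairs are admitted.
    (fun k l => i = j ∨ k = l)
    (K := K) (V := 1 + C) (N := if i = j then Fintype.card ι else 1) (by positivity)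
    (fun k _ => hg k)
    (fun k _ => (h.memLp_pair i k k j).1) (fun k _ => (h.memLp_pair i k k j).2)
    (fun k _ l _ hkl => by
      obtain ⟨hij, hkl⟩ := not_or.1 hkl
      have e : ∀ ω, X i k ω * X k j ω * conj (X i l ω * X l j ω)
          = ∏ r : Fin 4, X (![i, k, l, j] r) (![k, j, i, l] r) ω := fun ω => by
        simp [Fin.prod_univ_four, ← h.hermitian, mul_assoc]
      simp_rw [e]
      -- The edge `{i, k}` occurs only once among the four, unless it coincides with `{j, l}`. In
      -- that case `{k, j}` is a loop at `j` that occurs only once.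
      by_cases hc : i = l ∧ k = j
      · obtain ⟨rfl, rfl⟩ := hc
        refine h.integral_prod_eq_zero _ _ 1 fun r hr => ?_
        fin_cases r <;> simp_all
      · refine h.integral_prod_eq_zero _ _ 0 fun r hr => ?_
        fin_cases r <;> simp_all <;> grind)
    (fun l _ => by
      split_ifs with hij
      · exact Finset.card_le_univ _
      · simp [hij, Finset.filter_eq'])
  simpa [apply_ite (Nat.cast : ℕ → ℝ)] using this

/-- Each of the three possible coincidences leaves two free indices. -/
lemma card_not_distinct_le :
    ((Finset.univ : Finset (ι × ι × ι)).filter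
      fun a => ¬(a.1 ≠ a.2.1 ∧ a.2.1 ≠ a.2.2 ∧ a.2.2 ≠ a.1)).card ≤ 3 * Fintype.card ι ^ 2 := by
  classical
  let F₁ : ι × ι → ι × ι × ι := fun p => (p.1, p.1, p.2)
  let F₂ : ι × ι → ι × ι × ι := fun p => (p.1, p.2, p.2)
  let F₃ : ι × ι → ι × ι × ι := fun p => (p.1, p.2, p.1)
  have hsub : ((Finset.univ : Finset (ι × ι × ι)).filter
      fun a => ¬(a.1 ≠ a.2.1 ∧ a.2.1 ≠ a.2.2 ∧ a.2.2 ≠ a.1))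
      ⊆ Finset.univ.image F₁ ∪ Finset.univ.image F₂ ∪ Finset.univ.image F₃ := by
    rintro ⟨i, j, k⟩ hp
    simp only [Finset.mem_filter, Finset.mem_univ, true_and] at hp
    simp only [Finset.mem_union, Finset.mem_image, Finset.mem_univ, true_and, F₁, F₂, F₃,
      Prod.mk.injEq, Prod.exists]
    grind
  have hcard : ∀ F : ι × ι → ι × ι × ι, (Finset.univ.image F).card ≤ Fintype.card ι ^ 2 := fun F =>
    Finset.card_image_le.trans_eq (by rw [Finset.card_univ, Fintype.card_prod, sq])
  have h1 := Finset.card_union_le (Finset.univ.image F₁ ∪ Finset.univ.image F₂)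
    (Finset.univ.image F₃)
  have h2 := Finset.card_union_le (Finset.univ.image F₁) (Finset.univ.image F₂)
  have := Finset.card_le_card hsub
  have := hcard F₁
  have := hcard F₂
  have := hcard F₃
  omega

/-- Second moment of the cubic statistic. -/
lemma integral_norm_cubic_sq_le (h : IsNoiseArray P X C) (hC : 0 ≤ C) (c : ι × ι × ι → ℂ)
    {K : ℝ} (hc : ∀ a, ‖c a‖ ≤ K) :
    MemLp (fun ω => ∑ a : ι × ι × ι,
      c a * (X a.1 a.2.1 ω * X a.2.1 a.2.2 ω * X a.2.2 a.1 ω)) 2 P ∧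
    ∫ ω, ‖∑ a : ι × ι × ι, c a * (X a.1 a.2.1 ω * X a.2.1 a.2.2 ω * X a.2.2 a.1 ω)‖ ^ 2 ∂P
      ≤ 72 * K ^ 2 * (1 + C) * (Fintype.card ι) ^ 4 := by
  classical
  set W : ι × ι × ι → Ω → ℂ := fun a ω => X a.1 a.2.1 ω * X a.2.1 a.2.2 ω * X a.2.2 a.1 ω with hW
  set D : ι × ι × ι → Prop := fun a => a.1 ≠ a.2.1 ∧ a.2.1 ≠ a.2.2 ∧ a.2.2 ≠ a.1 with hD
  have hWL := fun a : ι × ι × ι => h.memLp_triple a.1 a.2.1 a.2.1 a.2.2 a.2.2 a.1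
  have hL : ∀ A : Finset (ι × ι × ι), MemLp (fun ω => ∑ a ∈ A, c a * W a ω) 2 P := fun A =>
    memLp_finsetSum _ fun a _ => (hWL a).1.const_mul _
  refine ⟨hL _, ?_⟩
  set n : ℝ := (Fintype.card ι : ℝ) with hn
  have hd : ∫ ω, ‖∑ a ∈ Finset.univ.filter D, c a * W a ω‖ ^ 2 ∂P
      ≤ K ^ 2 * (1 + C) * 27 * n ^ 3 := by
    have := integral_norm_sum_sq_le (P := P) (Finset.univ.filter D) c W
      -- Two triangles with distinct vertices can be correlated only if they have the same vertices.
      -- Admitting every triple over the vertices of `b` gives the simple count `27 = 3³`.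
      (fun a b => a ∈ ({b.1, b.2.1, b.2.2} : Finset ι) ×ˢ ({b.1, b.2.1, b.2.2} : Finset ι) ×ˢ
        ({b.1, b.2.1, b.2.2} : Finset ι))
      (K := K) (V := 1 + C) (N := 27) (by positivity) (fun a _ => hc a)
      (fun a _ => (hWL a).1) (fun a _ => (hWL a).2)
      (fun a ha b hb hab => by
        obtain ⟨i, j, k⟩ := a
        obtain ⟨p, q, r⟩ := b
        simp only [Finset.mem_filter, Finset.mem_univ, true_and, hD] at ha hb
        have e : ∀ ω, W (i, j, k) ω * conj (W (p, q, r) ω)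
            = ∏ m : Fin 6, X (![i, j, k, q, r, p] m) (![j, k, i, p, q, r] m) ω := fun ω => by
          simp [hW, Fin.prod_univ_six, ← h.hermitian, mul_assoc]
        simp_rw [e]
        simp only [Finset.mem_product, Finset.mem_insert, Finset.mem_singleton] at hab
        -- Some vertex of the first triangle is missing from the second. If it is `i` or `j`, the
        -- edge `{i, j}` is unmatched; otherwise it is `k`, and `{j, k}` is unmatched.
        by_cases hij : (i = p ∨ i = q ∨ i = r) ∧ (j = p ∨ j = q ∨ j = r)
        · refine h.integral_prod_eq_zero _ _ 1 fun m hm => ?_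
          fin_cases m <;> simp at hm ⊢ <;> grind
        · refine h.integral_prod_eq_zero _ _ 0 fun m hm => ?_
          fin_cases m <;> simp at hm ⊢ <;> grind)
      (fun b _ => by
        refine (Finset.card_le_card (t := ({b.1, b.2.1, b.2.2} : Finset ι) ×ˢ
          ({b.1, b.2.1, b.2.2} : Finset ι) ×ˢ ({b.1, b.2.1, b.2.2} : Finset ι))
          fun a ha => (Finset.mem_filter.1 ha).2).trans ?_
        have h3 : ({b.1, b.2.1, b.2.2} : Finset ι).card ≤ 3 := Finset.card_le_three
        rw [Finset.card_product, Finset.card_product]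
        calc _ ≤ 3 * (3 * 3) := Nat.mul_le_mul h3 (Nat.mul_le_mul h3 h3)
          _ = 27 := by norm_num)
    refine this.trans ?_
    have hcard : (((Finset.univ.filter D).card : ℕ) : ℝ) ≤ n ^ 3 := by
      rw [hn]
      exact_mod_cast (Finset.card_le_univ _).trans_eq
        (by rw [Fintype.card_prod, Fintype.card_prod]; ring)
    push_cast
    gcongr
  -- There are at most `3 n²` degenerate triples, so admitting all pairs of them already gives order
  -- `n⁴`.
  have hnd : ∫ ω, ‖∑ a ∈ Finset.univ.filter (fun a => ¬ D a), c a * W a ω‖ ^ 2 ∂P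
      ≤ K ^ 2 * (1 + C) * (3 * n ^ 2) * (3 * n ^ 2) := by
    have hcard : (((Finset.univ.filter (fun a => ¬ D a)).card : ℕ) : ℝ) ≤ 3 * n ^ 2 := by
      rw [hn]
      exact_mod_cast card_not_distinct_le (ι := ι)
    have := integral_norm_sum_sq_le (P := P) (Finset.univ.filter (fun a => ¬ D a)) c W
      (fun _ _ => True) (K := K) (V := 1 + C)
      (N := (Finset.univ.filter (fun a => ¬ D a)).card) (by positivity) (fun a _ => hc a)
      (fun a _ => (hWL a).1) (fun a _ => (hWL a).2) (fun a _ b _ hab => absurd trivial hab)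
      (fun b _ => Finset.card_filter_le _ _)
    refine this.trans ?_
    gcongr
  have hsplit : ∀ ω, ∑ a, c a * W a ω = ∑ a ∈ Finset.univ.filter D, c a * W a ω
      + ∑ a ∈ Finset.univ.filter (fun a => ¬ D a), c a * W a ω := fun ω =>
    (Finset.sum_filter_add_sum_filter_not _ _ _).symm
  have hid := (hL (Finset.univ.filter D)).integrable_norm_pow (p := 2) (by norm_num)
  have hind := (hL (Finset.univ.filter (fun a => ¬ D a))).integrable_norm_pow (p := 2) (by norm_num)
  have hn3 : n ^ 3 ≤ n ^ 4 := by
    rw [hn]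
    rcases Nat.eq_zero_or_pos (Fintype.card ι) with h0 | h0
    · simp [h0]
    · exact pow_le_pow_right₀ (by exact_mod_cast h0) (by norm_num)
  calc ∫ ω, ‖∑ a, c a * W a ω‖ ^ 2 ∂P
      ≤ ∫ ω, (2 * ‖∑ a ∈ Finset.univ.filter D, c a * W a ω‖ ^ 2
        + 2 * ‖∑ a ∈ Finset.univ.filter (fun a => ¬ D a), c a * W a ω‖ ^ 2) ∂P := by
        refine integral_mono ((hL _).integrable_norm_pow (by norm_num))
          ((hid.const_mul 2).add (hind.const_mul 2)) fun ω => ?_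
        simp only [hsplit]
        generalize ∑ a ∈ Finset.univ.filter D, c a * W a ω = u
        generalize ∑ a ∈ Finset.univ.filter (fun a => ¬ D a), c a * W a ω = v
        nlinarith [pow_le_pow_left₀ (norm_nonneg _) (norm_add_le u v) 2, sq_nonneg (‖u‖ - ‖v‖)]
    _ ≤ 2 * (K ^ 2 * (1 + C) * 27 * n ^ 3) + 2 * (K ^ 2 * (1 + C) * (3 * n ^ 2) * (3 * n ^ 2)) := by
        rw [integral_add (hid.const_mul 2) (hind.const_mul 2), integral_const_mul,
          integral_const_mul]
        linarith
    _ ≤ _ := by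
        -- The constant is `72 = 2 · 27 + 2 · 9`, once `n³` is replaced by `n⁴`.
        have : K ^ 2 * (1 + C) * n ^ 3 ≤ K ^ 2 * (1 + C) * n ^ 4 := by gcongr
        nlinarith

end IsNoiseArray

end NoiseArray

/-! ### Expansion of the resolvent -/

section Resolvent

variable {ι κ : Type*} [Fintype ι] [Fintype κ]

/-- The squared Frobenius norm of a matrix. -/
def frobSq (M : Matrix ι κ ℂ) : ℝ := ∑ i, ∑ j, ‖M i j‖ ^ 2

lemma frobSq_nonneg (M : Matrix ι κ ℂ) : 0 ≤ frobSq M :=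
  Finset.sum_nonneg fun _ _ => Finset.sum_nonneg fun _ _ => by positivity

lemma trace_conjTranspose_mul_self (M : Matrix ι κ ℂ) :
    Matrix.trace (M.conjTranspose * M) = (frobSq M : ℂ) := by
  simp only [Matrix.trace, Matrix.diag, Matrix.mul_apply, Matrix.conjTranspose_apply, frobSq]
  rw [Finset.sum_comm]
  push_cast
  refine Finset.sum_congr rfl fun i _ => Finset.sum_congr rfl fun j _ => ?_
  rw [← Complex.conj_mul']
  rfl

lemma norm_trace_mul_le (M : Matrix ι κ ℂ) (N : Matrix κ ι ℂ) :
    ‖Matrix.trace (M * N)‖ ≤ (frobSq M + frobSq N) / 2 := by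
  have h : frobSq N = ∑ i, ∑ j, ‖N j i‖ ^ 2 := Finset.sum_comm
  rw [h, frobSq, ← Finset.sum_add_distrib, Finset.sum_div]
  simp only [Matrix.trace, Matrix.diag, Matrix.mul_apply]
  refine (norm_sum_le _ _).trans (Finset.sum_le_sum fun i _ => ?_)
  rw [← Finset.sum_add_distrib, Finset.sum_div]
  refine (norm_sum_le _ _).trans (Finset.sum_le_sum fun j _ => ?_)
  rw [norm_mul]
  nlinarith [sq_nonneg (‖M i j‖ - ‖N j i‖)]

variable [DecidableEq ι]

/-- With `B = Re z - H` Hermitian, the cross terms in `(B + i Im z)ᴴ (B + i Im z)` cancel and leave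
`Bᴴ B + (Im z)²`, hence a sum of two squared Frobenius norms after multiplication by `N`. -/
lemma im_sq_mul_frobSq_le {H : Matrix ι ι ℂ} (hH : H.IsHermitian) (z : ℂ) (N : Matrix ι κ ℂ) :
    z.im ^ 2 * frobSq N ≤ frobSq ((Matrix.scalar ι z - H) * N) := by
  set B : Matrix ι ι ℂ := (z.re : ℂ) • 1 - H with hB
  have hBH : B.conjTranspose = B := by
    rw [hB, Matrix.conjTranspose_sub, hH.eq, Matrix.conjTranspose_smul]
    simp
  have hA : Matrix.scalar ι z - H = B + (z.im * Complex.I) • 1 := by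
    rw [hB, sub_add_eq_add_sub, ← add_smul, Complex.re_add_im, Matrix.smul_one_eq_diagonal]
    rfl
  have hAA : (Matrix.scalar ι z - H).conjTranspose * (Matrix.scalar ι z - H)
      = B.conjTranspose * B + ((z.im ^ 2 : ℝ) : ℂ) • 1 := by
    rw [hA, Matrix.conjTranspose_add, hBH, Matrix.conjTranspose_smul]
    simp only [Matrix.conjTranspose_one, add_mul, mul_add, Matrix.smul_mul, Matrix.mul_smul,
      one_mul, mul_one, star_mul', RCLike.star_def, Complex.conj_I, Complex.conj_ofReal, smul_smul]
    have : (z.im * Complex.I) * ((z.im : ℂ) * -Complex.I) = ((z.im ^ 2 : ℝ) : ℂ) := by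
      push_cast
      linear_combination -(z.im : ℂ) ^ 2 * Complex.I_sq
    rw [this]
    have h2 : ((z.im : ℂ) * -Complex.I) • B = -((z.im * Complex.I) • B) := by
      rw [mul_neg, neg_smul]
    rw [h2]
    abel
  have key : (frobSq ((Matrix.scalar ι z - H) * N) : ℂ)
      = ((frobSq (B * N) + z.im ^ 2 * frobSq N : ℝ) : ℂ) := by
    rw [← trace_conjTranspose_mul_self, Matrix.conjTranspose_mul, Matrix.mul_assoc,
      ← Matrix.mul_assoc (Matrix.conjTranspose _) _ N, hAA, Matrix.add_mul, Matrix.mul_add,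
      Matrix.trace_add, Matrix.smul_mul, Matrix.mul_smul, Matrix.trace_smul, Matrix.one_mul,
      Matrix.mul_assoc, ← Matrix.mul_assoc, ← Matrix.conjTranspose_mul,
      trace_conjTranspose_mul_self, trace_conjTranspose_mul_self]
    push_cast
    rfl
  have := Complex.ofReal_injective key
  linarith [frobSq_nonneg (B * N)]

/-- A kernel vector, viewed as a matrix with one column, has Frobenius norm zero by the preceding
inequality. -/
lemma isUnit_scalar_sub {H : Matrix ι ι ℂ} (hH : H.IsHermitian) {z : ℂ} (hz : z.im ≠ 0) :
    IsUnit (Matrix.scalar ι z - H).det := by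
  rw [isUnit_iff_ne_zero]
  intro h0
  obtain ⟨v, hv, hv0⟩ := Matrix.exists_mulVec_eq_zero_iff.2 h0
  have h1 := im_sq_mul_frobSq_le hH z (Matrix.replicateCol Unit v)
  rw [← Matrix.replicateCol_mulVec, hv0] at h1
  refine hv (funext fun i => ?_)
  have h2 : frobSq (Matrix.replicateCol Unit v) ≤ 0 := by
    refine nonpos_of_mul_nonpos_right (h1.trans_eq ?_) (by positivity)
    simp [frobSq]
  have h3 : ‖v i‖ ^ 2 ≤ frobSq (Matrix.replicateCol Unit v) := by
    simp only [frobSq, Matrix.replicateCol_apply, Finset.univ_unique, Finset.sum_const,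
      Finset.card_singleton, one_smul]
    exact Finset.single_le_sum (f := fun i => ‖v i‖ ^ 2) (fun _ _ => by positivity)
      (Finset.mem_univ i)
  have h4 : ‖v i‖ ^ 2 = 0 := le_antisymm (h3.trans h2) (by positivity)
  simpa using h4

lemma frobSq_resolvent_mul_le {H : Matrix ι ι ℂ} (hH : H.IsHermitian) {z : ℂ} (hz : z.im ≠ 0)
    (N : Matrix ι κ ℂ) :
    frobSq ((Matrix.scalar ι z - H)⁻¹ * N) ≤ (z.im ^ 2)⁻¹ * frobSq N := by
  have := im_sq_mul_frobSq_le hH z ((Matrix.scalar ι z - H)⁻¹ * N)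
  rw [← Matrix.mul_assoc, Matrix.mul_nonsing_inv _ (isUnit_scalar_sub hH hz), Matrix.one_mul]
    at this
  rw [inv_mul_eq_div, le_div_iff₀ (by positivity)]
  linarith

lemma sub_ofReal_ne_zero {z : ℂ} (hz : z.im ≠ 0) (t : ℝ) : z - (t : ℂ) ≠ 0 := fun h =>
  hz (by simpa using congrArg Complex.im h)

lemma norm_inv_sub_ofReal_le {z : ℂ} (hz : z.im ≠ 0) (t : ℝ) : ‖(z - (t : ℂ))⁻¹‖ ≤ |z.im|⁻¹ := by
  rw [norm_inv]
  refine inv_anti₀ (abs_pos.2 hz) ?_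
  simpa using Complex.abs_im_le_norm (z - (t : ℂ))

lemma resolvent_diagonal (l : ι → ℝ) {z : ℂ} (hz : z.im ≠ 0) :
    (Matrix.scalar ι z - Matrix.diagonal fun i => (l i : ℂ))⁻¹
      = Matrix.diagonal fun i => (z - (l i : ℂ))⁻¹ := by
  refine Matrix.inv_eq_right_inv ?_
  rw [Matrix.scalar_apply, Matrix.diagonal_sub, Matrix.diagonal_mul_diagonal]
  simp [mul_inv_cancel₀ (sub_ofReal_ne_zero hz _)]

/-- The remainder of order four in the expansion of the trace of the resolvent. -/
def resolventRemainder (l : ι → ℝ) (X : Matrix ι ι ℂ) (η : ℝ) (z : ℂ) : ℂ :=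
  Matrix.trace ((Matrix.scalar ι z - ((Matrix.diagonal fun i => (l i : ℂ)) + (η : ℂ) • X))⁻¹
    * (X * (Matrix.diagonal fun i => (z - (l i : ℂ))⁻¹)) ^ 4)

omit [Fintype ι] in
lemma isHermitian_diagonal_add_smul (l : ι → ℝ) {X : Matrix ι ι ℂ} (hX : X.IsHermitian) (η : ℝ) :
    ((Matrix.diagonal fun i => (l i : ℂ)) + (η : ℂ) • X).IsHermitian := by
  refine Matrix.IsHermitian.add ?_ ?_
  · exact Matrix.isHermitian_diagonal_of_self_adjoint _ (funext fun i => Complex.conj_ofReal _)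
  · rw [Matrix.IsHermitian, Matrix.conjTranspose_smul, hX.eq]
    simp

/-- With `G` the resolvent of the diagonal matrix, the identity `R = G + η R X G` is inserted into
itself until `R` appears only at order four. The diagonality of `G` turns the traces of the lower
orders into explicit sums. -/
lemma trace_resolvent_eq (l : ι → ℝ) {X : Matrix ι ι ℂ} (hX : X.IsHermitian) (η : ℝ) {z : ℂ}
    (hz : z.im ≠ 0) {g : ι → ℂ} (hg : g = fun i => (z - (l i : ℂ))⁻¹) :
    Matrix.trace
        (Matrix.scalar ι z - ((Matrix.diagonal fun i => (l i : ℂ)) + (η : ℂ) • X))⁻¹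
      = Matrix.trace (Matrix.scalar ι z - Matrix.diagonal fun i => (l i : ℂ))⁻¹
        + η * ∑ i, g i ^ 2 * X i i
        + (η : ℂ) ^ 2 * ∑ p : ι × ι, g p.1 ^ 2 * g p.2 * (X p.1 p.2 * X p.2 p.1)
        + (η : ℂ) ^ 3 * ∑ a : ι × ι × ι, g a.1 ^ 2 * g a.2.1 * g a.2.2
            * (X a.1 a.2.1 * X a.2.1 a.2.2 * X a.2.2 a.1)
        + (η : ℂ) ^ 4 * resolventRemainder l X η z := by
  rw [resolventRemainder, resolvent_diagonal l hz]
  have hdet := isUnit_scalar_sub (isHermitian_diagonal_add_smul l hX η) hz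
  set A : Matrix ι ι ℂ := Matrix.scalar ι z - ((Matrix.diagonal fun i => (l i : ℂ)) + (η : ℂ) • X)
  have hAdef : A = Matrix.scalar ι z - ((Matrix.diagonal fun i => (l i : ℂ)) + (η : ℂ) • X) := rfl
  rw [← hg]
  set G : Matrix ι ι ℂ := Matrix.diagonal g
  set R := A⁻¹
  set Y := X * G with hY
  have hAG : A * G = 1 - (η : ℂ) • Y := by
    have : (Matrix.scalar ι z - Matrix.diagonal fun i => (l i : ℂ)) * G = 1 := by
      rw [Matrix.scalar_apply, Matrix.diagonal_sub, Matrix.diagonal_mul_diagonal, hg]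
      simp [mul_inv_cancel₀ (sub_ofReal_ne_zero hz _)]
    rw [hAdef, ← sub_sub, Matrix.sub_mul, this, Matrix.smul_mul]
  have h0 : R = G + (η : ℂ) • (R * Y) := by
    have := congrArg (fun M => R * M) hAG
    simp only [← Matrix.mul_assoc, Matrix.mul_sub, Matrix.mul_one, Matrix.mul_smul] at this
    rw [Matrix.nonsing_inv_mul _ hdet, Matrix.one_mul] at this
    rw [this]; abel
  have step : ∀ k : ℕ, R * Y ^ k = G * Y ^ k + (η : ℂ) • (R * Y ^ (k + 1)) := fun k => by
    conv_lhs => rw [h0]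
    rw [Matrix.add_mul, Matrix.smul_mul, pow_succ', Matrix.mul_assoc]
  have hexp : R = G + (η : ℂ) • (G * Y ^ 1) + (η : ℂ) ^ 2 • (G * Y ^ 2)
      + (η : ℂ) ^ 3 • (G * Y ^ 3) + (η : ℂ) ^ 4 • (R * Y ^ 4) := by
    have s0 := step 0
    rw [step 1, step 2, step 3] at s0
    simp only [pow_zero, Matrix.mul_one, smul_add, smul_smul] at s0
    refine s0.trans ?_
    simp only [Nat.reduceAdd, ← pow_two, ← pow_succ', ← add_assoc]
  have hGY : ∀ i j, (G * Y) i j = g i * (X i j * g j) := fun i j => by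
    simp [G, hY, Matrix.diagonal_mul, Matrix.mul_diagonal]
  have hYa : ∀ i j, Y i j = X i j * g j := fun i j => by
    simp [G, hY, Matrix.mul_diagonal]
  have t1 : Matrix.trace (G * Y ^ 1) = ∑ i, g i ^ 2 * X i i := by
    simp only [Matrix.trace, Matrix.diag, pow_one, hGY]
    exact Finset.sum_congr rfl fun i _ => by ring
  have t2 : Matrix.trace (G * Y ^ 2)
      = ∑ p : ι × ι, g p.1 ^ 2 * g p.2 * (X p.1 p.2 * X p.2 p.1) := by
    rw [pow_two, ← Matrix.mul_assoc, Fintype.sum_prod_type]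
    simp only [Matrix.trace, Matrix.diag, Matrix.mul_apply (M := G * Y), hGY, hYa]
    exact Finset.sum_congr rfl fun i _ => Finset.sum_congr rfl fun j _ => by ring
  have t3 : Matrix.trace (G * Y ^ 3) = ∑ a : ι × ι × ι, g a.1 ^ 2 * g a.2.1 * g a.2.2
            * (X a.1 a.2.1 * X a.2.1 a.2.2 * X a.2.2 a.1) := by
    rw [pow_succ', pow_two, ← Matrix.mul_assoc, Fintype.sum_prod_type]
    simp only [Fintype.sum_prod_type]
    simp only [Matrix.trace, Matrix.diag, Matrix.mul_apply (M := G * Y),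
      Matrix.mul_apply (M := Y), hGY, hYa, Finset.mul_sum]
    exact Finset.sum_congr rfl fun i _ => Finset.sum_congr rfl fun j _ =>
      Finset.sum_congr rfl fun k _ => by ring
  conv_lhs => rw [hexp]
  simp only [Matrix.trace_add, Matrix.trace_smul, t1, t2, t3, smul_eq_mul]

/-- The product `R (X G)⁴` is regrouped as `(R · XGX) (G · XGX · G)`. Each group is bounded in
Frobenius norm by `XGX`, whose entries are the sums on the right; the two powers of `(Im z)⁻²` come
from `R` and from the two outer factors `G`. -/
lemma norm_resolventRemainder_le (l : ι → ℝ) {X : Matrix ι ι ℂ} (hX : X.IsHermitian) (η : ℝ)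
    {z : ℂ} (hz : z.im ≠ 0) :
    ‖resolventRemainder l X η z‖ ≤ ((z.im ^ 2)⁻¹ + (z.im ^ 2)⁻¹ ^ 2) / 2
      * ∑ i, ∑ j, ‖∑ k, (z - (l k : ℂ))⁻¹ * (X i k * X k j)‖ ^ 2 := by
  set G : Matrix ι ι ℂ := Matrix.diagonal fun i => (z - (l i : ℂ))⁻¹ with hG
  set R := (Matrix.scalar ι z - ((Matrix.diagonal fun i => (l i : ℂ)) + (η : ℂ) • X))⁻¹ with hR
  have hQ : ∑ i, ∑ j, ‖∑ k, (z - (l k : ℂ))⁻¹ * (X i k * X k j)‖ ^ 2 = frobSq (X * G * X) := by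
    rw [frobSq]
    refine Finset.sum_congr rfl fun i _ => Finset.sum_congr rfl fun j _ => ?_
    rw [Matrix.mul_apply]
    congr 2
    refine Finset.sum_congr rfl fun k _ => ?_
    rw [hG, Matrix.mul_diagonal]
    ring
  have hsplit : R * (X * G) ^ 4 = (R * (X * G * X)) * (G * (X * G * X) * G) := by
    simp only [pow_succ, pow_zero, one_mul, Matrix.mul_assoc]
  have hE : frobSq (G * (X * G * X) * G) ≤ (z.im ^ 2)⁻¹ ^ 2 * frobSq (X * G * X) := by
    rw [frobSq, frobSq, Finset.mul_sum]
    refine Finset.sum_le_sum fun i _ => ?_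
    rw [Finset.mul_sum]
    refine Finset.sum_le_sum fun j _ => ?_
    rw [hG, Matrix.mul_diagonal, Matrix.diagonal_mul, norm_mul, norm_mul, mul_pow, mul_pow]
    have hb : ∀ t : ℝ, ‖(z - (t : ℂ))⁻¹‖ ^ 2 ≤ (z.im ^ 2)⁻¹ := fun t => by
      rw [← sq_abs z.im, ← inv_pow]
      exact pow_le_pow_left₀ (norm_nonneg _) (norm_inv_sub_ofReal_le hz t) 2
    calc _ ≤ (z.im ^ 2)⁻¹ * ‖(X * G * X) i j‖ ^ 2 * (z.im ^ 2)⁻¹ := by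
          gcongr
          · exact hb _
          · exact hb _
      _ = _ := by ring
  rw [hQ]
  change ‖Matrix.trace (R * (X * G) ^ 4)‖ ≤ _
  rw [hsplit]
  refine (norm_trace_mul_le _ _).trans ?_
  have := frobSq_resolvent_mul_le (isHermitian_diagonal_add_smul l hX η) hz (X * G * X)
  linarith

end Resolvent

/-! ### Riemann sums along the step profiles -/

section Riemann

variable {E : Type*} [NormedAddCommGroup E] [NormedSpace ℝ E]

/-- The interval `[1/n, 1]`, on which `⌊n s⌋` is an index. -/
abbrev cells (n : ℕ) : Set ℝ := Set.Icc (1 / (n : ℝ)) 1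

lemma cells_subset (n : ℕ) : cells n ⊆ Set.Icc (0 : ℝ) 1 :=
  Set.Icc_subset_Icc_left (by positivity)

lemma floor_mem_of_mem_cells {n : ℕ} (hn : 1 ≤ n) {s : ℝ} (hs : s ∈ cells n) :
    ⌊(n : ℝ) * s⌋₊ ∈ Finset.Icc 1 n := by
  have hn' : (0 : ℝ) < n := by exact_mod_cast hn
  rw [Finset.mem_Icc]
  constructor
  · rw [Nat.one_le_floor_iff]
    have := (div_le_iff₀ hn').1 hs.1
    linarith
  · refine Nat.floor_le_of_le ?_
    nlinarith [hs.2]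

lemma eventually_mem_cells {s : ℝ} (hs : s ∈ Set.Ioc (0 : ℝ) 1) :
    ∀ᶠ n : ℕ in atTop, s ∈ cells n := by
  filter_upwards [tendsto_one_div_atTop_nhds_zero_nat.eventually (gt_mem_nhds hs.1)] with n hn
  exact ⟨hn.le, hs.2⟩

lemma measurable_floor_mul (n : ℕ) : Measurable fun s : ℝ => ⌊(n : ℝ) * s⌋₊ :=
  Nat.measurable_floor.comp (measurable_const_mul _)

omit [NormedSpace ℝ E] in
lemma aestronglyMeasurable_step (n : ℕ) (h : ℕ → E) (μ : Measure ℝ) :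
    AEStronglyMeasurable (fun s : ℝ => h ⌊(n : ℝ) * s⌋₊) μ :=
  ((StronglyMeasurable.of_discrete (f := h)).comp_measurable
    (measurable_floor_mul n)).aestronglyMeasurable

omit [NormedSpace ℝ E] in
lemma aestronglyMeasurable_step₂ (n : ℕ) (h : ℕ → ℕ → E) (μ : Measure (ℝ × ℝ)) :
    AEStronglyMeasurable (fun p : ℝ × ℝ => h ⌊(n : ℝ) * p.1⌋₊ ⌊(n : ℝ) * p.2⌋₊) μ :=
  ((StronglyMeasurable.of_discrete (f := fun q : ℕ × ℕ => h q.1 q.2)).comp_measurable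
    (((measurable_floor_mul n).comp measurable_fst).prodMk
      ((measurable_floor_mul n).comp measurable_snd))).aestronglyMeasurable

omit [NormedSpace ℝ E] in
lemma integrableOn_step {n : ℕ} (hn : 1 ≤ n) (h : ℕ → E) :
    IntegrableOn (fun s : ℝ => h ⌊(n : ℝ) * s⌋₊) (cells n) := by
  refine IntegrableOn.of_bound (by simp) (aestronglyMeasurable_step n h _)
    (∑ i ∈ Finset.Icc 1 n, ‖h i‖) ((ae_restrict_iff' measurableSet_Icc).2 (ae_of_all _ fun s hs => ?_))
  exact Finset.single_le_sum (f := fun i => ‖h i‖) (fun _ _ => norm_nonneg _)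
    (floor_mem_of_mem_cells hn hs)

lemma volume_prod_cells_lt_top (n : ℕ) : (volume : Measure (ℝ × ℝ)) (cells n ×ˢ cells n) < ⊤ := by
  rw [Measure.volume_eq_prod, Measure.prod_prod]
  exact ENNReal.mul_lt_top (by simp) (by simp)

omit [NormedSpace ℝ E] in
lemma integrableOn_step₂ {n : ℕ} (hn : 1 ≤ n) (h : ℕ → ℕ → E) :
    IntegrableOn (fun p : ℝ × ℝ => h ⌊(n : ℝ) * p.1⌋₊ ⌊(n : ℝ) * p.2⌋₊) (cells n ×ˢ cells n) := by
  refine IntegrableOn.of_bound (volume_prod_cells_lt_top n) (aestronglyMeasurable_step₂ n h _)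
    (∑ q ∈ Finset.Icc 1 n ×ˢ Finset.Icc 1 n, ‖h q.1 q.2‖)
    ((ae_restrict_iff' (measurableSet_Icc.prod measurableSet_Icc)).2 (ae_of_all _ fun p hp => ?_))
  exact Finset.single_le_sum (f := fun q : ℕ × ℕ => ‖h q.1 q.2‖) (fun _ _ => norm_nonneg _)
    (Finset.mem_product.2 ⟨floor_mem_of_mem_cells hn hp.1, floor_mem_of_mem_cells hn hp.2⟩ :
      (⌊(n : ℝ) * p.1⌋₊, ⌊(n : ℝ) * p.2⌋₊) ∈ _)

/-- On `[1/n, 1]` the index `n` is reached only at the point `s = 1`, a null set, so the sum stops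
at `n - 1`. -/
lemma integral_step [CompleteSpace E] {n : ℕ} (hn : 1 ≤ n) (h : ℕ → E) :
    ∫ s in cells n, h ⌊(n : ℝ) * s⌋₊ = (n : ℝ)⁻¹ • ∑ i ∈ Finset.Ico 1 n, h i := by
  have hn' : (0 : ℝ) < n := by exact_mod_cast hn
  have hle : 1 / (n : ℝ) ≤ 1 := by
    rw [div_le_one hn']; exact_mod_cast hn
  rw [integral_Icc_eq_integral_Ioc, ← intervalIntegral.integral_of_le hle]
  have hsum := intervalIntegral.sum_integral_adjacent_intervals_Ico (μ := volume)
    (f := fun s : ℝ => h ⌊(n : ℝ) * s⌋₊) (a := fun k : ℕ => (k : ℝ) / n) hn (fun k hk => by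
      have hk' : (k : ℝ) / n ≤ ((k + 1 : ℕ) : ℝ) / n := by gcongr; simp
      rw [intervalIntegrable_iff_integrableOn_Icc_of_le hk']
      refine (integrableOn_step hn h).mono_set (Set.Icc_subset_Icc ?_ ?_)
      · have : (1 : ℝ) ≤ k := by exact_mod_cast hk.1
        gcongr
      · rw [div_le_one hn']
        exact_mod_cast hk.2)
  simp only [Nat.cast_one, div_self hn'.ne'] at hsum
  rw [← hsum, Finset.smul_sum]
  refine Finset.sum_congr rfl fun k _ => ?_
  have hk' : (k : ℝ) / n ≤ ((k + 1 : ℕ) : ℝ) / n := by gcongr; simp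
  -- The cell is taken closed on the left and open on the right, where the floor is constantly `k`.
  rw [intervalIntegral.integral_of_le hk', ← integral_Ico_eq_integral_Ioc,
    setIntegral_congr_fun (g := fun _ => h k) measurableSet_Ico fun s hs => ?_]
  · rw [setIntegral_const, Measure.real, Real.volume_Ico, ENNReal.toReal_ofReal (by linarith)]
    congr 1
    push_cast
    ring
  · have : ⌊(n : ℝ) * s⌋₊ = k := by
      rw [Nat.floor_eq_iff (by have := hs.1; have : 0 ≤ s := le_trans (by positivity) hs.1; positivity)]
      have h1 := (div_le_iff₀ hn').1 hs.1
      have h2 := (lt_div_iff₀ hn').1 hs.2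
      push_cast at h2
      constructor <;> linarith
    simp only [this]

lemma integral_step₂ [CompleteSpace E] {n : ℕ} (hn : 1 ≤ n) (h : ℕ → ℕ → E) :
    ∫ p in cells n ×ˢ cells n, h ⌊(n : ℝ) * p.1⌋₊ ⌊(n : ℝ) * p.2⌋₊
      = ((n : ℝ)⁻¹ ^ 2) • ∑ q ∈ Finset.Ico 1 n ×ˢ Finset.Ico 1 n, h q.1 q.2 := by
  rw [Measure.volume_eq_prod, setIntegral_prod _ (by
    rw [← Measure.volume_eq_prod]; exact integrableOn_step₂ hn h)]
  have : ∀ s : ℝ, ∫ t in cells n, h ⌊(n : ℝ) * s⌋₊ ⌊(n : ℝ) * t⌋₊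
      = (n : ℝ)⁻¹ • ∑ j ∈ Finset.Ico 1 n, h ⌊(n : ℝ) * s⌋₊ j := fun s =>
    integral_step hn (h ⌊(n : ℝ) * s⌋₊)
  simp only [this]
  rw [integral_step hn (fun i => (n : ℝ)⁻¹ • ∑ j ∈ Finset.Ico 1 n, h i j), ← Finset.smul_sum,
    smul_smul, ← sq, Finset.sum_product]

/-- The two sums differ by the last row and the last column, that is by `2n - 1` terms. -/
lemma norm_riemann_sub_le {n : ℕ} (hn : 1 ≤ n) (h : ℕ → ℕ → E) {K : ℝ}
    (hK : ∀ i ∈ Finset.Icc 1 n, ∀ j ∈ Finset.Icc 1 n, ‖h i j‖ ≤ K) :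
    ‖((n : ℝ)⁻¹ ^ 2) • ∑ q ∈ Finset.Icc 1 n ×ˢ Finset.Icc 1 n, h q.1 q.2
      - ((n : ℝ)⁻¹ ^ 2) • ∑ q ∈ Finset.Ico 1 n ×ˢ Finset.Ico 1 n, h q.1 q.2‖ ≤ 2 * K / n := by
  have hn' : (0 : ℝ) < n := by exact_mod_cast hn
  have hK0 : 0 ≤ K := (norm_nonneg _).trans
    (hK 1 (Finset.mem_Icc.2 ⟨le_rfl, hn⟩) 1 (Finset.mem_Icc.2 ⟨le_rfl, hn⟩))
  have hsub : Finset.Ico 1 n ×ˢ Finset.Ico 1 n ⊆ Finset.Icc 1 n ×ˢ Finset.Icc 1 n :=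
    Finset.product_subset_product Finset.Ico_subset_Icc_self Finset.Ico_subset_Icc_self
  rw [← smul_sub, ← Finset.sum_sdiff hsub, add_sub_cancel_right, norm_smul]
  have hcard : (((Finset.Icc 1 n ×ˢ Finset.Icc 1 n) \ (Finset.Ico 1 n ×ˢ Finset.Ico 1 n)).card : ℝ)
      ≤ 2 * n := by
    rw [Finset.card_sdiff_of_subset hsub, Finset.card_product, Finset.card_product, Nat.card_Icc,
      Nat.card_Ico]
    obtain ⟨m, rfl⟩ : ∃ m, n = m + 1 := ⟨n - 1, by omega⟩
    have : (m + 1 + 1 - 1) * (m + 1 + 1 - 1) - (m + 1 - 1) * (m + 1 - 1) ≤ 2 * (m + 1) := by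
      simp only [Nat.add_sub_cancel]
      rw [Nat.sub_le_iff_le_add]
      nlinarith
    exact_mod_cast this
  calc _ ≤ ‖(n : ℝ)⁻¹ ^ 2‖ * (2 * n * K) := by
        gcongr
        refine (norm_sum_le_of_le _ fun q hq => ?_).trans ((Finset.sum_const K).trans_le ?_)
        · have := Finset.mem_product.1 (Finset.mem_sdiff.1 hq).1
          exact hK _ this.1 _ this.2
        · rw [nsmul_eq_mul]
          gcongr
    _ = _ := by
        rw [Real.norm_of_nonneg (by positivity)]
        field_simp

lemma ae_mem_Ioc : ∀ᵐ s ∂(volume : Measure ℝ).restrict (Set.Icc 0 1), s ∈ Set.Ioc (0 : ℝ) 1 := by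
  rw [← Measure.restrict_congr_set Ioc_ae_eq_Icc]
  exact ae_restrict_mem measurableSet_Ioc

/-- Dominated convergence for the step functions, extended by zero to `[0, 1]`. The term of index
`n`, which the integral does not see, is at most `K / n`. -/
lemma tendsto_riemann (h : ℕ → ℕ → ℝ) (H : ℝ → ℝ) {K : ℝ}
    (hb : ∀ᶠ n in atTop, ∀ i ∈ Finset.Icc 1 n, |h n i| ≤ K)
    (hlim : ∀ s ∈ Set.Ioc (0 : ℝ) 1, Tendsto (fun n : ℕ => h n ⌊(n : ℝ) * s⌋₊) atTop (𝓝 (H s))) :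
    Tendsto (fun n : ℕ => (n : ℝ)⁻¹ * ∑ i ∈ Finset.Icc 1 n, h n i) atTop
      (𝓝 (∫ s in Set.Icc (0 : ℝ) 1, H s)) := by
  have hint : Tendsto (fun n : ℕ => ∫ s in Set.Icc (0 : ℝ) 1,
      (cells n).indicator (fun s => h n ⌊(n : ℝ) * s⌋₊) s) atTop
      (𝓝 (∫ s in Set.Icc (0 : ℝ) 1, H s)) := by
    refine tendsto_integral_filter_of_dominated_convergence (fun _ => K) ?_ ?_ (by simp) ?_
    · exact Eventually.of_forall fun n =>
        (aestronglyMeasurable_step n (h n) _).indicator measurableSet_Icc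
    · filter_upwards [hb, eventually_ge_atTop 1] with n hn hn1
      refine ae_of_all _ fun s => ?_
      have hK : 0 ≤ K := (abs_nonneg _).trans (hn 1 (Finset.mem_Icc.2 ⟨le_rfl, hn1⟩))
      by_cases hs : s ∈ cells n
      · rw [Set.indicator_of_mem hs]
        exact hn _ (floor_mem_of_mem_cells hn1 hs)
      · rw [Set.indicator_of_notMem hs, norm_zero]
        exact hK
    · filter_upwards [ae_mem_Ioc] with s hs
      refine (hlim s hs).congr' ?_
      filter_upwards [eventually_mem_cells hs] with n hn
      rw [Set.indicator_of_mem hn]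
  have hlast : Tendsto (fun n : ℕ => (n : ℝ)⁻¹ * h n n) atTop (𝓝 0) := by
    refine squeeze_zero_norm' (a := fun n : ℕ => K * (n : ℝ)⁻¹) ?_ ?_
    · filter_upwards [hb, eventually_ge_atTop 1] with n hn hn1
      rw [norm_mul, Real.norm_eq_abs (h n n), Real.norm_of_nonneg (by positivity), mul_comm]
      have := hn n (Finset.mem_Icc.2 ⟨hn1, le_rfl⟩)
      gcongr
    · simpa using tendsto_inv_atTop_nhds_zero_nat.const_mul K
  have := hint.add hlast
  rw [add_zero] at this
  refine this.congr' ?_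
  filter_upwards [eventually_ge_atTop 1] with n hn
  rw [setIntegral_indicator measurableSet_Icc, Set.inter_eq_right.2 (cells_subset n),
    integral_step hn (h n), ← Finset.sum_Ico_add_eq_sum_Icc hn, smul_eq_mul, mul_add]

end Riemann

/-! ### Convergence of the step profiles in mean -/

section Profile

/-- Step profiles `l`, `V` of an array, which converge to the profiles `f` and `σ²`. -/
structure IsProfile (l : ℕ → ℕ → ℝ) (V : ℕ → ℕ → ℕ → ℝ) (f : ℝ → ℝ) (σ : ℝ → ℝ → ℝ)
    (L M : ℝ) : Prop where
  bound_l : ∀ᶠ n in atTop, ∀ i ∈ Finset.Icc 1 n, |l n i| ≤ L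
  bound_V : ∀ n, ∀ i ∈ Finset.Icc 1 n, ∀ j ∈ Finset.Icc 1 n, |V n i j| ≤ M
  tendsto_l : ∀ s ∈ Set.Ioc (0 : ℝ) 1, Tendsto (fun n : ℕ => l n ⌊(n : ℝ) * s⌋₊) atTop (𝓝 (f s))
  tendsto_V : ∀ s ∈ Set.Ioc (0 : ℝ) 1, ∀ t ∈ Set.Ioc (0 : ℝ) 1, s ≠ t →
    Tendsto (fun n : ℕ => V n ⌊(n : ℝ) * s⌋₊ ⌊(n : ℝ) * t⌋₊) atTop (𝓝 (σ s t ^ 2))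

/-- The unit square. -/
abbrev unitSquare : Set (ℝ × ℝ) := Set.Icc (0 : ℝ) 1 ×ˢ Set.Icc (0 : ℝ) 1

lemma measurableSet_unitSquare : MeasurableSet unitSquare := measurableSet_Icc.prod measurableSet_Icc

lemma measurableSet_cells_prod (n : ℕ) : MeasurableSet (cells n ×ˢ cells n) :=
  measurableSet_Icc.prod measurableSet_Icc

lemma cells_prod_subset (n : ℕ) : cells n ×ˢ cells n ⊆ unitSquare :=
  Set.prod_mono (cells_subset n) (cells_subset n)

lemma volume_unitSquare : (volume : Measure (ℝ × ℝ)) unitSquare = 1 := by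
  rw [Measure.volume_eq_prod, Measure.prod_prod]
  simp

instance : IsProbabilityMeasure ((volume : Measure (ℝ × ℝ)).restrict unitSquare) :=
  ⟨by rw [Measure.restrict_apply_univ, volume_unitSquare]⟩

instance : IsProbabilityMeasure ((volume : Measure ℝ).restrict (Set.Icc 0 1)) :=
  ⟨by simp⟩

/-- The profiles are limits only for positive and, for the variances, distinct arguments; the
exceptional points are null in the square. -/
lemma ae_unitSquare : ∀ᵐ p ∂(volume : Measure (ℝ × ℝ)).restrict unitSquare,
    p.1 ∈ Set.Ioc (0 : ℝ) 1 ∧ p.2 ∈ Set.Ioc (0 : ℝ) 1 ∧ p.1 ≠ p.2 := by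
  have h0 : ∀ᵐ s : ℝ, s ≠ 0 := by simp [ae_iff]
  have h1 : ∀ᵐ p : ℝ × ℝ, p.1 ≠ 0 := Measure.quasiMeasurePreserving_fst.ae h0
  have h2 : ∀ᵐ p : ℝ × ℝ, p.2 ≠ 0 := Measure.quasiMeasurePreserving_snd.ae h0
  have h3 : ∀ᵐ p : ℝ × ℝ, p.1 ≠ p.2 := by
    rw [ae_iff, Measure.volume_eq_prod, Measure.measure_prod_null]
    · refine ae_of_all _ fun s => ?_
      have : Prod.mk s ⁻¹' {p : ℝ × ℝ | ¬p.1 ≠ p.2} = {s} := by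
        ext t; simp [eq_comm]
      simp only [this, Real.volume_singleton, Pi.zero_apply]
    · simpa using measurableSet_eq_fun measurable_fst measurable_snd
  rw [ae_restrict_iff' measurableSet_unitSquare]
  filter_upwards [h1, h2, h3] with p p1 p2 p3 hp
  exact ⟨⟨lt_of_le_of_ne hp.1.1 (Ne.symm p1), hp.1.2⟩,
    ⟨lt_of_le_of_ne hp.2.1 (Ne.symm p2), hp.2.2⟩, p3⟩

namespace IsProfile

variable {l : ℕ → ℕ → ℝ} {V : ℕ → ℕ → ℕ → ℝ} {f : ℝ → ℝ} {σ : ℝ → ℝ → ℝ} {L M : ℝ}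

lemma abs_f_le (h : IsProfile l V f σ L M) {s : ℝ} (hs : s ∈ Set.Ioc (0 : ℝ) 1) : |f s| ≤ L := by
  refine le_of_tendsto (h.tendsto_l s hs).abs ?_
  filter_upwards [h.bound_l, eventually_mem_cells hs, eventually_ge_atTop 1] with n h1 h2 h3
  exact h1 _ (floor_mem_of_mem_cells h3 h2)

lemma abs_sq_le (h : IsProfile l V f σ L M) {s t : ℝ} (hs : s ∈ Set.Ioc (0 : ℝ) 1)
    (ht : t ∈ Set.Ioc (0 : ℝ) 1) (hst : s ≠ t) : |σ s t ^ 2| ≤ M := by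
  refine le_of_tendsto (h.tendsto_V s hs t ht hst).abs ?_
  filter_upwards [eventually_mem_cells hs, eventually_mem_cells ht, eventually_ge_atTop 1]
    with n h1 h2 h3
  exact h.bound_V n _ (floor_mem_of_mem_cells h3 h1) _ (floor_mem_of_mem_cells h3 h2)

/-- The profile is an almost everywhere limit of step functions, so its measurability is a
consequence of the convergence. -/
lemma aestronglyMeasurable_f (h : IsProfile l V f σ L M) :
    AEStronglyMeasurable f (volume.restrict (Set.Icc 0 1)) := by
  refine aestronglyMeasurable_of_tendsto_ae atTop
    (f := fun (n : ℕ) (s : ℝ) => l n ⌊(n : ℝ) * s⌋₊) (fun n => aestronglyMeasurable_step n (l n) _) ?_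
  filter_upwards [ae_mem_Ioc] with s hs using h.tendsto_l s hs

lemma aestronglyMeasurable_sq (h : IsProfile l V f σ L M) :
    AEStronglyMeasurable (fun p : ℝ × ℝ => σ p.1 p.2 ^ 2) (volume.restrict unitSquare) := by
  refine aestronglyMeasurable_of_tendsto_ae atTop
    (f := fun (n : ℕ) (p : ℝ × ℝ) => V n ⌊(n : ℝ) * p.1⌋₊ ⌊(n : ℝ) * p.2⌋₊)
    (fun n => aestronglyMeasurable_step₂ n (V n) _) ?_
  filter_upwards [ae_unitSquare] with p hp using h.tendsto_V _ hp.1 _ hp.2.1 hp.2.2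

lemma integrableOn_f (h : IsProfile l V f σ L M) : IntegrableOn f (Set.Icc 0 1) :=
  Integrable.of_bound h.aestronglyMeasurable_f L
    (ae_mem_Ioc.mono fun _ hs => h.abs_f_le hs)

lemma integrableOn_sq (h : IsProfile l V f σ L M) :
    IntegrableOn (fun p : ℝ × ℝ => σ p.1 p.2 ^ 2) unitSquare :=
  Integrable.of_bound h.aestronglyMeasurable_sq M
    (ae_unitSquare.mono fun _ hp => h.abs_sq_le hp.1 hp.2.1 hp.2.2)

/-- Dominated convergence. No rate results, which is enough whenever `n ε` is bounded or the Riemann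
sum is not multiplied by it. -/
lemma tendsto_error (h : IsProfile l V f σ L M) :
    Tendsto (fun n : ℕ => (∫ p in cells n ×ˢ cells n,
        |V n ⌊(n : ℝ) * p.1⌋₊ ⌊(n : ℝ) * p.2⌋₊ - σ p.1 p.2 ^ 2|)
      + ∫ s in cells n, |l n ⌊(n : ℝ) * s⌋₊ - f s|) atTop (𝓝 0) := by
  have h1 : Tendsto (fun n : ℕ => ∫ p in unitSquare, (cells n ×ˢ cells n).indicator
      (fun p => |V n ⌊(n : ℝ) * p.1⌋₊ ⌊(n : ℝ) * p.2⌋₊ - σ p.1 p.2 ^ 2|) p) atTop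
      (𝓝 (∫ _ in unitSquare, (0 : ℝ))) := by
    refine tendsto_integral_filter_of_dominated_convergence (fun _ => 2 * M) ?_ ?_ (integrable_const _) ?_
    · exact Eventually.of_forall fun n =>
        ((aestronglyMeasurable_step₂ n (V n) _).sub h.aestronglyMeasurable_sq).norm.indicator
          (measurableSet_cells_prod n)
    · filter_upwards [eventually_ge_atTop 1] with n hn
      filter_upwards [ae_unitSquare] with p hp
      have hσ := h.abs_sq_le hp.1 hp.2.1 hp.2.2
      by_cases hpn : p ∈ cells n ×ˢ cells n
      · rw [Set.indicator_of_mem hpn, Real.norm_eq_abs, abs_abs]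
        have := h.bound_V n _ (floor_mem_of_mem_cells hn hpn.1) _
          (floor_mem_of_mem_cells hn hpn.2)
        exact (abs_sub _ _).trans (by linarith)
      · rw [Set.indicator_of_notMem hpn, norm_zero]
        linarith [(abs_nonneg _).trans hσ]
    · filter_upwards [ae_unitSquare] with p hp
      have := ((h.tendsto_V _ hp.1 _ hp.2.1 hp.2.2).sub_const (σ p.1 p.2 ^ 2)).abs
      rw [sub_self, abs_zero] at this
      refine this.congr' ?_
      filter_upwards [eventually_mem_cells hp.1, eventually_mem_cells hp.2.1] with n h1 h2
      rw [Set.indicator_of_mem (Set.mk_mem_prod h1 h2)]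
  have h2 : Tendsto (fun n : ℕ => ∫ s in Set.Icc (0 : ℝ) 1, (cells n).indicator
      (fun s => |l n ⌊(n : ℝ) * s⌋₊ - f s|) s) atTop (𝓝 (∫ _ in Set.Icc (0 : ℝ) 1, (0 : ℝ))) := by
    refine tendsto_integral_filter_of_dominated_convergence (fun _ => 2 * L) ?_ ?_ (integrable_const _) ?_
    · exact Eventually.of_forall fun n =>
        ((aestronglyMeasurable_step n (l n) _).sub h.aestronglyMeasurable_f).norm.indicator
          measurableSet_Icc
    · filter_upwards [eventually_ge_atTop 1, h.bound_l] with n hn hl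
      filter_upwards [ae_mem_Ioc] with s hs
      have hf := h.abs_f_le hs
      by_cases hsn : s ∈ cells n
      · rw [Set.indicator_of_mem hsn, Real.norm_eq_abs, abs_abs]
        have := hl _ (floor_mem_of_mem_cells hn hsn)
        exact (abs_sub _ _).trans (by linarith)
      · rw [Set.indicator_of_notMem hsn, norm_zero]
        linarith [(abs_nonneg _).trans hf]
    · filter_upwards [ae_mem_Ioc] with s hs
      have := ((h.tendsto_l _ hs).sub_const (f s)).abs
      rw [sub_self, abs_zero] at this
      refine this.congr' ?_
      filter_upwards [eventually_mem_cells hs] with n h1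
      rw [Set.indicator_of_mem h1]
  have := h1.add h2
  rw [integral_zero, integral_zero, add_zero] at this
  refine this.congr fun n => ?_
  rw [setIntegral_indicator (measurableSet_cells_prod n), setIntegral_indicator measurableSet_Icc,
    Set.inter_eq_right.2 (cells_prod_subset n), Set.inter_eq_right.2 (cells_subset n)]

end IsProfile

/-! ### Comparison of the Riemann sum with its limit -/

/-- The Riemann sum approximating `limitB`. -/
def stepB (l : ℕ → ℕ → ℝ) (V : ℕ → ℕ → ℕ → ℝ) (z : ℂ) (n : ℕ) : ℂ :=
  ((n : ℝ)⁻¹ ^ 2) • ∑ q ∈ Finset.Icc 1 n ×ˢ Finset.Icc 1 n,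
    (z - (l n q.1 : ℂ))⁻¹ ^ 2 * (z - (l n q.2 : ℂ))⁻¹ * (V n q.1 q.2 : ℂ)

lemma norm_inv_sub_inv_le {z : ℂ} (hz : z.im ≠ 0) (a b : ℝ) :
    ‖(z - (a : ℂ))⁻¹ - (z - (b : ℂ))⁻¹‖ ≤ |z.im|⁻¹ ^ 2 * |a - b| := by
  rw [inv_sub_inv (sub_ofReal_ne_zero hz a) (sub_ofReal_ne_zero hz b), div_eq_mul_inv, mul_inv,
    norm_mul, norm_mul]
  have e : z - (b : ℂ) - (z - (a : ℂ)) = ((a - b : ℝ) : ℂ) := by push_cast; ring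
  rw [e, Complex.norm_real, Real.norm_eq_abs, mul_comm]
  refine mul_le_mul_of_nonneg_right ?_ (abs_nonneg _)
  rw [sq]
  exact mul_le_mul (norm_inv_sub_ofReal_le hz a) (norm_inv_sub_ofReal_le hz b) (norm_nonneg _)
    (by positivity)

lemma norm_kernel_le {z : ℂ} (hz : z.im ≠ 0) (a b v : ℝ) :
    ‖(z - (a : ℂ))⁻¹ ^ 2 * (z - (b : ℂ))⁻¹ * (v : ℂ)‖ ≤ |z.im|⁻¹ ^ 3 * |v| := by
  rw [norm_mul, norm_mul, norm_pow, Complex.norm_real, Real.norm_eq_abs]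
  have ha := norm_inv_sub_ofReal_le hz a
  have hb := norm_inv_sub_ofReal_le hz b
  calc _ ≤ |z.im|⁻¹ ^ 2 * |z.im|⁻¹ * |v| := by gcongr
    _ = _ := by ring

/-- The weight is changed first, then the poles, using `u² - u'² = (u + u')(u - u')`. The second
weight `v'` multiplies the pole errors, so only the limit profile has to be bounded there. -/
lemma norm_kernel_sub_le {z : ℂ} (hz : z.im ≠ 0) (a b v a' b' v' : ℝ) :
    ‖(z - (a : ℂ))⁻¹ ^ 2 * (z - (b : ℂ))⁻¹ * (v : ℂ)
        - (z - (a' : ℂ))⁻¹ ^ 2 * (z - (b' : ℂ))⁻¹ * (v' : ℂ)‖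
      ≤ |z.im|⁻¹ ^ 3 * |v - v'| + 2 * |z.im|⁻¹ ^ 4 * |v'| * (|a - a'| + |b - b'|) := by
  set κ := |z.im|⁻¹
  have hκ : 0 ≤ κ := by positivity
  have ha := norm_inv_sub_ofReal_le hz a
  have ha' := norm_inv_sub_ofReal_le hz a'
  have hb := norm_inv_sub_ofReal_le hz b
  have hda := norm_inv_sub_inv_le hz a a'
  have hdb := norm_inv_sub_inv_le hz b b'
  have h0 := norm_kernel_le hz a b (v - v')
  generalize (z - (a : ℂ))⁻¹ = u at *
  generalize (z - (a' : ℂ))⁻¹ = u' at *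
  generalize (z - (b : ℂ))⁻¹ = w at *
  generalize (z - (b' : ℂ))⁻¹ = w' at *
  have e : u ^ 2 * w * (v : ℂ) - u' ^ 2 * w' * (v' : ℂ)
      = u ^ 2 * w * ((v - v' : ℝ) : ℂ)
        + ((u + u') * (u - u') * w + u' ^ 2 * (w - w')) * (v' : ℂ) := by
    push_cast; ring
  rw [e]
  refine (norm_add_le _ _).trans (add_le_add h0 ?_)
  rw [norm_mul, Complex.norm_real, Real.norm_eq_abs]
  have h1 : ‖(u + u') * (u - u') * w‖ ≤ 2 * κ * (κ ^ 2 * |a - a'|) * κ := by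
    rw [norm_mul, norm_mul]
    gcongr
    exact (norm_add_le _ _).trans (by linarith)
  have h2 : ‖u' ^ 2 * (w - w')‖ ≤ κ ^ 2 * (κ ^ 2 * |b - b'|) := by
    rw [norm_mul, norm_pow]
    gcongr
  have h3 : 0 ≤ κ ^ 4 * |b - b'| := by positivity
  calc _ ≤ (2 * κ * (κ ^ 2 * |a - a'|) * κ + κ ^ 2 * (κ ^ 2 * |b - b'|)) * |v'| := by
        gcongr
        exact (norm_add_le _ _).trans (add_le_add h1 h2)
    _ ≤ (2 * κ ^ 4 * (|a - a'| + |b - b'|)) * |v'| := by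
        gcongr
        linarith
    _ = _ := by ring

namespace IsProfile

variable {l : ℕ → ℕ → ℝ} {V : ℕ → ℕ → ℕ → ℝ} {f : ℝ → ℝ} {σ : ℝ → ℝ → ℝ} {L M : ℝ}

lemma bound_nonneg (h : IsProfile l V f σ L M) : 0 ≤ M :=
  (abs_nonneg _).trans (h.bound_V 1 1 (by simp) 1 (by simp))

lemma norm_stepB_le (h : IsProfile l V f σ L M) {z : ℂ} (hz : z.im ≠ 0) {n : ℕ} (hn : 1 ≤ n) :
    ‖stepB l V z n‖ ≤ |z.im|⁻¹ ^ 3 * M := by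
  have hn' : (0 : ℝ) < n := by exact_mod_cast hn
  rw [stepB, norm_smul]
  calc _ ≤ ‖(n : ℝ)⁻¹ ^ 2‖ * (n ^ 2 * (|z.im|⁻¹ ^ 3 * M)) := by
        gcongr
        refine (norm_sum_le_of_le _ fun q hq => ?_).trans
          ((Finset.sum_const (|z.im|⁻¹ ^ 3 * M)).trans_le ?_)
        · have := Finset.mem_product.1 hq
          refine (norm_kernel_le hz _ _ _).trans ?_
          gcongr
          exact h.bound_V n _ this.1 _ this.2
        · rw [nsmul_eq_mul, Finset.card_product, Nat.card_Icc]
          simp [sq]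
    _ = _ := by
        rw [Real.norm_of_nonneg (by positivity)]
        field_simp

/-- The integrand of `limitB`. -/
def kernelB (f : ℝ → ℝ) (σ : ℝ → ℝ → ℝ) (z : ℂ) (p : ℝ × ℝ) : ℂ :=
  (z - (f p.1 : ℂ))⁻¹ ^ 2 * (z - (f p.2 : ℂ))⁻¹ * ((σ p.1 p.2 ^ 2 : ℝ) : ℂ)

lemma limitB_eq (z : ℂ) : limitB f σ z = ∫ p in unitSquare, kernelB f σ z p := by
  refine integral_congr_ae (ae_of_all _ fun p => ?_)
  simp only [kernelB, div_eq_mul_inv, mul_inv, inv_pow]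
  ring

lemma ae_norm_kernelB_le (h : IsProfile l V f σ L M) {z : ℂ} (hz : z.im ≠ 0) :
    ∀ᵐ p ∂(volume : Measure (ℝ × ℝ)).restrict unitSquare,
      ‖kernelB f σ z p‖ ≤ |z.im|⁻¹ ^ 3 * M := by
  filter_upwards [ae_unitSquare] with p hp
  refine (norm_kernel_le hz _ _ _).trans ?_
  gcongr
  exact h.abs_sq_le hp.1 hp.2.1 hp.2.2

lemma aestronglyMeasurable_f_fst (h : IsProfile l V f σ L M) :
    AEStronglyMeasurable (fun p : ℝ × ℝ => f p.1) (volume.restrict unitSquare) := by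
  rw [Measure.volume_eq_prod, ← Measure.prod_restrict]
  exact h.aestronglyMeasurable_f.comp_fst

lemma aestronglyMeasurable_f_snd (h : IsProfile l V f σ L M) :
    AEStronglyMeasurable (fun p : ℝ × ℝ => f p.2) (volume.restrict unitSquare) := by
  rw [Measure.volume_eq_prod, ← Measure.prod_restrict]
  exact h.aestronglyMeasurable_f.comp_snd

lemma integrableOn_kernelB (h : IsProfile l V f σ L M) {z : ℂ} (hz : z.im ≠ 0) :
    IntegrableOn (kernelB f σ z) unitSquare := by
  refine Integrable.of_bound ?_ _ (h.ae_norm_kernelB_le hz)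
  have h1 := h.aestronglyMeasurable_f_fst.aemeasurable
  have h2 := h.aestronglyMeasurable_f_snd.aemeasurable
  have h3 := h.aestronglyMeasurable_sq.aemeasurable
  refine AEMeasurable.aestronglyMeasurable ?_
  have hinv : Measurable fun a : ℝ => (z - (a : ℂ))⁻¹ := by fun_prop
  exact (((hinv.comp_aemeasurable h1).pow_const 2).mul (hinv.comp_aemeasurable h2)).mul
    (Complex.measurable_ofReal.comp_aemeasurable h3)

/-- Three errors add up: the last row and column of the Riemann sum, the distance of the step
profiles to their limits on the cells, and the part of the square outside the cells. The first and
the last are each at most `2 / n` times the bound on the kernel. -/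
lemma norm_stepB_sub_limitB_le (h : IsProfile l V f σ L M) {z : ℂ} (hz : z.im ≠ 0) {n : ℕ}
    (hn : 1 ≤ n) :
    ‖stepB l V z n - limitB f σ z‖ ≤
      (|z.im|⁻¹ ^ 3 + 4 * |z.im|⁻¹ ^ 4 * M)
        * ((∫ p in cells n ×ˢ cells n, |V n ⌊(n : ℝ) * p.1⌋₊ ⌊(n : ℝ) * p.2⌋₊ - σ p.1 p.2 ^ 2|)
          + ∫ s in cells n, |l n ⌊(n : ℝ) * s⌋₊ - f s|)
        + 4 * (|z.im|⁻¹ ^ 3 * M) / n := by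
  set κ := |z.im|⁻¹ with hκdef
  have hκ : 0 ≤ κ := by positivity
  have hM := h.bound_nonneg
  have hn' : (0 : ℝ) < n := by exact_mod_cast hn
  set S := cells n ×ˢ cells n with hS
  set F : ℕ → ℕ → ℂ := fun i j => (z - (l n i : ℂ))⁻¹ ^ 2 * (z - (l n j : ℂ))⁻¹ * (V n i j : ℂ)
    with hF
  have hvol : ((volume : Measure ℝ).restrict (cells n)).real Set.univ ≤ 1 := by
    rw [Measure.real, Measure.restrict_apply_univ, Real.volume_Icc]
    refine ENNReal.toReal_le_of_le_ofReal zero_le_one (ENNReal.ofReal_le_ofReal ?_)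
    have : 0 ≤ 1 / (n : ℝ) := by positivity
    linarith
  have hrestr : (volume : Measure (ℝ × ℝ)).restrict S
      = ((volume : Measure ℝ).restrict (cells n)).prod ((volume : Measure ℝ).restrict (cells n)) := by
    rw [Measure.volume_eq_prod, Measure.prod_restrict]
  have hle : (volume : Measure (ℝ × ℝ)).restrict S ≤ volume.restrict unitSquare :=
    Measure.restrict_mono (cells_prod_subset n) le_rfl
  have hA : IntegrableOn (fun p : ℝ × ℝ =>
      |V n ⌊(n : ℝ) * p.1⌋₊ ⌊(n : ℝ) * p.2⌋₊ - σ p.1 p.2 ^ 2|) S :=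
    ((integrableOn_step₂ hn (V n)).sub (h.integrableOn_sq.mono_set (cells_prod_subset n))).abs
  have hE : IntegrableOn (fun s : ℝ => |l n ⌊(n : ℝ) * s⌋₊ - f s|) (cells n) :=
    ((integrableOn_step hn (l n)).sub (h.integrableOn_f.mono_set (cells_subset n))).abs
  have hE1 : IntegrableOn (fun p : ℝ × ℝ => |l n ⌊(n : ℝ) * p.1⌋₊ - f p.1|) S := by
    rw [IntegrableOn, hrestr]
    exact hE.comp_fst _
  have hE2 : IntegrableOn (fun p : ℝ × ℝ => |l n ⌊(n : ℝ) * p.2⌋₊ - f p.2|) S := by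
    rw [IntegrableOn, hrestr]
    exact hE.comp_snd _
  have hE12 : IntegrableOn (fun p : ℝ × ℝ =>
      |l n ⌊(n : ℝ) * p.1⌋₊ - f p.1| + |l n ⌊(n : ℝ) * p.2⌋₊ - f p.2|) S := hE1.add hE2
  have hE0 : 0 ≤ ∫ s in cells n, |l n ⌊(n : ℝ) * s⌋₊ - f s| := integral_nonneg fun _ => abs_nonneg _
  have hA0 : 0 ≤ ∫ p in S, |V n ⌊(n : ℝ) * p.1⌋₊ ⌊(n : ℝ) * p.2⌋₊ - σ p.1 p.2 ^ 2| :=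
    integral_nonneg fun _ => abs_nonneg _
  have hE1' : ∫ p in S, |l n ⌊(n : ℝ) * p.1⌋₊ - f p.1|
      ≤ ∫ s in cells n, |l n ⌊(n : ℝ) * s⌋₊ - f s| := by
    rw [hrestr, integral_fun_fst (fun s => |l n ⌊(n : ℝ) * s⌋₊ - f s|), smul_eq_mul]
    exact mul_le_of_le_one_left hE0 hvol
  have hE2' : ∫ p in S, |l n ⌊(n : ℝ) * p.2⌋₊ - f p.2|
      ≤ ∫ s in cells n, |l n ⌊(n : ℝ) * s⌋₊ - f s| := by
    rw [hrestr, integral_fun_snd (fun s => |l n ⌊(n : ℝ) * s⌋₊ - f s|), smul_eq_mul]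
    exact mul_le_of_le_one_left hE0 hvol
  have b1 : ‖stepB l V z n - (∫ p in S, F ⌊(n : ℝ) * p.1⌋₊ ⌊(n : ℝ) * p.2⌋₊)‖
      ≤ 2 * (κ ^ 3 * M) / n := by
    rw [integral_step₂ hn F]
    refine norm_riemann_sub_le hn F fun i hi j hj => (norm_kernel_le hz _ _ _).trans ?_
    gcongr
    exact h.bound_V n i hi j hj
  have b2 : ‖(∫ p in S, F ⌊(n : ℝ) * p.1⌋₊ ⌊(n : ℝ) * p.2⌋₊) - (∫ p in S, kernelB f σ z p)‖
      ≤ (κ ^ 3 + 4 * κ ^ 4 * M)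
        * ((∫ p in S, |V n ⌊(n : ℝ) * p.1⌋₊ ⌊(n : ℝ) * p.2⌋₊ - σ p.1 p.2 ^ 2|)
          + ∫ s in cells n, |l n ⌊(n : ℝ) * s⌋₊ - f s|) := by
    rw [← integral_sub (integrableOn_step₂ hn F)
      ((h.integrableOn_kernelB hz).mono_set (cells_prod_subset n))]
    calc _ ≤ ∫ p in S, (κ ^ 3 * |V n ⌊(n : ℝ) * p.1⌋₊ ⌊(n : ℝ) * p.2⌋₊ - σ p.1 p.2 ^ 2|
          + 2 * κ ^ 4 * M * (|l n ⌊(n : ℝ) * p.1⌋₊ - f p.1| + |l n ⌊(n : ℝ) * p.2⌋₊ - f p.2|)) := by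
          refine norm_integral_le_of_norm_le
            ((hA.const_mul _).add (hE12.const_mul _)) ?_
          filter_upwards [hle.absolutelyContinuous.ae_le ae_unitSquare] with p hp
          refine (norm_kernel_sub_le hz _ _ _ _ _ _).trans ?_
          have := h.abs_sq_le hp.1 hp.2.1 hp.2.2
          gcongr
      _ = κ ^ 3 * (∫ p in S, |V n ⌊(n : ℝ) * p.1⌋₊ ⌊(n : ℝ) * p.2⌋₊ - σ p.1 p.2 ^ 2|)
          + 2 * κ ^ 4 * M * ((∫ p in S, |l n ⌊(n : ℝ) * p.1⌋₊ - f p.1|)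
            + ∫ p in S, |l n ⌊(n : ℝ) * p.2⌋₊ - f p.2|) := by
          rw [integral_add (hA.const_mul _) (hE12.const_mul _), integral_const_mul,
            integral_const_mul, integral_add hE1 hE2]
      _ ≤ κ ^ 3 * (∫ p in S, |V n ⌊(n : ℝ) * p.1⌋₊ ⌊(n : ℝ) * p.2⌋₊ - σ p.1 p.2 ^ 2|)
          + 2 * κ ^ 4 * M * ((∫ s in cells n, |l n ⌊(n : ℝ) * s⌋₊ - f s|)
            + ∫ s in cells n, |l n ⌊(n : ℝ) * s⌋₊ - f s|) := by gcongr
      _ ≤ _ := by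
          have : 0 ≤ κ ^ 3 * ∫ s in cells n, |l n ⌊(n : ℝ) * s⌋₊ - f s| := by positivity
          have : 0 ≤ 4 * κ ^ 4 * M *
            ∫ p in S, |V n ⌊(n : ℝ) * p.1⌋₊ ⌊(n : ℝ) * p.2⌋₊ - σ p.1 p.2 ^ 2| := by positivity
          linarith
  have b3 : ‖(∫ p in S, kernelB f σ z p) - limitB f σ z‖ ≤ 2 * (κ ^ 3 * M) / n := by
    rw [limitB_eq, norm_sub_rev, ← setIntegral_sdiff (measurableSet_cells_prod n)
      (h.integrableOn_kernelB hz) (cells_prod_subset n)]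
    -- The area is `1 - (1 - 1/n)² = 2/n - 1/n²`.
    have hv : (volume : Measure (ℝ × ℝ)).real (unitSquare \ S) ≤ 2 / n := by
      rw [measureReal_sdiff (cells_prod_subset n) (measurableSet_cells_prod n)
        (by rw [volume_unitSquare]; simp), Measure.real, volume_unitSquare, Measure.real,
        Measure.volume_eq_prod, Measure.prod_prod, ENNReal.toReal_mul, Real.volume_Icc,
        ENNReal.toReal_ofReal]
      · simp only [ENNReal.toReal_one]
        have : 0 ≤ (1 / (n : ℝ)) ^ 2 := by positivity
        have e : 2 / (n : ℝ) = 2 * (1 / n) := by ring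
        rw [e]
        nlinarith
      · rw [sub_nonneg, div_le_one hn']
        exact_mod_cast hn
    have hfin : (volume : Measure (ℝ × ℝ)) (unitSquare \ S) < ⊤ :=
      (measure_mono Set.sdiff_subset).trans_lt (by rw [volume_unitSquare]; simp)
    refine (norm_setIntegral_le_of_norm_le_const_ae hfin ?_).trans
      ((mul_le_mul_of_nonneg_left hv (by positivity : 0 ≤ κ ^ 3 * M)).trans_eq (by ring))
    exact (Measure.restrict_mono Set.sdiff_subset le_rfl).absolutelyContinuous.ae_le
      (h.ae_norm_kernelB_le hz)
  have e : stepB l V z n - limitB f σ z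
      = (stepB l V z n - (∫ p in S, F ⌊(n : ℝ) * p.1⌋₊ ⌊(n : ℝ) * p.2⌋₊))
        + ((∫ p in S, F ⌊(n : ℝ) * p.1⌋₊ ⌊(n : ℝ) * p.2⌋₊) - (∫ p in S, kernelB f σ z p))
        + ((∫ p in S, kernelB f σ z p) - limitB f σ z) := by ring
  rw [e]
  refine (norm_add₃_le).trans ?_
  have : 4 * (κ ^ 3 * M) / (n : ℝ) = 2 * (κ ^ 3 * M) / n + 2 * (κ ^ 3 * M) / n := by ring
  rw [this]
  linarith

end IsProfile

end Profile

/-! ### The error in the expansion of the trace of the resolvent -/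

section Error

variable {Ω ι : Type*} [MeasurableSpace Ω] [Fintype ι]

lemma measurable_det [DecidableEq ι] {M : Ω → Matrix ι ι ℂ}
    (hM : ∀ i j, Measurable fun ω => M ω i j) : Measurable fun ω => (M ω).det := by
  simp only [Matrix.det_apply]
  exact Finset.measurable_sum _ fun τ _ =>
    (Finset.measurable_prod _ fun i _ => hM (τ i) i).const_smul _

/-- By Cramer's rule an entry of the inverse is an adjugate entry over the determinant, both
polynomials in the entries. -/
lemma measurable_inv_apply [DecidableEq ι] {M : Ω → Matrix ι ι ℂ}
    (hM : ∀ i j, Measurable fun ω => M ω i j) (i j : ι) : Measurable fun ω => (M ω)⁻¹ i j := by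
  simp only [Matrix.inv_def, Ring.inverse_eq_inv', Matrix.smul_apply, smul_eq_mul,
    Matrix.adjugate_apply]
  refine (measurable_det hM).inv.mul (measurable_det fun k l => ?_)
  simp only [Matrix.updateRow_apply]
  split_ifs
  · exact measurable_const
  · exact hM k l

lemma measurable_trace_inv [DecidableEq ι] {M : Ω → Matrix ι ι ℂ}
    (hM : ∀ i j, Measurable fun ω => M ω i j) : Measurable fun ω => Matrix.trace (M ω)⁻¹ :=
  Finset.measurable_sum _ fun i _ => measurable_inv_apply hM i i

/-- The constant in the bound on the error. -/
def errorConst (z : ℂ) (C : ℝ) : ℝ :=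
  √(8 * (|z.im|⁻¹ ^ 3) ^ 2 * (1 + C)) + √(72 * (|z.im|⁻¹ ^ 4) ^ 2 * (1 + C))
    + ((z.im ^ 2)⁻¹ + (z.im ^ 2)⁻¹ ^ 2) / 2 * (2 * |z.im|⁻¹ ^ 2 * (1 + C))

variable [LinearOrder ι] {P : Measure Ω} [IsProbabilityMeasure P] {X : ι → ι → Ω → ℂ} {C : ℝ}

/-- The normalized difference of the resolvent traces, minus its leading random part and its
leading deterministic part. -/
def expansionError (P : Measure Ω) (X : ι → ι → Ω → ℂ) (l : ι → ℝ) (ε : ℝ) (z : ℂ) (ω : Ω) : ℂ :=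
  (ε : ℂ)⁻¹ * (Matrix.trace (Matrix.scalar ι z - ((Matrix.diagonal fun i => (l i : ℂ))
        + ((ε / √(Fintype.card ι) : ℝ) : ℂ) • Matrix.of fun i j => X i j ω))⁻¹
      - Matrix.trace (Matrix.scalar ι z - Matrix.diagonal fun i => (l i : ℂ))⁻¹)
    - ((√(Fintype.card ι))⁻¹ : ℝ) * ∑ i, (z - (l i : ℂ))⁻¹ ^ 2 * X i i ω
    - ε / (Fintype.card ι : ℂ) * ∑ p : ι × ι, (z - (l p.1 : ℂ))⁻¹ ^ 2 * (z - (l p.2 : ℂ))⁻¹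
        * ∫ ω', X p.1 p.2 ω' * X p.2 p.1 ω' ∂P

namespace IsNoiseArray

omit [IsProbabilityMeasure P] in
lemma measurable_expansionError (h : IsNoiseArray P X C) (l : ι → ℝ) (ε : ℝ) (z : ℂ) :
    Measurable (expansionError P X l ε z) := by
  have hX := h.measurable
  unfold expansionError
  refine (((measurable_const.mul ((measurable_trace_inv fun i j => ?_).sub_const _)).sub
    (measurable_const.mul (Finset.measurable_sum _ fun i _ => (hX i i).const_mul _))).sub_const _)
  simp only [Matrix.sub_apply, Matrix.add_apply, Matrix.smul_apply, Matrix.of_apply, smul_eq_mul]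
  exact (((hX i j).const_mul _).const_add _).const_sub _

omit [IsProbabilityMeasure P] in
-- The subtractions in the definition cancel the first order and the mean of the second. With `η = ε
-- / √n`, the remaining prefactors `η ^ k / ε` are `ε/n`, `ε²/n^{3/2}` and `ε³/n²`.
lemma expansionError_eq [Nonempty ι] (h : IsNoiseArray P X C) (l : ι → ℝ) {ε : ℝ} (hε : 0 < ε)
    {z : ℂ} (hz : z.im ≠ 0) (ω : Ω) :
    expansionError P X l ε z ω
      = ((ε / Fintype.card ι : ℝ) : ℂ) * ∑ p : ι × ι,
          (z - (l p.1 : ℂ))⁻¹ ^ 2 * (z - (l p.2 : ℂ))⁻¹ * fluctuation P X p ω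
        + ((ε ^ 2 / √(Fintype.card ι) ^ 3 : ℝ) : ℂ) * ∑ a : ι × ι × ι,
          (z - (l a.1 : ℂ))⁻¹ ^ 2 * (z - (l a.2.1 : ℂ))⁻¹ * (z - (l a.2.2 : ℂ))⁻¹
            * (X a.1 a.2.1 ω * X a.2.1 a.2.2 ω * X a.2.2 a.1 ω)
        + ((ε ^ 3 / (Fintype.card ι : ℝ) ^ 2 : ℝ) : ℂ) * resolventRemainder l
            (Matrix.of fun i j => X i j ω) (ε / √(Fintype.card ι)) z := by
  have hherm : (Matrix.of fun i j => X i j ω).IsHermitian := by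
    ext i j
    simp only [Matrix.conjTranspose_apply, Matrix.of_apply]
    exact (h.hermitian j i ω).symm
  have hn : (0 : ℝ) < Fintype.card ι := Nat.cast_pos.2 Fintype.card_pos
  have hs : (0 : ℝ) < √(Fintype.card ι) := Real.sqrt_pos.2 hn
  have hsq : √(Fintype.card ι : ℝ) ^ 2 = Fintype.card ι := Real.sq_sqrt hn.le
  rw [expansionError, trace_resolvent_eq l hherm _ hz rfl]
  simp only [fluctuation, mul_sub, Finset.sum_sub_distrib, Matrix.of_apply]
  generalize ∑ i, (z - (l i : ℂ))⁻¹ ^ 2 * X i i ω = S₁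
  generalize ∑ p : ι × ι, (z - (l p.1 : ℂ))⁻¹ ^ 2 * (z - (l p.2 : ℂ))⁻¹
    * (X p.1 p.2 ω * X p.2 p.1 ω) = S₂
  generalize ∑ p : ι × ι, (z - (l p.1 : ℂ))⁻¹ ^ 2 * (z - (l p.2 : ℂ))⁻¹
    * ∫ ω', X p.1 p.2 ω' * X p.2 p.1 ω' ∂P = S₂'
  generalize ∑ a : ι × ι × ι, (z - (l a.1 : ℂ))⁻¹ ^ 2 * (z - (l a.2.1 : ℂ))⁻¹
    * (z - (l a.2.2 : ℂ))⁻¹ * (X a.1 a.2.1 ω * X a.2.1 a.2.2 ω * X a.2.2 a.1 ω) = S₃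
  generalize resolventRemainder l (Matrix.of fun i j => X i j ω) _ z = S₄
  generalize Matrix.trace (Matrix.scalar ι z - Matrix.diagonal fun i => (l i : ℂ))⁻¹ = T
  have hc : (Fintype.card ι : ℂ) = ((√(Fintype.card ι : ℝ) : ℝ) : ℂ) ^ 2 := by
    rw [← Complex.ofReal_pow, hsq, Complex.ofReal_natCast]
  push_cast
  rw [hc]
  generalize hsdef : √(Fintype.card ι : ℝ) = s at hs
  have hs' : (s : ℂ) ≠ 0 := by exact_mod_cast hs.ne'
  have hε' : (ε : ℂ) ≠ 0 := by exact_mod_cast hε.ne'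
  field_simp
  ring

/-- In L¹ the fluctuations of the second order are of size `n`, the cubic sum of size `n²`, and the
remainder of size `n³`. With their prefactors they contribute `ε`, `ε² √n` and `ε³ n`. -/
lemma integral_norm_expansionError_le [Nonempty ι] (h : IsNoiseArray P X C) (hC : 0 ≤ C)
    (l : ι → ℝ) {ε : ℝ} (hε : 0 < ε) {z : ℂ} (hz : z.im ≠ 0) :
    Integrable (expansionError P X l ε z) P ∧
      ∫ ω, ‖expansionError P X l ε z ω‖ ∂P
        ≤ errorConst z C * (ε + ε ^ 3 * Fintype.card ι) := by
  set κ := |z.im|⁻¹ with hκdef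
  have hκ : 0 ≤ κ := by positivity
  set n : ℝ := (Fintype.card ι : ℝ) with hndef
  have hn : 0 < n := Nat.cast_pos.2 Fintype.card_pos
  have hg : ∀ i, ‖(z - (l i : ℂ))⁻¹‖ ≤ κ := fun i => norm_inv_sub_ofReal_le hz (l i)
  set κ' := ((z.im ^ 2)⁻¹ + (z.im ^ 2)⁻¹ ^ 2) / 2 with hκ'def
  have hκ' : 0 ≤ κ' := by positivity
  set F₂ : Ω → ℂ := fun ω => ∑ p : ι × ι,
    (z - (l p.1 : ℂ))⁻¹ ^ 2 * (z - (l p.2 : ℂ))⁻¹ * fluctuation P X p ω with hF₂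
  set F₃ : Ω → ℂ := fun ω => ∑ a : ι × ι × ι,
    (z - (l a.1 : ℂ))⁻¹ ^ 2 * (z - (l a.2.1 : ℂ))⁻¹ * (z - (l a.2.2 : ℂ))⁻¹
      * (X a.1 a.2.1 ω * X a.2.1 a.2.2 ω * X a.2.2 a.1 ω) with hF₃
  set Q : Ω → ℝ := fun ω => ∑ i, ∑ j, ‖∑ k, (z - (l k : ℂ))⁻¹ * (X i k ω * X k j ω)‖ ^ 2 with hQ
  have L₂ : MemLp F₂ 2 P := memLp_finsetSum _ fun p _ => (h.memLp_fluctuation p).const_mul _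
  have B₂ : ∫ ω, ‖F₂ ω‖ ∂P ≤ √(8 * (κ ^ 3) ^ 2 * (1 + C)) * n := by
    have := integral_norm_le_sqrt L₂ (h.integral_norm_quadratic_sub_sq_le hC
      (fun p => (z - (l p.1 : ℂ))⁻¹ ^ 2 * (z - (l p.2 : ℂ))⁻¹) (K := κ ^ 3) fun p => by
        rw [norm_mul, norm_pow]
        calc _ ≤ κ ^ 2 * κ := by gcongr <;> exact hg _
          _ = _ := by ring)
    rwa [← hndef, Real.sqrt_mul' _ (sq_nonneg n), Real.sqrt_sq hn.le] at this
  obtain ⟨L₃, V₃⟩ := h.integral_norm_cubic_sq_le hC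
    (fun a : ι × ι × ι => (z - (l a.1 : ℂ))⁻¹ ^ 2 * (z - (l a.2.1 : ℂ))⁻¹ * (z - (l a.2.2 : ℂ))⁻¹)
    (K := κ ^ 4) fun a => by
      rw [norm_mul, norm_mul, norm_pow]
      calc _ ≤ κ ^ 2 * κ * κ := by gcongr <;> exact hg _
        _ = _ := by ring
  have B₃ : ∫ ω, ‖F₃ ω‖ ∂P ≤ √(72 * (κ ^ 4) ^ 2 * (1 + C)) * n ^ 2 := by
    have := integral_norm_le_sqrt L₃ V₃
    have e : n ^ 4 = (n ^ 2) ^ 2 := by ring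
    rwa [← hndef, e, Real.sqrt_mul' _ (sq_nonneg _), Real.sqrt_sq (by positivity)] at this
  have IQ' : ∀ i j, Integrable (fun ω => ‖∑ k, (z - (l k : ℂ))⁻¹ * (X i k ω * X k j ω)‖ ^ 2) P :=
    fun i j => (memLp_finsetSum Finset.univ (f := fun k ω => (z - (l k : ℂ))⁻¹ * (X i k ω * X k j ω))
      fun k _ => (h.memLp_pair i k k j).1.const_mul _).integrable_norm_pow (by norm_num)
  have IQ : Integrable Q P :=
    integrable_finsetSum _ fun i _ => integrable_finsetSum _ fun j _ => IQ' i j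
  -- Up to the common constant, the `n` diagonal entries contribute at most `n²` each and the
  -- off-diagonal ones at most `n` each.
  have BQ : ∫ ω, Q ω ∂P ≤ 2 * κ ^ 2 * (1 + C) * n ^ 3 := by
    rw [hQ, integral_finsetSum _ fun i _ => integrable_finsetSum _ fun j _ => IQ' i j]
    calc _ ≤ ∑ i : ι, ∑ j : ι, κ ^ 2 * (1 + C) * (if i = j then n else 1) * n := by
          refine Finset.sum_le_sum fun i _ => ?_
          rw [integral_finsetSum _ fun j _ => IQ' i j]
          exact Finset.sum_le_sum fun j _ => h.integral_norm_sandwich_sq_le hC _ hg i j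
      _ ≤ ∑ i : ι, ∑ j : ι, κ ^ 2 * (1 + C) * ((if i = j then n else 0) + 1) * n := by
          refine Finset.sum_le_sum fun i _ => Finset.sum_le_sum fun j _ => ?_
          gcongr
          split_ifs <;> linarith
      _ = _ := by
          simp only [← Finset.sum_mul, ← Finset.mul_sum, Finset.sum_add_distrib,
            Finset.sum_ite_eq, Finset.mem_univ, if_true, Finset.sum_const, Finset.card_univ,
            nsmul_eq_mul, mul_one, ← hndef]
          ring
  have I₂ : Integrable (fun ω => ‖F₂ ω‖) P := (L₂.integrable (by norm_num)).norm
  have I₃ : Integrable (fun ω => ‖F₃ ω‖) P := (L₃.integrable (by norm_num)).norm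
  set D : Ω → ℝ := fun ω => ε / n * ‖F₂ ω‖ + ε ^ 2 / √n ^ 3 * ‖F₃ ω‖ + ε ^ 3 / n ^ 2 * (κ' * Q ω)
    with hD
  have I₂₃ : Integrable (fun ω => ε / n * ‖F₂ ω‖ + ε ^ 2 / √n ^ 3 * ‖F₃ ω‖) P :=
    (I₂.const_mul _).add (I₃.const_mul _)
  have ID : Integrable D P := I₂₃.add ((IQ.const_mul _).const_mul _)
  have hbound : ∀ ω, ‖expansionError P X l ε z ω‖ ≤ D ω := fun ω => by
    rw [h.expansionError_eq l hε hz ω]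
    refine (norm_add₃_le).trans (add_le_add (add_le_add ?_ ?_) ?_)
    · rw [norm_mul, Complex.norm_real, Real.norm_of_nonneg (by positivity)]
    · rw [norm_mul, Complex.norm_real, Real.norm_of_nonneg (by positivity)]
    · rw [norm_mul, Complex.norm_real, Real.norm_of_nonneg (by positivity)]
      refine mul_le_mul_of_nonneg_left ?_ (by positivity)
      refine norm_resolventRemainder_le l ?_ _ hz
      ext i j
      simp only [Matrix.conjTranspose_apply, Matrix.of_apply]
      exact (h.hermitian j i ω).symm
  have IE : Integrable (expansionError P X l ε z) P :=
    ID.mono' (h.measurable_expansionError l ε z).aestronglyMeasurable (ae_of_all _ hbound)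
  refine ⟨IE, (integral_mono IE.norm ID hbound).trans ?_⟩
  have hs : 0 < √n := Real.sqrt_pos.2 hn
  have hsq : √n ^ 2 = n := Real.sq_sqrt hn.le
  rw [hD, integral_add I₂₃ ((IQ.const_mul _).const_mul _),
    integral_add (I₂.const_mul _) (I₃.const_mul _), integral_const_mul, integral_const_mul,
    integral_const_mul, integral_const_mul]
  set a₂ := √(8 * (κ ^ 3) ^ 2 * (1 + C)) with ha₂
  set a₃ := √(72 * (κ ^ 4) ^ 2 * (1 + C)) with ha₃
  have ha₂0 : 0 ≤ a₂ := Real.sqrt_nonneg _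
  have ha₃0 : 0 ≤ a₃ := Real.sqrt_nonneg _
  have e₂ : ε / n * ∫ ω, ‖F₂ ω‖ ∂P ≤ a₂ * ε := by
    calc _ ≤ ε / n * (a₂ * n) := by gcongr
      _ = _ := by field_simp
  have e₃ : ε ^ 2 / √n ^ 3 * ∫ ω, ‖F₃ ω‖ ∂P ≤ a₃ * (ε + ε ^ 3 * n) := by
    calc _ ≤ ε ^ 2 / √n ^ 3 * (a₃ * n ^ 2) := by gcongr
      _ = a₃ * (ε ^ 2 * √n) := by
          have : n ^ 2 = √n ^ 4 := by rw [← hsq]; simp only [Real.sqrt_sq hs.le]; ring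
          rw [this]
          field_simp
      _ ≤ _ := by
          refine mul_le_mul_of_nonneg_left ?_ ha₃0
          -- The cubic contribution `ε² √n` is the geometric mean of the other two, so it imposes no
          -- further condition on `ε`.
          have : ε + ε ^ 3 * n - 2 * (ε ^ 2 * √n) = ε * (1 - ε * √n) ^ 2 := by
            linear_combination -ε ^ 3 * hsq
          have h1 : 0 ≤ ε * (1 - ε * √n) ^ 2 := by positivity
          have h2 : 0 ≤ ε ^ 2 * √n := by positivity
          linarith
  have e₄ : ε ^ 3 / n ^ 2 * (κ' * ∫ ω, Q ω ∂P) ≤ κ' * (2 * κ ^ 2 * (1 + C)) * (ε ^ 3 * n) := by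
    calc _ ≤ ε ^ 3 / n ^ 2 * (κ' * (2 * κ ^ 2 * (1 + C) * n ^ 3)) := by gcongr
      _ = _ := by field_simp
  have hr : errorConst z C = a₂ + a₃ + κ' * (2 * κ ^ 2 * (1 + C)) := rfl
  rw [hr]
  have p1 : 0 ≤ a₂ * (ε ^ 3 * n) := by positivity
  have p2 : 0 ≤ κ' * (2 * κ ^ 2 * (1 + C)) * ε := by positivity
  linarith

/-! ### The leading random part -/

/-- The leading random part of the normalized difference of the resolvent traces. -/
def linearPart (X : ι → ι → Ω → ℂ) (l : ι → ℝ) (z : ℂ) (ω : Ω) : ℂ :=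
  ((√(Fintype.card ι))⁻¹ : ℝ) * ∑ i, (z - (l i : ℂ))⁻¹ ^ 2 * X i i ω

omit [IsProbabilityMeasure P] in
lemma measurable_linearPart (h : IsNoiseArray P X C) (l : ι → ℝ) (z : ℂ) :
    Measurable (linearPart X l z) :=
  (Finset.measurable_sum _ fun i _ => (h.measurable i i).const_mul _).const_mul _

lemma integral_norm_linearPart_le [Nonempty ι] (h : IsNoiseArray P X C) (hC : 0 ≤ C)
    (l : ι → ℝ) {z : ℂ} (hz : z.im ≠ 0) :
    Integrable (linearPart X l z) P ∧
      ∫ ω, ‖linearPart X l z ω‖ ∂P ≤ √((|z.im|⁻¹ ^ 2) ^ 2 * (1 + C)) := by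
  have hn : (0 : ℝ) < Fintype.card ι := Nat.cast_pos.2 Fintype.card_pos
  have L : MemLp (fun ω => ∑ i, (z - (l i : ℂ))⁻¹ ^ 2 * X i i ω) 2 P :=
    memLp_finsetSum _ fun i _ => (h.memLp_entry i i).1.const_mul _
  refine ⟨(L.integrable (by norm_num)).const_mul _, ?_⟩
  have := integral_norm_le_sqrt L (h.integral_norm_diag_sq_le hC
    (fun i => (z - (l i : ℂ))⁻¹ ^ 2) (K := |z.im|⁻¹ ^ 2) fun i => by
      rw [norm_pow]
      exact pow_le_pow_left₀ (norm_nonneg _) (norm_inv_sub_ofReal_le hz _) 2)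
  rw [Real.sqrt_mul' _ hn.le] at this
  simp only [linearPart, norm_mul, Complex.norm_real]
  rw [integral_const_mul, Real.norm_of_nonneg (by positivity)]
  calc _ ≤ (√(Fintype.card ι))⁻¹ * (√((|z.im|⁻¹ ^ 2) ^ 2 * (1 + C)) * √(Fintype.card ι)) :=
        mul_le_mul_of_nonneg_left this (by positivity)
    _ = _ := by
        have : √(Fintype.card ι : ℝ) ≠ 0 := (Real.sqrt_pos.2 hn).ne'
        field_simp

omit [Fintype ι] [IsProbabilityMeasure P] in
lemma coe_re_diag (h : IsNoiseArray P X C) (i : ι) (ω : Ω) : (((X i i ω).re : ℝ) : ℂ) = X i i ω :=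
  Complex.conj_eq_iff_re.1 (h.hermitian i i ω).symm

omit [Fintype ι] [IsProbabilityMeasure P] in
lemma abs_re_diag (h : IsNoiseArray P X C) (i : ι) (ω : Ω) : |(X i i ω).re| = ‖X i i ω‖ := by
  rw [← h.coe_re_diag i ω, Complex.norm_real, Complex.ofReal_re, Real.norm_eq_abs]

omit [Fintype ι] [IsProbabilityMeasure P] in
lemma iIndepFun_re_diag (h : IsNoiseArray P X C) : iIndepFun (fun i ω => (X i i ω).re) P := by
  have h1 : iIndepFun (fun i => X i i) P :=
    h.indep.precomp (g := fun i => (⟨(i, i), le_rfl⟩ : {p : ι × ι // p.1 ≤ p.2}))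
      fun i j hij => by simpa using hij
  exact h1.comp (fun _ => Complex.re) fun _ => Complex.measurable_re

/-- Pairing with `t` gives a real combination of the independent diagonal entries, which are real by
Hermitian symmetry. The coefficients are of order `n^{-1/2}`, so the `n` third order errors add up
to order `n^{-1/2}`. -/
lemma norm_charFun_linearPart_sub_le [Nonempty ι] (h : IsNoiseArray P X C) (hC : 0 ≤ C)
    (l : ι → ℝ) {z : ℂ} (hz : z.im ≠ 0) (t : ℂ) :
    ‖charFun (P.map (linearPart X l z)) t
      - (Real.exp (-((Fintype.card ι : ℝ)⁻¹ * ∑ i, (inner ℝ ((z - (l i : ℂ))⁻¹ ^ 2) t) ^ 2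
          * ∫ ω, ‖X i i ω‖ ^ 2 ∂P) / 2) : ℂ)‖
      ≤ 4 * (|z.im|⁻¹ ^ 2 * ‖t‖) ^ 3 * (1 + C) * (√(Fintype.card ι))⁻¹
        + ((|z.im|⁻¹ ^ 2 * ‖t‖) ^ 2 * (1 + C)) ^ 2 * (Fintype.card ι : ℝ)⁻¹ := by
  set n : ℝ := (Fintype.card ι : ℝ) with hndef
  have hn : 0 < n := Nat.cast_pos.2 Fintype.card_pos
  have hs : 0 < √n := Real.sqrt_pos.2 hn
  have hsq : √n ^ 2 = n := Real.sq_sqrt hn.le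
  set A := |z.im|⁻¹ ^ 2 * ‖t‖ with hA
  have hA0 : 0 ≤ A := by positivity
  set α : ι → ℝ := fun i => (√n)⁻¹ * inner ℝ ((z - (l i : ℂ))⁻¹ ^ 2) t with hα
  have hαA : ∀ i, |α i| ≤ (√n)⁻¹ * A := fun i => by
    rw [hα, abs_mul, abs_of_pos (inv_pos.2 hs)]
    refine mul_le_mul_of_nonneg_left ?_ (inv_pos.2 hs).le
    refine (abs_real_inner_le_norm _ _).trans ?_
    rw [norm_pow]
    exact mul_le_mul_of_nonneg_right
      (pow_le_pow_left₀ (norm_nonneg _) (norm_inv_sub_ofReal_le hz (l i)) 2) (norm_nonneg t)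
  have hinner : ∀ ω, inner ℝ (linearPart X l z ω) t = ∑ i, α i * (X i i ω).re := fun ω => by
    have : linearPart X l z ω
        = ∑ i, ((√n)⁻¹ * (X i i ω).re) • (z - (l i : ℂ))⁻¹ ^ 2 := by
      rw [linearPart, Finset.mul_sum]
      refine Finset.sum_congr rfl fun i _ => ?_
      rw [Complex.real_smul, Complex.ofReal_mul, h.coe_re_diag]
      ring
    rw [this, sum_inner]
    refine Finset.sum_congr rfl fun i _ => ?_
    rw [real_inner_smul_left, hα]
    ring
  have hchar : charFun (P.map (linearPart X l z)) t
      = ∫ ω, Complex.exp (Complex.I * ((∑ i, α i * (X i i ω).re : ℝ) : ℂ)) ∂P := by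
    rw [charFun_apply, integral_map (h.measurable_linearPart l z).aemeasurable (by fun_prop)]
    refine integral_congr_ae (ae_of_all _ fun ω => ?_)
    simp only
    rw [hinner, mul_comm]
  have hv : ∀ i, ∫ ω, (X i i ω).re ^ 2 ∂P = ∫ ω, ‖X i i ω‖ ^ 2 ∂P := fun i => by
    refine integral_congr_ae (ae_of_all _ fun ω => ?_)
    simp only
    rw [← h.abs_re_diag, sq_abs]
  have hexp : n⁻¹ * ∑ i, (inner ℝ ((z - (l i : ℂ))⁻¹ ^ 2) t) ^ 2 * ∫ ω, ‖X i i ω‖ ^ 2 ∂P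
      = ∑ i, α i ^ 2 * ∫ ω, ‖X i i ω‖ ^ 2 ∂P := by
    rw [Finset.mul_sum]
    refine Finset.sum_congr rfl fun i _ => ?_
    have hsq' : (√n)⁻¹ ^ 2 = n⁻¹ := by rw [inv_pow, hsq]
    simp only [hα]
    rw [mul_pow, hsq']
    ring
  rw [hchar, hexp]
  refine (norm_integral_exp_sum_sub_exp_le (r := fun i ω => (X i i ω).re)
    (fun i => Complex.measurable_re.comp (h.measurable i i)) h.iIndepFun_re_diag α
    (fun i => ∫ ω, ‖X i i ω‖ ^ 2 ∂P) (M := 1 + C) (fun i => ?_) (fun i => ?_) hv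
    (fun i => (h.memLp_entry i i).2) (fun i => ?_)).trans ?_
  · simp only [h.abs_re_diag]
    exact (h.integrable_norm_pow i i (k := 3) (by norm_num)).1
  · have := integral_re ((h.memLp_entry i i).1.integrable (by norm_num))
    simpa [h.centered] using this
  · simp only [h.abs_re_diag]
    exact (h.integrable_norm_pow i i (k := 3) (by norm_num)).2
  · calc _ ≤ ∑ _i : ι, (4 * ((√n)⁻¹ * A) ^ 3 * (1 + C) + (((√n)⁻¹ * A) ^ 2 * (1 + C)) ^ 2) := by
          refine Finset.sum_le_sum fun i _ => ?_
          rw [← sq_abs (α i)]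
          have := hαA i
          gcongr
      _ = n * (4 * ((√n)⁻¹ * A) ^ 3 * (1 + C) + (((√n)⁻¹ * A) ^ 2 * (1 + C)) ^ 2) := by
          rw [Finset.sum_const, Finset.card_univ, nsmul_eq_mul]
      _ = _ := by
          rw [← hsq]
          simp only [Real.sqrt_sq hs.le]
          field_simp

end IsNoiseArray

end Error

/-! ### The characteristic function of the limit field -/

section LimitField

lemma hasDerivAt_cauchyKernel (z : ℂ) (hz : z.im ≠ 0) (t : ℝ) :
    HasDerivAt (cauchyKernel z hz).1 ((z - (t : ℂ))⁻¹ ^ 2) t := by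
  have h : HasDerivAt (fun w : ℂ => 1 / (z - w)) ((z - (t : ℂ))⁻¹ ^ 2) (t : ℂ) := by
    have h1 : HasDerivAt (fun w : ℂ => z - w) (-1) (t : ℂ) := (hasDerivAt_id _).const_sub z
    have h2 := h1.fun_inv (sub_ofReal_ne_zero hz t)
    simp only [one_div]
    rw [neg_neg, one_div, ← inv_pow] at h2
    exact h2
  exact h.comp_ofReal

lemma deriv_cauchyKernel (z : ℂ) (hz : z.im ≠ 0) (t : ℝ) :
    deriv (cauchyKernel z hz).1 t = (z - (t : ℂ))⁻¹ ^ 2 :=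
  (hasDerivAt_cauchyKernel z hz t).deriv

lemma deriv_conjugate_cauchyKernel (z : ℂ) (hz : z.im ≠ 0) (t : ℝ) :
    deriv (cauchyKernel z hz).conjugate.1 t = conj ((z - (t : ℂ))⁻¹ ^ 2) :=
  (Complex.conjCLE.toContinuousLinearMap.hasFDerivAt.comp_hasDerivAt t
    (hasDerivAt_cauchyKernel z hz t)).deriv

/-- It writes the squared real pairing through `w` and its conjugate, so that bilinear covariances,
taken without conjugation, determine its mean. -/
lemma ofReal_inner_sq (t w : ℂ) : (((inner ℝ t w) ^ 2 : ℝ) : ℂ)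
    = conj t ^ 2 / 4 * (w * w) + (t * conj t) / 2 * (w * conj w) + t ^ 2 / 4 * (conj w * conj w) := by
  have h : ((inner ℝ t w : ℝ) : ℂ) = (w * conj t + conj (w * conj t)) / 2 := by
    rw [Complex.inner, Complex.re_eq_add_conj]
  rw [Complex.ofReal_pow, h, map_mul, Complex.conj_conj]
  ring

/-- The variance of the pairing of the limit field at `φ_z` with `t`. -/
def limitVar (f σd : ℝ → ℝ) (z t : ℂ) : ℝ :=
  ∫ s in Set.Icc (0 : ℝ) 1, (inner ℝ ((z - (f s : ℂ))⁻¹ ^ 2) t) ^ 2 * σd s ^ 2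

variable {Ω' : Type*} [MeasurableSpace Ω'] {P' : Measure Ω'} [IsProbabilityMeasure P']
  {f σd : ℝ → ℝ} {Z : C6 → Ω' → ℂ}

omit [IsProbabilityMeasure P'] in
-- The three second moments are covariances of the field at the Cauchy kernel and at its conjugate.
-- The same quadratic identity, applied under the integral over `[0, 1]`, reassembles them into
-- `limitVar`.
lemma integral_inner_limitField_sq (hZ : IsLimitField P' f σd Z) {z : ℂ} (hz : z.im ≠ 0) (t : ℂ)
    {M : ℝ} (hf : AEStronglyMeasurable f (volume.restrict (Set.Icc 0 1)))
    (hσ : AEStronglyMeasurable (fun s => σd s ^ 2) (volume.restrict (Set.Icc 0 1)))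
    (hσM : ∀ᵐ s ∂(volume : Measure ℝ).restrict (Set.Icc 0 1), |σd s ^ 2| ≤ M) :
    ∫ ω, (inner ℝ t (Z (cauchyKernel z hz) ω)) ^ 2 ∂P' = limitVar f σd z t := by
  set φ := cauchyKernel z hz
  set W := Z φ
  set W' := Z φ.conjugate
  have hW : MemLp W 2 P' := (hZ.gaussian.hasGaussianLaw_eval φ).memLp_two
  have hW' : MemLp W' 2 P' := (hZ.gaussian.hasGaussianLaw_eval φ.conjugate).memLp_two
  have hconj : ∀ᵐ ω ∂P', conj (W ω) = W' ω := hZ.conj_eq φ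
  have iWW : Integrable (fun ω => W ω * W ω) P' := hW.integrable_mul hW
  have iWW' : Integrable (fun ω => W ω * W' ω) P' := hW.integrable_mul hW'
  have iW'W' : Integrable (fun ω => W' ω * W' ω) P' := hW'.integrable_mul hW'
  have e1 : ((∫ ω, (inner ℝ t (W ω)) ^ 2 ∂P' : ℝ) : ℂ)
      = conj t ^ 2 / 4 * (∫ ω, W ω * W ω ∂P') + (t * conj t) / 2 * (∫ ω, W ω * W' ω ∂P')
        + t ^ 2 / 4 * ∫ ω, W' ω * W' ω ∂P' := by
    have i12 : Integrable (fun ω => conj t ^ 2 / 4 * (W ω * W ω)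
        + (t * conj t) / 2 * (W ω * W' ω)) P' := (iWW.const_mul _).add (iWW'.const_mul _)
    rw [← integral_complex_ofReal, ← integral_const_mul, ← integral_const_mul,
      ← integral_const_mul, ← integral_add (iWW.const_mul _) (iWW'.const_mul _),
      ← integral_add i12 (iW'W'.const_mul _)]
    refine integral_congr_ae ?_
    filter_upwards [hconj] with ω hω
    rw [ofReal_inner_sq, hω]
  set a : ℝ → ℂ := fun s => (z - (f s : ℂ))⁻¹ ^ 2 with ha
  have hb : ∀ s, ‖a s‖ ≤ |z.im|⁻¹ ^ 2 := fun s => by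
    rw [ha, norm_pow]
    exact pow_le_pow_left₀ (norm_nonneg _) (norm_inv_sub_ofReal_le hz _) 2
  have hm : AEMeasurable a (volume.restrict (Set.Icc 0 1)) := by
    have hinv : Measurable fun y : ℝ => (z - (y : ℂ))⁻¹ ^ 2 := by fun_prop
    exact hinv.comp_aemeasurable hf.aemeasurable
  have hm' : AEMeasurable (fun s => conj (a s)) (volume.restrict (Set.Icc 0 1)) :=
    RCLike.continuous_conj.measurable.comp_aemeasurable hm
  have hσ' : AEMeasurable (fun s => ((σd s ^ 2 : ℝ) : ℂ)) (volume.restrict (Set.Icc 0 1)) :=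
    Complex.measurable_ofReal.comp_aemeasurable hσ.aemeasurable
  have hint : ∀ u v : ℝ → ℂ, AEMeasurable u (volume.restrict (Set.Icc 0 1)) →
      AEMeasurable v (volume.restrict (Set.Icc 0 1)) → (∀ s, ‖u s‖ ≤ |z.im|⁻¹ ^ 2) →
      (∀ s, ‖v s‖ ≤ |z.im|⁻¹ ^ 2) →
      IntegrableOn (fun s => ((σd s ^ 2 : ℝ) : ℂ) * u s * v s) (Set.Icc 0 1) :=
    fun u v hu hv hub hvb => by
      refine Integrable.of_bound ((hσ'.mul hu).mul hv).aestronglyMeasurable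
        (M * |z.im|⁻¹ ^ 2 * |z.im|⁻¹ ^ 2) ?_
      filter_upwards [hσM] with s hs
      have hM := (abs_nonneg _).trans hs
      rw [norm_mul, norm_mul, Complex.norm_real, Real.norm_eq_abs]
      have := hub s
      have := hvb s
      gcongr
  have hb' : ∀ s, ‖conj (a s)‖ ≤ |z.im|⁻¹ ^ 2 := fun s => by rw [RCLike.norm_conj]; exact hb s
  have j1 := (hint a a hm hm hb hb).const_mul (conj t ^ 2 / 4)
  have j2 := (hint a _ hm hm' hb hb').const_mul ((t * conj t) / 2)
  have j3 := (hint _ _ hm' hm' hb' hb').const_mul (t ^ 2 / 4)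
  have e2 : ((limitVar f σd z t : ℝ) : ℂ)
      = conj t ^ 2 / 4 * (∫ s in Set.Icc (0 : ℝ) 1, ((σd s ^ 2 : ℝ) : ℂ) * a s * a s)
        + (t * conj t) / 2 * (∫ s in Set.Icc (0 : ℝ) 1, ((σd s ^ 2 : ℝ) : ℂ) * a s * conj (a s))
        + t ^ 2 / 4 * ∫ s in Set.Icc (0 : ℝ) 1, ((σd s ^ 2 : ℝ) : ℂ) * conj (a s) * conj (a s) := by
    have j12 : IntegrableOn (fun s => conj t ^ 2 / 4 * (((σd s ^ 2 : ℝ) : ℂ) * a s * a s)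
        + (t * conj t) / 2 * (((σd s ^ 2 : ℝ) : ℂ) * a s * conj (a s))) (Set.Icc 0 1) := j1.add j2
    rw [limitVar, ← integral_complex_ofReal, ← integral_const_mul, ← integral_const_mul,
      ← integral_const_mul, ← integral_add j1 j2, ← integral_add j12 j3]
    refine integral_congr_ae (ae_of_all _ fun s => ?_)
    simp only
    rw [Complex.ofReal_mul, real_inner_comm, ofReal_inner_sq]
    ring
  have c1 := hZ.covariance φ φ
  have c2 := hZ.covariance φ φ.conjugate
  have c3 := hZ.covariance φ.conjugate φ.conjugate
  simp only [φ, deriv_cauchyKernel, deriv_conjugate_cauchyKernel] at c1 c2 c3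
  apply Complex.ofReal_injective
  rw [e1, e2]
  congr 1
  · congr 1
    · rw [c1]
    · rw [c2]
  · rw [c3]

omit [IsProbabilityMeasure P'] in
lemma charFun_limitField (hZ : IsLimitField P' f σd Z) {z : ℂ} (hz : z.im ≠ 0) (t : ℂ)
    {M : ℝ} (hf : AEStronglyMeasurable f (volume.restrict (Set.Icc 0 1)))
    (hσ : AEStronglyMeasurable (fun s => σd s ^ 2) (volume.restrict (Set.Icc 0 1)))
    (hσM : ∀ᵐ s ∂(volume : Measure ℝ).restrict (Set.Icc 0 1), |σd s ^ 2| ≤ M) :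
    charFun (P'.map (Z (cauchyKernel z hz))) t = (Real.exp (-limitVar f σd z t / 2) : ℂ) := by
  have hG := hZ.gaussian.hasGaussianLaw_eval (cauchyKernel z hz)
  have h0 : ∫ ω, inner ℝ t (Z (cauchyKernel z hz) ω) ∂P' = 0 := by
    rw [integral_inner hG.integrable, hZ.centered, inner_zero_right]
  have hmeas : AEMeasurable (fun ω => inner ℝ t (Z (cauchyKernel z hz) ω)) P' :=
    (continuous_const.inner continuous_id).measurable.comp_aemeasurable hG.aemeasurable
  rw [hG.charFun_map_eq, h0, variance_of_integral_eq_zero hmeas h0,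
    integral_inner_limitField_sq hZ hz t hf hσ hσM, Complex.ofReal_exp]
  congr 1
  push_cast
  ring

end LimitField

/-! ### Convergence in distribution up to an error which is small in mean -/

section Slutsky

lemma norm_exp_mul_I_sub_le (a b : ℝ) :
    ‖Complex.exp (a * Complex.I) - Complex.exp (b * Complex.I)‖ ≤ |a - b| := by
  have e : Complex.exp (a * Complex.I) - Complex.exp (b * Complex.I)
      = Complex.exp (b * Complex.I) * (Complex.exp (Complex.I * ((a - b : ℝ) : ℂ)) - 1) := by
    rw [mul_sub, ← Complex.exp_add, mul_one]
    congr 2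
    push_cast
    ring
  rw [e, norm_mul, Complex.norm_exp_ofReal_mul_I, one_mul]
  exact Real.norm_exp_I_mul_ofReal_sub_one_le

lemma norm_charFun_sub_charFun_le {Ω : Type*} [MeasurableSpace Ω] {P : Measure Ω}
    [IsProbabilityMeasure P] {Y T : Ω → ℂ} (hY : AEMeasurable Y P) (hT : AEMeasurable T P)
    (hint : Integrable (fun ω => Y ω - T ω) P) (t : ℂ) :
    ‖charFun (P.map Y) t - charFun (P.map T) t‖ ≤ ‖t‖ * ∫ ω, ‖Y ω - T ω‖ ∂P := by
  have hi : ∀ {U : Ω → ℂ}, AEMeasurable U P →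
      Integrable (fun ω => Complex.exp ((inner ℝ (U ω) t : ℝ) * Complex.I)) P := fun {U} hU => by
    refine Integrable.of_bound (C := 1) ?_ (ae_of_all _ fun ω => ?_)
    · have hc : Continuous fun u : ℂ => Complex.exp ((inner ℝ u t : ℝ) * Complex.I) := by fun_prop
      exact (hc.measurable.comp_aemeasurable hU).aestronglyMeasurable
    · rw [Complex.norm_exp_ofReal_mul_I]
  rw [charFun_apply, charFun_apply, integral_map hY (by fun_prop), integral_map hT (by fun_prop),
    ← integral_sub (hi hY) (hi hT), ← integral_const_mul]
  refine norm_integral_le_of_norm_le (hint.norm.const_mul _) (ae_of_all _ fun ω => ?_)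
  refine (norm_exp_mul_I_sub_le _ _).trans ?_
  rw [← inner_sub_left, mul_comm]
  exact abs_real_inner_le_norm _ _

variable {Ω : ℕ → Type*} [∀ n, MeasurableSpace (Ω n)] {P : (n : ℕ) → Measure (Ω n)}
  [∀ n, IsProbabilityMeasure (P n)]

/-- Closeness in mean makes the characteristic functions of `Y` and `T` asymptotically equal, and
Lévy's continuity theorem concludes. Working with laws avoids any relation between the probability
spaces. -/
lemma tendstoInDistribution_of_tendsto_charFun {Ω' : Type*} [MeasurableSpace Ω'] {P' : Measure Ω'}
    [IsProbabilityMeasure P'] {Y T : (n : ℕ) → Ω n → ℂ} {W : Ω' → ℂ}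
    (hY : ∀ n, AEMeasurable (Y n) (P n)) (hT : ∀ n, AEMeasurable (T n) (P n))
    (hW : AEMeasurable W P')
    (hchar : ∀ t, Tendsto (fun n => charFun ((P n).map (T n)) t) atTop
      (𝓝 (charFun (P'.map W) t)))
    (hint : ∀ᶠ n in atTop, Integrable (fun ω => Y n ω - T n ω) (P n))
    (hlim : Tendsto (fun n => ∫ ω, ‖Y n ω - T n ω‖ ∂P n) atTop (𝓝 0)) :
    TendstoInDistribution Y atTop W P P' where
  forall_aemeasurable := hY
  aemeasurable_limit := hW
  tendsto := by
    refine ProbabilityMeasure.tendsto_iff_tendsto_charFun.2 fun t => ?_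
    have h0 : Tendsto (fun n => charFun ((P n).map (Y n)) t - charFun ((P n).map (T n)) t) atTop
        (𝓝 0) := by
      refine squeeze_zero_norm' (a := fun n => ‖t‖ * ∫ ω, ‖Y n ω - T n ω‖ ∂P n) ?_
        (by simpa using hlim.const_mul ‖t‖)
      filter_upwards [hint] with n hn
      exact norm_charFun_sub_charFun_le (hY n) (hT n) hn t
    simpa using h0.add (hchar t)

lemma tendstoZeroInProbability_of_integral {Y : (n : ℕ) → Ω n → ℂ}
    (hint : ∀ᶠ n in atTop, Integrable (Y n) (P n))
    (hlim : Tendsto (fun n => ∫ ω, ‖Y n ω‖ ∂P n) atTop (𝓝 0)) :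
    TendstoZeroInProbability P Y := by
  intro δ hδ
  have h0 : Tendsto (fun n => ENNReal.ofReal (δ⁻¹ * ∫ ω, ‖Y n ω‖ ∂P n)) atTop (𝓝 0) := by
    have := (ENNReal.continuous_ofReal.tendsto _).comp (hlim.const_mul δ⁻¹)
    simpa [Function.comp_def] using this
  refine tendsto_of_tendsto_of_tendsto_of_le_of_le' tendsto_const_nhds h0
    (Eventually.of_forall fun n => zero_le) ?_
  filter_upwards [hint] with n hn
  have h1 := mul_meas_ge_le_integral_of_nonneg (ae_of_all _ fun ω => norm_nonneg (Y n ω)) hn.norm δ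
  rw [ENNReal.le_ofReal_iff_toReal_le (measure_ne_top _ _)
    (mul_nonneg (inv_nonneg.2 hδ.le) (integral_nonneg fun _ => norm_nonneg _)),
    inv_mul_eq_div, le_div_iff₀ hδ, mul_comm]
  exact h1

end Slutsky

/-! ### The matrix model -/

section Model

variable {Ω : ℕ → Type*} [∀ n, MeasurableSpace (Ω n)] {P : (n : ℕ) → Measure (Ω n)}
  [∀ n, IsProbabilityMeasure (P n)] {lam : ℕ → ℕ → ℝ} {x : (n : ℕ) → ℕ → ℕ → Ω n → ℂ}
  {ε : ℕ → ℝ} {f σd : ℝ → ℝ} {σ : ℝ → ℝ → ℝ}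

/-- The array of the entries with indices in `1, …, n`. -/
def entries (x : (n : ℕ) → ℕ → ℕ → Ω n → ℂ) (n : ℕ) (i j : Finset.Icc 1 n) : Ω n → ℂ := x n i j

/-- The eigenvalues with indices in `1, …, n`. -/
def eigs (lam : ℕ → ℕ → ℝ) (n : ℕ) (i : Finset.Icc 1 n) : ℝ := lam n i

lemma card_indices (n : ℕ) : Fintype.card (Finset.Icc 1 n) = n := by simp

omit [∀ n, IsProbabilityMeasure (P n)] in
lemma IsNoise.exists_isNoiseArray (hx : IsNoise P x) :
    ∃ C : ℝ, 0 ≤ C ∧ ∀ n, IsNoiseArray (P n) (entries x n) C := by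
  obtain ⟨C, hC⟩ := hx.moment
  refine ⟨C, C.2, fun n => ?_⟩
  have hm : ∀ i j : Finset.Icc 1 n, Measurable (x n i j) := fun i j => hx.measurable n i i.2 j j.2
  have hfin : ∀ i j : Finset.Icc 1 n, ∫⁻ ω, ‖x n i j ω ^ 8‖ₑ ∂P n ≤ C := fun i j => by
    simpa only [enorm_pow] using hC n i i.2 j j.2
  have hi : ∀ i j : Finset.Icc 1 n, Integrable (fun ω => x n i j ω ^ 8) (P n) := fun i j =>
    ⟨((hm i j).pow_const 8).aestronglyMeasurable,
      (hfin i j).trans_lt ENNReal.coe_lt_top⟩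
  refine ⟨hm, fun i j ω => hx.hermitian n i i.2 j j.2 ω, ?_, fun i j => hx.centered n i i.2 j j.2,
    fun i j => ?_, fun i j => ?_⟩
  -- Restricting indices to `1, …, n` is an injective relabelling of the pairs, so independence is
  -- inherited.
  · refine (hx.indep n).precomp (g := fun p : {p : Finset.Icc 1 n × Finset.Icc 1 n // p.1 ≤ p.2} =>
      ⟨((p.1.1 : ℕ), (p.1.2 : ℕ)), (Finset.mem_Icc.1 p.1.1.2).1, p.2,
        (Finset.mem_Icc.1 p.1.2.2).2⟩) fun p q hpq => ?_
    simp only [Subtype.mk.injEq, Prod.mk.injEq] at hpq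
    exact Subtype.ext (Prod.ext (Subtype.ext hpq.1) (Subtype.ext hpq.2))
  · simpa only [norm_pow, entries] using (hi i j).norm
  · have h1 := integral_norm_eq_lintegral_enorm (hi i j).1
    simp only [norm_pow] at h1
    simp only [entries]
    rw [h1]
    exact ENNReal.toReal_le_of_le_ofReal C.2 ((hfin i j).trans (by simp))

omit [∀ n, IsProbabilityMeasure (P n)] in
lemma entryVar_eq (hx : IsNoise P x) (n : ℕ) (i j : Finset.Icc 1 n) :
    entryVar P x n i j = ∫ ω, ‖entries x n i j ω‖ ^ 2 ∂P n := by
  simp only [entryVar, hx.centered n i i.2 j j.2, sub_zero, entries]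

omit [∀ n, IsProbabilityMeasure (P n)] in
-- Hermitian symmetry turns the product of transposed entries, which is what the trace produces,
-- into a squared modulus.
lemma ofReal_entryVar (hx : IsNoise P x) (n : ℕ) (i j : Finset.Icc 1 n) :
    (entryVar P x n i j : ℂ) = ∫ ω, entries x n i j ω * entries x n j i ω ∂P n := by
  rw [entryVar_eq hx, ← integral_complex_ofReal]
  refine integral_congr_ae (ae_of_all _ fun ω => ?_)
  simp only [entries]
  rw [hx.hermitian n i i.2 j j.2, Complex.mul_conj']
  push_cast
  rfl

lemma abs_entryVar_le (hx : IsNoise P x) {C : ℝ}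
    (hC : ∀ n, IsNoiseArray (P n) (entries x n) C) (n : ℕ) (i : ℕ) (hi : i ∈ Finset.Icc 1 n)
    (j : ℕ) (hj : j ∈ Finset.Icc 1 n) : |entryVar P x n i j| ≤ 1 + C := by
  rw [entryVar_eq hx n ⟨i, hi⟩ ⟨j, hj⟩, abs_of_nonneg (integral_nonneg fun _ => by positivity)]
  exact ((hC n).memLp_entry _ _).2

lemma SpectrumNearCompact.exists_bound (h : SpectrumNearCompact lam) :
    ∃ L, ∀ᶠ n in atTop, ∀ i ∈ Finset.Icc 1 n, |lam n i| ≤ L := by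
  obtain ⟨S, hS, hne, hlim⟩ := h
  obtain ⟨R, hR⟩ := hS.isBounded.subset_closedBall (0 : ℝ)
  refine ⟨R + 1, ?_⟩
  filter_upwards [hlim.eventually (gt_mem_nhds one_pos)] with n hn i hi
  have h1 : Metric.infDist (lam n i) S < 1 :=
    (le_ciSup (f := fun i : Finset.Icc 1 n => Metric.infDist (lam n i) S)
      (Set.finite_range _).bddAbove ⟨i, hi⟩).trans_lt hn
  obtain ⟨y, hy, hd⟩ := (Metric.infDist_lt_iff hne).1 h1
  have hyR := hR hy
  rw [mem_closedBall_zero_iff, Real.norm_eq_abs] at hyR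
  rw [Real.dist_eq] at hd
  have := abs_sub_abs_le_abs_sub (lam n i) y
  linarith

lemma exists_isProfile (hx : IsNoise P x) {C : ℝ}
    (hC : ∀ n, IsNoiseArray (P n) (entries x n) C)
    (hp : ProfileConvergence P lam x ε f σd σ) (hc : SpectrumNearCompact lam) :
    ∃ L, IsProfile lam (entryVar P x) f σ L (1 + C) := by
  obtain ⟨L, hL⟩ := hc.exists_bound
  exact ⟨L, hL, abs_entryVar_le hx hC, hp.spectrum, hp.offDiagVar⟩

omit [∀ n, IsProbabilityMeasure (P n)] in
lemma ProfileConvergence.aestronglyMeasurable_diagVar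
    (hp : ProfileConvergence P lam x ε f σd σ) :
    AEStronglyMeasurable (fun s => σd s ^ 2) (volume.restrict (Set.Icc 0 1)) := by
  refine aestronglyMeasurable_of_tendsto_ae atTop (f := fun (n : ℕ) (s : ℝ) =>
    entryVar P x n ⌊(n : ℝ) * s⌋₊ ⌊(n : ℝ) * s⌋₊)
    (fun n => aestronglyMeasurable_step n (fun i => entryVar P x n i i) _) ?_
  filter_upwards [ae_mem_Ioc] with s hs using hp.diagVar s hs

lemma ProfileConvergence.ae_abs_diagVar_le (hp : ProfileConvergence P lam x ε f σd σ)
    (hx : IsNoise P x) {C : ℝ} (hC : ∀ n, IsNoiseArray (P n) (entries x n) C) :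
    ∀ᵐ s ∂(volume : Measure ℝ).restrict (Set.Icc 0 1), |σd s ^ 2| ≤ 1 + C := by
  filter_upwards [ae_mem_Ioc] with s hs
  refine le_of_tendsto (hp.diagVar s hs).abs ?_
  filter_upwards [eventually_mem_cells hs, eventually_ge_atTop 1] with n h1 h2
  exact abs_entryVar_le hx hC n _ (floor_mem_of_mem_cells h2 h1) _ (floor_mem_of_mem_cells h2 h1)

omit [∀ n, MeasurableSpace (Ω n)] in
lemma perturbedMatrix_eq (n : ℕ) (ω : Ω n) :
    perturbedMatrix lam x ε n ω = (Matrix.diagonal fun i => (eigs lam n i : ℂ))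
      + ((ε n / √(n : ℝ) : ℝ) : ℂ) • Matrix.of fun i j => entries x n i j ω := by
  ext i j
  simp only [perturbedMatrix, diagMatrix, noiseMatrix, eigs, entries, Matrix.add_apply,
    Matrix.smul_apply, Matrix.of_apply, smul_eq_mul]
  push_cast
  ring

omit [∀ n, IsProbabilityMeasure (P n)] in
lemma sum_eq_stepB (hx : IsNoise P x) (z : ℂ) {n : ℕ} (hn : 1 ≤ n) :
    (ε n : ℂ) / (Fintype.card (Finset.Icc 1 n) : ℂ) * ∑ p : Finset.Icc 1 n × Finset.Icc 1 n,
      (z - (eigs lam n p.1 : ℂ))⁻¹ ^ 2 * (z - (eigs lam n p.2 : ℂ))⁻¹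
        * ∫ ω', entries x n p.1 p.2 ω' * entries x n p.2 p.1 ω' ∂P n
      = n * ε n * stepB lam (entryVar P x) z n := by
  have hn' : (n : ℂ) ≠ 0 := by exact_mod_cast (by omega : n ≠ 0)
  simp only [← ofReal_entryVar hx, card_indices, eigs]
  rw [stepB, Finset.sum_product, Fintype.sum_prod_type, ← Finset.sum_coe_sort (Finset.Icc 1 n)]
  simp only [← Finset.sum_coe_sort (Finset.Icc 1 n) (fun j => (z - (lam n _ : ℂ))⁻¹ ^ 2
    * (z - (lam n j : ℂ))⁻¹ * (entryVar P x n _ j : ℂ)), Complex.real_smul]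
  push_cast
  field_simp

omit [∀ n, IsProbabilityMeasure (P n)] in
-- All four regimes start from this decomposition into a Gaussian part, a deterministic part and an
-- error small in mean.
lemma scaled_deltaG_eq (hx : IsNoise P x) (z : ℂ) {n : ℕ} (hn : 1 ≤ n) (ω : Ω n) :
    (n : ℂ) * (ε n : ℂ)⁻¹ * deltaG lam x ε z n ω
      = IsNoiseArray.linearPart (entries x n) (eigs lam n) z ω
        + n * ε n * stepB lam (entryVar P x) z n
        + expansionError (P n) (entries x n) (eigs lam n) (ε n) z ω := by
  have hn' : (n : ℂ) ≠ 0 := by exact_mod_cast (by omega : n ≠ 0)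
  rw [expansionError, sum_eq_stepB hx z hn, IsNoiseArray.linearPart, deltaG, stieltjes, stieltjes,
    perturbedMatrix_eq, card_indices]
  have e : ∀ a b : ℂ, (n : ℂ) * (ε n : ℂ)⁻¹ * (1 / (n : ℂ) * a - 1 / (n : ℂ) * b)
      = (ε n : ℂ)⁻¹ * (a - b) := fun a b => by field_simp
  rw [e]
  have e2 : diagMatrix lam n = Matrix.diagonal fun i => (eigs lam n i : ℂ) := rfl
  rw [e2]
  have e3 : ∀ a b c : ℂ, a = b + c + (a - b - c) := fun a b c => by ring
  convert e3 _ _ _ using 14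

end Model

/-! ### Convergence according to the size of the perturbation -/

section Regimes

variable {Ω : ℕ → Type*} [∀ n, MeasurableSpace (Ω n)] {P : (n : ℕ) → Measure (Ω n)}
  [∀ n, IsProbabilityMeasure (P n)] {lam : ℕ → ℕ → ℝ} {x : (n : ℕ) → ℕ → ℕ → Ω n → ℂ}
  {ε : ℕ → ℝ} {f σd : ℝ → ℝ} {σ : ℝ → ℝ → ℝ} {Ω' : Type*} [MeasurableSpace Ω'] {P' : Measure Ω'}
  [IsProbabilityMeasure P'] {Z : C6 → Ω' → ℂ} {C : ℝ} {z : ℂ}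

omit [∀ n, IsProbabilityMeasure (P n)] in
lemma measurable_deltaG (hC : ∀ n, IsNoiseArray (P n) (entries x n) C) (z : ℂ) (n : ℕ) :
    Measurable (deltaG lam x ε z n) := by
  unfold deltaG stieltjes
  refine (measurable_const.mul (measurable_trace_inv fun i j => ?_)).sub_const _
  simp only [perturbedMatrix_eq, Matrix.sub_apply, Matrix.add_apply, Matrix.smul_apply,
    Matrix.of_apply, smul_eq_mul]
  exact ((((hC n).measurable i j).const_mul _).const_add _).const_sub _

lemma nonempty_indices {n : ℕ} (hn : 1 ≤ n) : Nonempty (Finset.Icc 1 n) :=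
  ⟨⟨1, Finset.mem_Icc.2 ⟨le_rfl, hn⟩⟩⟩

omit [IsProbabilityMeasure P'] in
-- The Gaussian approximation at size `n` has as variance a Riemann sum over the diagonal entries,
-- which converges to the variance of the limit field.
lemma tendsto_charFun_linearPart (hx : IsNoise P x) (hC0 : 0 ≤ C)
    (hC : ∀ n, IsNoiseArray (P n) (entries x n) C) (hp : ProfileConvergence P lam x ε f σd σ)
    (hc : SpectrumNearCompact lam) (hZ : IsLimitField P' f σd Z) (hz : z.im ≠ 0) (t : ℂ) :
    Tendsto (fun n => charFun ((P n).map
        (IsNoiseArray.linearPart (entries x n) (eigs lam n) z)) t) atTop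
      (𝓝 (charFun (P'.map (Z (cauchyKernel z hz))) t)) := by
  obtain ⟨L, hprof⟩ := exists_isProfile hx hC hp hc
  rw [charFun_limitField hZ hz t hprof.aestronglyMeasurable_f hp.aestronglyMeasurable_diagVar
    (hp.ae_abs_diagVar_le hx hC)]
  set h : ℕ → ℕ → ℝ := fun n i =>
    (inner ℝ ((z - (lam n i : ℂ))⁻¹ ^ 2) t) ^ 2 * entryVar P x n i i with hh
  have hkernel : Continuous fun y : ℝ => (inner ℝ ((z - (y : ℂ))⁻¹ ^ 2) t) ^ 2 := by
    have h1 : Continuous fun y : ℝ => (z - (y : ℂ))⁻¹ :=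
      (continuous_const.sub Complex.continuous_ofReal).inv₀ fun y => sub_ofReal_ne_zero hz y
    exact ((h1.pow 2).inner continuous_const).pow 2
  have hriem : Tendsto (fun n : ℕ => (n : ℝ)⁻¹ * ∑ i ∈ Finset.Icc 1 n, h n i) atTop
      (𝓝 (limitVar f σd z t)) := by
    refine tendsto_riemann h _ (K := (|z.im|⁻¹ ^ 2 * ‖t‖) ^ 2 * (1 + C))
      (Eventually.of_forall fun n i hi => ?_) fun s hs => ?_
    · rw [hh, abs_mul, abs_pow]
      refine mul_le_mul (pow_le_pow_left₀ (abs_nonneg _) ?_ 2) (abs_entryVar_le hx hC n i hi i hi)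
        (abs_nonneg _) (by positivity)
      refine (abs_real_inner_le_norm _ _).trans ?_
      rw [norm_pow]
      have := norm_inv_sub_ofReal_le hz (lam n i)
      gcongr
    · exact ((hkernel.tendsto (f s)).comp (hp.spectrum s hs)).mul (hp.diagVar s hs)
  have hexp : Tendsto (fun n : ℕ =>
      (Real.exp (-((n : ℝ)⁻¹ * ∑ i ∈ Finset.Icc 1 n, h n i) / 2) : ℂ)) atTop
      (𝓝 (Real.exp (-limitVar f σd z t / 2) : ℂ)) :=
    (Complex.continuous_ofReal.tendsto _).comp
      ((Real.continuous_exp.tendsto _).comp (hriem.neg.div_const 2))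
  have hinv := tendsto_inv_atTop_nhds_zero_nat (𝕜 := ℝ)
  have hsqrt : Tendsto (fun n : ℕ => (√(n : ℝ))⁻¹) atTop (𝓝 0) :=
    tendsto_inv_atTop_zero.comp (Real.tendsto_sqrt_atTop.comp tendsto_natCast_atTop_atTop)
  have hdiff : Tendsto (fun n : ℕ => charFun ((P n).map
      (IsNoiseArray.linearPart (entries x n) (eigs lam n) z)) t
      - (Real.exp (-((n : ℝ)⁻¹ * ∑ i ∈ Finset.Icc 1 n, h n i) / 2) : ℂ)) atTop (𝓝 0) := by
    refine squeeze_zero_norm' (a := fun n : ℕ =>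
      4 * (|z.im|⁻¹ ^ 2 * ‖t‖) ^ 3 * (1 + C) * (√(n : ℝ))⁻¹
        + ((|z.im|⁻¹ ^ 2 * ‖t‖) ^ 2 * (1 + C)) ^ 2 * (n : ℝ)⁻¹) ?_
      (by simpa using (hsqrt.const_mul _).add (hinv.const_mul _))
    filter_upwards [eventually_ge_atTop 1] with n hn
    have := nonempty_indices hn
    have key := (hC n).norm_charFun_linearPart_sub_le hC0 (eigs lam n) hz t
    simp only [card_indices, ← entryVar_eq hx] at key
    rwa [← Finset.sum_coe_sort (Finset.Icc 1 n)]
  simpa using hdiff.add hexp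

/-- The fluctuations of `ΔG_n(z)` around a deterministic sequence which is close to the leading
deterministic part. -/
lemma tendstoInDistribution_deltaG_sub (hε : ∀ n, 1 ≤ n → 0 < ε n) (hx : IsNoise P x)
    (hp : ProfileConvergence P lam x ε f σd σ) (hc : SpectrumNearCompact lam)
    (hZ : IsLimitField P' f σd Z) (hz : z.im ≠ 0) (hε1 : Tendsto ε atTop (𝓝 0))
    (hε3 : Tendsto (fun n => ε n ^ 3 * n) atTop (𝓝 0)) (m : ℕ → ℂ)
    (hm : Tendsto (fun n : ℕ => n * ε n * stepB lam (entryVar P x) z n - m n) atTop (𝓝 0)) :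
    TendstoInDistribution
      (fun (n : ℕ) (ω : Ω n) => (n : ℂ) * (ε n : ℂ)⁻¹ * deltaG lam x ε z n ω - m n) atTop
      (Z (cauchyKernel z hz)) P P' := by
  obtain ⟨C, hC0, hC⟩ := hx.exists_isNoiseArray
  have hdecomp : ∀ n : ℕ, 1 ≤ n → ∀ ω, (n : ℂ) * (ε n : ℂ)⁻¹ * deltaG lam x ε z n ω - m n
      - IsNoiseArray.linearPart (entries x n) (eigs lam n) z ω
      = expansionError (P n) (entries x n) (eigs lam n) (ε n) z ω
        + (n * ε n * stepB lam (entryVar P x) z n - m n) := fun n hn ω => by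
    rw [scaled_deltaG_eq hx z hn]
    ring
  have herr : ∀ n : ℕ, 1 ≤ n → Integrable (expansionError (P n) (entries x n) (eigs lam n) (ε n) z)
      (P n) ∧ ∫ ω, ‖expansionError (P n) (entries x n) (eigs lam n) (ε n) z ω‖ ∂P n
        ≤ errorConst z C * (ε n + ε n ^ 3 * n) := fun n hn => by
    have := nonempty_indices hn
    simpa only [card_indices] using
      (hC n).integral_norm_expansionError_le hC0 (eigs lam n) (hε n hn) hz
  refine tendstoInDistribution_of_tendsto_charFun
    (T := fun n => IsNoiseArray.linearPart (entries x n) (eigs lam n) z)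
    (fun n => (((measurable_deltaG hC z n).const_mul _).sub_const _).aemeasurable)
    (fun n => ((hC n).measurable_linearPart _ _).aemeasurable)
    (hZ.gaussian.hasGaussianLaw_eval _).aemeasurable
    (tendsto_charFun_linearPart hx hC0 hC hp hc hZ hz) ?_ ?_
  · filter_upwards [eventually_ge_atTop 1] with n hn
    simp only [hdecomp n hn]
    exact (herr n hn).1.add (integrable_const _)
  · refine squeeze_zero' (Eventually.of_forall fun n => integral_nonneg fun _ => norm_nonneg _)
      (g := fun n : ℕ => errorConst z C * (ε n + ε n ^ 3 * n)
        + ‖n * ε n * stepB lam (entryVar P x) z n - m n‖) ?_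
      (by simpa using ((hε1.add hε3).const_mul (errorConst z C)).add hm.norm)
    filter_upwards [eventually_ge_atTop 1] with n hn
    simp only [hdecomp n hn]
    obtain ⟨hi, hb⟩ := herr n hn
    calc _ ≤ ∫ ω, (‖expansionError (P n) (entries x n) (eigs lam n) (ε n) z ω‖
          + ‖n * ε n * stepB lam (entryVar P x) z n - m n‖) ∂P n :=
        integral_mono (hi.add (integrable_const _)).norm (hi.norm.add (integrable_const _))
          fun ω => norm_add_le _ _
      _ ≤ _ := by
        rw [integral_add hi.norm (integrable_const _)]
        simpa using hb

/-- One constant serves both bounds. After multiplication by `n ε` the boundary term `1 / n` becomes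
`ε`, so only the mean profile error needs a rate. -/
lemma norm_stepB_sub_limitB_le_meanProfileError (hx : IsNoise P x)
    (hp : ProfileConvergence P lam x ε f σd σ) (hc : SpectrumNearCompact lam) (hz : z.im ≠ 0) :
    ∃ K : ℝ, ∀ n : ℕ, 1 ≤ n → ‖stepB lam (entryVar P x) z n‖ ≤ K ∧
      ‖stepB lam (entryVar P x) z n - limitB f σ z‖
        ≤ K * (meanProfileError P lam x f σ n + 1 / n) := by
  obtain ⟨C, hC0, hC⟩ := hx.exists_isNoiseArray
  obtain ⟨L, hprof⟩ := exists_isProfile hx hC hp hc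
  have hM := hprof.bound_nonneg
  set a := |z.im|⁻¹ ^ 3 * (1 + C)
  set b := |z.im|⁻¹ ^ 3 + 4 * |z.im|⁻¹ ^ 4 * (1 + C)
  have ha : 0 ≤ a := by positivity
  have hb : 0 ≤ b := by positivity
  refine ⟨4 * a + b, fun n hn => ⟨(hprof.norm_stepB_le hz hn).trans (by linarith), ?_⟩⟩
  refine (hprof.norm_stepB_sub_limitB_le hz hn).trans ?_
  have he : 0 ≤ meanProfileError P lam x f σ n :=
    add_nonneg (integral_nonneg fun _ => abs_nonneg _) (integral_nonneg fun _ => abs_nonneg _)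
  change b * meanProfileError P lam x f σ n + 4 * a / n ≤ _
  have h1 : 0 ≤ 4 * a * meanProfileError P lam x f σ n := by positivity
  have h2 : 0 ≤ b * (1 / (n : ℝ)) := by positivity
  have h3 : 4 * a / (n : ℝ) = 4 * a * (1 / n) := by ring
  rw [h3]
  linarith

lemma tendsto_stepB (hx : IsNoise P x) (hp : ProfileConvergence P lam x ε f σd σ)
    (hc : SpectrumNearCompact lam) (hz : z.im ≠ 0) :
    Tendsto (stepB lam (entryVar P x) z) atTop (𝓝 (limitB f σ z)) := by
  obtain ⟨C, hC0, hC⟩ := hx.exists_isNoiseArray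
  obtain ⟨L, hprof⟩ := exists_isProfile hx hC hp hc
  obtain ⟨K, hK⟩ := norm_stepB_sub_limitB_le_meanProfileError hx hp hc hz
  have herr : Tendsto (meanProfileError P lam x f σ) atTop (𝓝 0) := hprof.tendsto_error
  rw [tendsto_iff_norm_sub_tendsto_zero]
  refine squeeze_zero' (Eventually.of_forall fun n => norm_nonneg _)
    ((eventually_ge_atTop 1).mono fun n hn => (hK n hn).2) ?_
  simpa using (herr.add tendsto_one_div_atTop_nhds_zero_nat).const_mul K

/-- If `n ε_n` converges then `n ε_n⁻¹ ΔG_n(z)` has Gaussian fluctuations around the limit of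
`n ε_n B(z)`. -/
lemma tendstoInDistribution_of_tendsto_mul (hε : ∀ n, 1 ≤ n → 0 < ε n) (hx : IsNoise P x)
    (hp : ProfileConvergence P lam x ε f σd σ) (hc : SpectrumNearCompact lam)
    (hZ : IsLimitField P' f σd Z) (hz : z.im ≠ 0) {c : ℝ}
    (hεc : Tendsto (fun n : ℕ => (n : ℝ) * ε n) atTop (𝓝 c)) :
    TendstoInDistribution
      (fun (n : ℕ) (ω : Ω n) => (n : ℂ) * (ε n : ℂ)⁻¹ * deltaG lam x ε z n ω - c * limitB f σ z)
      atTop (Z (cauchyKernel z hz)) P P' := by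
  have hε1 : Tendsto ε atTop (𝓝 0) := by
    have := hεc.mul (tendsto_inv_atTop_nhds_zero_nat (𝕜 := ℝ))
    rw [mul_zero] at this
    refine this.congr' ?_
    filter_upwards [eventually_ge_atTop 1] with n hn
    have : (n : ℝ) ≠ 0 := by exact_mod_cast (by omega : n ≠ 0)
    field_simp
  have hε3 : Tendsto (fun n => ε n ^ 3 * n) atTop (𝓝 0) := by
    have := hεc.mul (hε1.pow 2)
    simp only [ne_eq, OfNat.ofNat_ne_zero, not_false_eq_true, zero_pow, mul_zero] at this
    exact this.congr fun n => by ring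
  refine tendstoInDistribution_deltaG_sub hε hx hp hc hZ hz hε1 hε3 (fun _ => c * limitB f σ z) ?_
  have h1 := ((Complex.continuous_ofReal.tendsto _).comp hεc).mul (tendsto_stepB hx hp hc hz)
  have h2 := h1.sub_const ((c : ℂ) * limitB f σ z)
  rw [sub_self] at h2
  exact h2.congr fun n => by simp

end Regimes

end PerturbedDiagonal

end

theorem mainTheorem2
    {Ω : ℕ → Type*} [∀ n, MeasurableSpace (Ω n)]
    (P : (n : ℕ) → Measure (Ω n)) [∀ n, IsProbabilityMeasure (P n)]
    (lam : ℕ → ℕ → ℝ) (x : (n : ℕ) → ℕ → ℕ → Ω n → ℂ) (ε : ℕ → ℝ)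
    (hε : ∀ n, 1 ≤ n → 0 < ε n)
    (f σd : ℝ → ℝ) (σ : ℝ → ℝ → ℝ)
    (hx : PerturbedDiagonal.IsNoise P x)
    (hprofile : PerturbedDiagonal.ProfileConvergence P lam x ε f σd σ)
    (hcompact : PerturbedDiagonal.SpectrumNearCompact lam)
    {Ω' : Type*} [MeasurableSpace Ω'] (P' : Measure Ω') [IsProbabilityMeasure P']
    (Z : PerturbedDiagonal.C6 → Ω' → ℂ)
    (hZ : PerturbedDiagonal.IsLimitField P' f σd Z) :
    -- perturbative regime
    ((ε =o[atTop] fun n : ℕ => (n : ℝ)⁻¹) →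
      ∀ (z : ℂ) (hz : z.im ≠ 0),
        TendstoInDistribution
          (fun (n : ℕ) (ω : Ω n) => (n : ℂ) * (ε n : ℂ)⁻¹ * PerturbedDiagonal.deltaG lam x ε z n ω)
          atTop
          (Z (PerturbedDiagonal.cauchyKernel z hz)) P P') ∧
    -- critical regime
    (∀ c : ℝ, 0 < c → (ε ~[atTop] fun n : ℕ => c / (n : ℝ)) →
      ∀ (z : ℂ) (hz : z.im ≠ 0),
        TendstoInDistribution
          (fun (n : ℕ) (ω : Ω n) => (n : ℂ) * (ε n : ℂ)⁻¹ * PerturbedDiagonal.deltaG lam x ε z n ω)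
          atTop
          (fun ω => (c : ℂ) * PerturbedDiagonal.limitB f σ z
            + Z (PerturbedDiagonal.cauchyKernel z hz) ω) P P') ∧
    -- semi-perturbative regime, fluctuations
    (((fun n : ℕ => (n : ℝ)⁻¹) =o[atTop] ε) →
      (ε =o[atTop] fun n : ℕ => (n : ℝ) ^ (-(1 / 3) : ℝ)) →
      Tendsto (fun n : ℕ => n * ε n * PerturbedDiagonal.meanProfileError P lam x f σ n)
        atTop (𝓝 0) →
      ∀ (z : ℂ) (hz : z.im ≠ 0),
        TendstoInDistribution
          (fun (n : ℕ) (ω : Ω n) => (n : ℂ) * (ε n : ℂ)⁻¹ *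
            (PerturbedDiagonal.deltaG lam x ε z n ω
              - (ε n : ℂ) ^ 2 * PerturbedDiagonal.limitB f σ z))
          atTop
          (Z (PerturbedDiagonal.cauchyKernel z hz)) P P') ∧
    -- semi-perturbative regime, convergence in probability
    (((fun n : ℕ => (n : ℝ)⁻¹) =o[atTop] ε) →
      (ε =o[atTop] fun _ : ℕ => (1 : ℝ)) →
      ∀ z : ℂ, z.im ≠ 0 →
        PerturbedDiagonal.TendstoZeroInProbability P
          (fun (n : ℕ) (ω : Ω n) => ((ε n : ℂ) ^ 2)⁻¹ * PerturbedDiagonal.deltaG lam x ε z n ω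
            - PerturbedDiagonal.limitB f σ z)) := by
  have hZm : ∀ φ, AEMeasurable (Z φ) P' := fun φ =>
    (hZ.gaussian.hasGaussianLaw_eval φ).aemeasurable
  have hn0 : ∀ᶠ n : ℕ in atTop, (n : ℝ) ≠ 0 := by
    filter_upwards [eventually_ge_atTop 1] with n hn
    exact_mod_cast (by omega : n ≠ 0)
  refine ⟨fun hsmall z hz => ?_, fun c hc hcrit z hz => ?_, fun hlarge hsmall hmean z hz => ?_,
    fun hlarge hsmall z hz => ?_⟩
  -- This is the case `c = 0`, in which the deterministic part disappears.
  · have hεc : Tendsto (fun n : ℕ => (n : ℝ) * ε n) atTop (𝓝 0) := by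
      refine hsmall.tendsto_div_nhds_zero.congr fun n => ?_
      rw [div_inv_eq_mul, mul_comm]
    simpa using PerturbedDiagonal.tendstoInDistribution_of_tendsto_mul hε hx hprofile hcompact hZ
      hz hεc
  · have hεc : Tendsto (fun n : ℕ => (n : ℝ) * ε n) atTop (𝓝 c) := by
      have h1 := (isEquivalent_iff_tendsto_one (by
        filter_upwards [hn0] with n hn using div_ne_zero hc.ne' hn)).1 hcrit
      have h2 := h1.const_mul c
      rw [mul_one] at h2
      refine h2.congr' ?_
      filter_upwards [hn0] with n hn
      simp only [Pi.div_apply]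
      field_simp
    have := (PerturbedDiagonal.tendstoInDistribution_of_tendsto_mul hε hx hprofile hcompact hZ
      hz hεc).continuous_comp (g := fun w => (c : ℂ) * PerturbedDiagonal.limitB f σ z + w)
      (by fun_prop)
    simpa [Function.comp_def] using this
  · have hn3 : Tendsto (fun n : ℕ => (n : ℝ) ^ (-(1 / 3) : ℝ)) atTop (𝓝 0) :=
      (tendsto_rpow_neg_atTop (by norm_num)).comp tendsto_natCast_atTop_atTop
    have hε1 : Tendsto ε atTop (𝓝 0) := hsmall.isBigO.trans_tendsto hn3
    -- The exponent `1/3` is what makes the error term `ε³ n` vanish.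
    have hε3 : Tendsto (fun n => ε n ^ 3 * n) atTop (𝓝 0) := by
      have h1 := hsmall.tendsto_div_nhds_zero.pow 3
      simp only [ne_eq, OfNat.ofNat_ne_zero, not_false_eq_true, zero_pow] at h1
      refine h1.congr' ?_
      filter_upwards [eventually_ge_atTop 1] with n hn
      have hn' : (0 : ℝ) ≤ n := Nat.cast_nonneg n
      rw [div_pow, ← Real.rpow_natCast ((n : ℝ) ^ (-(1 / 3) : ℝ)), ← Real.rpow_mul hn']
      norm_num [Real.rpow_neg_one]
    obtain ⟨K, hK⟩ := PerturbedDiagonal.norm_stepB_sub_limitB_le_meanProfileError hx hprofile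
      hcompact hz
    have hm : Tendsto (fun n : ℕ =>
        n * ε n * PerturbedDiagonal.stepB lam (PerturbedDiagonal.entryVar P x) z n
          - n * ε n * PerturbedDiagonal.limitB f σ z) atTop (𝓝 0) := by
      refine squeeze_zero_norm' (a := fun n : ℕ =>
        K * (n * ε n * PerturbedDiagonal.meanProfileError P lam x f σ n + ε n)) ?_
        (by simpa using (hmean.add hε1).const_mul K)
      filter_upwards [eventually_ge_atTop 1, hn0] with n hn hn'
      rw [← mul_sub, norm_mul, norm_mul, Complex.norm_natCast, Complex.norm_real,
        Real.norm_of_nonneg (hε n hn).le]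
      have := mul_le_mul_of_nonneg_left (hK n hn).2
        (mul_nonneg (Nat.cast_nonneg n) (hε n hn).le : 0 ≤ (n : ℝ) * ε n)
      refine this.trans_eq ?_
      field_simp
    refine (PerturbedDiagonal.tendstoInDistribution_deltaG_sub hε hx hprofile hcompact hZ hz hε1 hε3
      _ hm).congr (fun n => ?_) (ae_eq_refl _)
    -- At `n = 0` nothing is known about `ε`, but the prefactor `n` makes both sides zero.
    rcases Nat.eq_zero_or_pos n with rfl | hn
    · simp
    · have hε' : (ε n : ℂ) ≠ 0 := by exact_mod_cast (hε n hn).ne'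
      refine ae_of_all _ fun ω => ?_
      field_simp
  · obtain ⟨C, hC0, hC⟩ := hx.exists_isNoiseArray
    have hε1 : Tendsto ε atTop (𝓝 0) := by simpa using hsmall.tendsto_div_nhds_zero
    have hinv : Tendsto (fun n : ℕ => ((n : ℝ) * ε n)⁻¹) atTop (𝓝 0) := by
      refine hlarge.tendsto_div_nhds_zero.congr fun n => ?_
      rw [mul_inv, div_eq_mul_inv]
    have hnn := tendsto_inv_atTop_nhds_zero_nat (𝕜 := ℝ)
    have hstep := PerturbedDiagonal.tendsto_stepB hx hprofile hcompact hz
    rw [tendsto_iff_norm_sub_tendsto_zero] at hstep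
    set T : (n : ℕ) → Ω n → ℂ := fun n => PerturbedDiagonal.IsNoiseArray.linearPart
      (PerturbedDiagonal.entries x n) (PerturbedDiagonal.eigs lam n) z
    set E : (n : ℕ) → Ω n → ℂ := fun n => PerturbedDiagonal.expansionError (P n)
      (PerturbedDiagonal.entries x n) (PerturbedDiagonal.eigs lam n) (ε n) z
    set b := PerturbedDiagonal.stepB lam (PerturbedDiagonal.entryVar P x) z
    set B := PerturbedDiagonal.limitB f σ z
    set K := PerturbedDiagonal.errorConst z C
    set K' := √((|z.im|⁻¹ ^ 2) ^ 2 * (1 + C))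
    -- The scaling `ε⁻²` is `n / ε` divided by `n ε`, so the Gaussian part and the error acquire the
    -- vanishing factor `(n ε)⁻¹`.
    have hdecomp : ∀ n : ℕ, 1 ≤ n → ∀ ω, ((ε n : ℂ) ^ 2)⁻¹ * PerturbedDiagonal.deltaG lam x ε z n ω - B
        = (((n * ε n)⁻¹ : ℝ) : ℂ) * (T n ω + E n ω) + (b n - B) := fun n hn ω => by
      have hn' : (n : ℂ) ≠ 0 := by exact_mod_cast (by omega : n ≠ 0)
      have hε' : (ε n : ℂ) ≠ 0 := by exact_mod_cast (hε n hn).ne'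
      have h1 := PerturbedDiagonal.scaled_deltaG_eq (lam := lam) (ε := ε) hx z hn ω
      have h2 : T n ω + E n ω = (n : ℂ) * (ε n : ℂ)⁻¹ * PerturbedDiagonal.deltaG lam x ε z n ω
          - n * ε n * b n := by
        rw [h1]; ring
      rw [h2]
      push_cast
      field_simp
      ring
    have hT : ∀ n : ℕ, 1 ≤ n → Integrable (T n) (P n) ∧ ∫ ω, ‖T n ω‖ ∂P n ≤ K' := fun n hn => by
      have := PerturbedDiagonal.nonempty_indices hn
      exact (hC n).integral_norm_linearPart_le hC0 _ hz
    have hE : ∀ n : ℕ, 1 ≤ n → Integrable (E n) (P n) ∧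
        ∫ ω, ‖E n ω‖ ∂P n ≤ K * (ε n + ε n ^ 3 * n) := fun n hn => by
      have := PerturbedDiagonal.nonempty_indices hn
      simpa only [PerturbedDiagonal.card_indices] using
        (hC n).integral_norm_expansionError_le hC0 (PerturbedDiagonal.eigs lam n) (hε n hn) hz
    refine PerturbedDiagonal.tendstoZeroInProbability_of_integral ?_ ?_
    · filter_upwards [eventually_ge_atTop 1] with n hn
      simp only [hdecomp n hn]
      exact (((hT n hn).1.add (hE n hn).1).const_mul _).add (integrable_const _)
    · refine squeeze_zero' (Eventually.of_forall fun n => integral_nonneg fun _ => norm_nonneg _)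
        -- Divided by `n ε`, the error bound `ε + ε³ n` becomes `1/n + ε²`; hence `ε → 0` suffices
        -- for it.
        (g := fun n : ℕ => ((n : ℝ) * ε n)⁻¹ * K' + K * ((n : ℝ)⁻¹ + ε n ^ 2) + ‖b n - B‖) ?_
        (by simpa using ((hinv.mul_const K').add ((hnn.add (hε1.pow 2)).const_mul K)).add hstep)
      filter_upwards [eventually_ge_atTop 1, hn0] with n hn hn'
      obtain ⟨iT, bT⟩ := hT n hn
      obtain ⟨iE, bE⟩ := hE n hn
      have hεn := hε n hn
      have hpos : 0 ≤ ((n : ℝ) * ε n)⁻¹ := by positivity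
      simp only [hdecomp n hn]
      have iTE : Integrable (fun ω => ((n : ℝ) * ε n)⁻¹ * (‖T n ω‖ + ‖E n ω‖)) (P n) :=
        (iT.norm.add iE.norm).const_mul _
      calc _ ≤ ∫ ω, (((n : ℝ) * ε n)⁻¹ * (‖T n ω‖ + ‖E n ω‖) + ‖b n - B‖) ∂P n := by
            refine integral_mono (((iT.add iE).const_mul _).add (integrable_const _)).norm
              (iTE.add (integrable_const _)) fun ω => ?_
            refine (norm_add_le _ _).trans (add_le_add_left ?_ _)
            rw [norm_mul, Complex.norm_real, Real.norm_of_nonneg hpos]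
            exact mul_le_mul_of_nonneg_left (norm_add_le _ _) hpos
        _ = ((n : ℝ) * ε n)⁻¹ * ((∫ ω, ‖T n ω‖ ∂P n) + ∫ ω, ‖E n ω‖ ∂P n) + ‖b n - B‖ := by
            rw [integral_add iTE (integrable_const _), integral_const_mul,
              integral_add iT.norm iE.norm]
            simp
        _ ≤ ((n : ℝ) * ε n)⁻¹ * (K' + K * (ε n + ε n ^ 3 * n)) + ‖b n - B‖ := by gcongr
        _ = _ := by
            field_simp
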